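/- **Conventions.** All manifolds are smooth, Hausdorff and connected; $(M,g)$ is a pseudo-Riemannian manifold of dimension $n$ with contravariant metric $G=g^{-1}$. $S^2(M)$ is the space of smooth symmetric contravariant $2$-tensor fields; $K\in S^2(M)$ also denotes the endomorphism of $TM$ (and of $T^*M$) obtained by lowering an index with $g$. $K$ is a *Killing tensor* if its Schouten bracket with the metric vanishes, $[K,G]=0$. It is a *characteristic Killing tensor* (ChKT) if moreover at each point it has $n$ distinct real eigenvalues and around each point there are local coordinates whose coordinate vector fields are eigenvector fields of $K$. A *Killing–Stäckel space* (KS-space) associated with a ChKT $K$ is an $n$-dimensional real vector space of Killing tensors on $M$ that are diagonalized by the eigenspaces of $K$ (every eigenvector of $K$ is an eigenvector of each of them). A non-degenerate distribution $D$ is *Killing* if it is spherical, i.e. there is a section $H$ of $D^\perp$ with $(\nabla_XY)^{D^\perp}=\langle X,Y\rangle H$ and $(\nabla_XH)^{D^\perp}=0$ for all sections $X,Y$ of $D$, and if $D^\perp$ is geodesic, i.e. $(\nabla_XY)^{D}=0$ for all sections $X,Y$ of $D^\perp$. **Proposition (the Killing–Stäckel space of a reducible separable web).** Let $K$ be a ChKT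 on $M$ with associated KS-space $\mathcal K$, and let $D$ be a $K$-invariant Killing distribution on $M$. Let $B\times_\rho F$, with $\dim F>0$ and $\rho:B\to\mathbb R^+$ smooth, be a local warped product adapted to $(D^\perp,D)$; that is, $(B,g_B)$ and $(F,g_F)$ are pseudo-Riemannian manifolds, and $B\times F$ is identified by a diffeomorphism with an open subset $U\subseteq M$ such that $g|_U=g_B+\rho^2g_F$ (equivalently $G|_U=G_B+\rho^{-2}G_F$), the slices $B\times\{y\}$ are integral manifolds of $D^\perp$ and the slices $\{x\}\times F$ are integral manifolds of $D$. Then there are KS-spaces $\mathcal K_B$ on $B$ and $\mathcal K_F$ on $F$ (each associated with some ChKT of $B$, respectively $F$, and so of dimension $\dim B$, respectively $\dim F$) such that a contravariant $2$-tensor field $L$ on $U$ belongs to $\mathcal K|_U$ if and only if there exist $L_B\in\mathcal K_B$, $L_F\in\mathcal K_F$ and a smooth function $l$ on $B$ with $$L=L_B+l\,G_F+L_F,\qquad dl=L_B\,d\rho^{-2},$$ where tensors and functions on $B$ and $F$ are lifted to $B\times F=U$. -/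

import Mathlib

open scoped Manifold ContDiff

noncomputable section

namespace KillingStackel

/-- The tangent space at a point of an `n`-dimensional manifold. -/
abbrev Tan (n : ℕ) {M : Type*} [TopologicalSpace M] [ChartedSpace (EuclideanSpace ℝ (Fin n)) M]
    (x : M) : Type :=
  TangentSpace (𝓡 n) x

/-- The cotangent space at a point of an `n`-dimensional manifold. -/
abbrev Cotan (n : ℕ) {M : Type*} [TopologicalSpace M]
    [ChartedSpace (EuclideanSpace ℝ (Fin n)) M] (x : M) : Type :=
  Tan n x →L[ℝ] ℝ

/-- A field of contravariant 2-tensors, not necessarily smooth or symmetric. The tensor `K` at `x`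
is given as the linear map `α ↦ K(·, α)` from `T*ₓM` to `TₓM`, so that `K(α, β) = α (K x β)`. -/
abbrev ContraField (n : ℕ) (M : Type*) [TopologicalSpace M]
    [ChartedSpace (EuclideanSpace ℝ (Fin n)) M] : Type _ :=
  ∀ x : M, Cotan n x →ₗ[ℝ] Tan n x

section Manifold

variable {n : ℕ} {M : Type*} [TopologicalSpace M] [ChartedSpace (EuclideanSpace ℝ (Fin n)) M]

/-- A smooth real-valued function on an `n`-dimensional manifold. -/
def SmoothFn (n : ℕ) {M : Type*} [TopologicalSpace M]
    [ChartedSpace (EuclideanSpace ℝ (Fin n)) M] (f : M → ℝ) : Prop :=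
  ContMDiff (𝓡 n) 𝓘(ℝ, ℝ) ∞ f

/-- The function `K(df, dh)`. -/
def ContraField.pair (K : ContraField n M) (f h : M → ℝ) (x : M) : ℝ :=
  mvfderiv (𝓡 n) f x (K x (mvfderiv (𝓡 n) h x))

/-- The space `S²(M)` of smooth symmetric contravariant 2-tensor fields. Smoothness means that
`K(df, dh)` is smooth for all smooth functions `f`, `h`. -/
def SymTensor (n : ℕ) (M : Type*) [TopologicalSpace M]
    [ChartedSpace (EuclideanSpace ℝ (Fin n)) M] : Submodule ℝ (ContraField n M) where
  carrier := {K | (∀ (x : M) (α β : Cotan n x), α (K x β) = β (K x α)) ∧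
    ∀ f h : M → ℝ, SmoothFn n f → SmoothFn n h → SmoothFn n (K.pair f h)}
  add_mem' := by
    rintro K L ⟨hK, hK'⟩ ⟨hL, hL'⟩
    refine ⟨fun x α β => by simp [hK x α β, hL x α β], fun f h hf hh => ?_⟩
    have : ContraField.pair (K + L) f h = fun x => K.pair f h x + L.pair f h x := by
      funext x; simp [ContraField.pair]
    rw [this]
    exact ContMDiff.add (hK' f h hf hh) (hL' f h hf hh)
  zero_mem' := by
    refine ⟨fun x α β => by simp, fun f h _ _ => ?_⟩
    have : ContraField.pair (0 : ContraField n M) f h = fun _ => (0 : ℝ) := by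
      funext x; simp [ContraField.pair]
    rw [this]
    exact contMDiff_const
  smul_mem' := by
    rintro c K ⟨hK, hK'⟩
    refine ⟨fun x α β => by simp [hK x α β], fun f h hf hh => ?_⟩
    have : ContraField.pair (c • K) f h = fun x => c * K.pair f h x := by
      funext x; simp [ContraField.pair]
    rw [this]
    exact ContMDiff.mul contMDiff_const (hK' f h hf hh)

/-- A (covariant) pseudo-Riemannian metric. -/
structure PseudoRiemannianMetric (n : ℕ) (M : Type*) [TopologicalSpace M]
    [ChartedSpace (EuclideanSpace ℝ (Fin n)) M] [IsManifold (𝓡 n) ∞ M] where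
  val : ∀ x : M, TangentSpace (𝓡 n) x →L[ℝ] TangentSpace (𝓡 n) x →L[ℝ] ℝ
  symm : ∀ (x : M) (v w : Tan n x), val x v w = val x w v
  nondegenerate : ∀ (x : M) (v : Tan n x), (∀ w, val x v w = 0) → v = 0
  smooth : ContMDiff (𝓡 n)
    ((𝓡 n).prod 𝓘(ℝ, EuclideanSpace ℝ (Fin n) →L[ℝ] EuclideanSpace ℝ (Fin n) →L[ℝ] ℝ)) ∞
    (fun x => Bundle.TotalSpace.mk'
      (EuclideanSpace ℝ (Fin n) →L[ℝ] EuclideanSpace ℝ (Fin n) →L[ℝ] ℝ)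
      (E := fun x : M => TangentSpace (𝓡 n) x →L[ℝ] TangentSpace (𝓡 n) x →L[ℝ] ℝ) x (val x))

theorem bijective_of_nondegenerate {n : ℕ}
    (b : EuclideanSpace ℝ (Fin n) →L[ℝ] EuclideanSpace ℝ (Fin n) →L[ℝ] ℝ)
    (hb : ∀ v, (∀ w, b v w = 0) → v = 0) : Function.Bijective b := by
  have inj : Function.Injective b.toLinearMap := by
    rw [← LinearMap.ker_eq_bot, LinearMap.ker_eq_bot']
    intro v hv
    refine hb v fun w => ?_
    have : b v = 0 := hv
    simp [this]
  have e : Module.finrank ℝ (EuclideanSpace ℝ (Fin n)) =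
      Module.finrank ℝ (EuclideanSpace ℝ (Fin n) →L[ℝ] ℝ) := by
    rw [← (LinearMap.toContinuousLinearMap
      (𝕜 := ℝ) (E := EuclideanSpace ℝ (Fin n)) (F' := ℝ)).finrank_eq]
    exact (Subspace.dual_finrank_eq (K := ℝ) (V := EuclideanSpace ℝ (Fin n))).symm
  exact ⟨inj, (LinearMap.injective_iff_surjective_of_finrank_eq_finrank e).1 inj⟩

variable [IsManifold (𝓡 n) ∞ M]

namespace PseudoRiemannianMetric

/-- The musical isomorphism `v ↦ g(v, ·)`. -/
def flat (g : PseudoRiemannianMetric n M) (x : M) : Tan n x ≃ₗ[ℝ] Cotan n x :=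
  LinearEquiv.ofBijective (g.val x).toLinearMap
    (bijective_of_nondegenerate (g.val x) (g.nondegenerate x))

/-- The contravariant metric `G`, the inverse of `g`. -/
def contra (g : PseudoRiemannianMetric n M) : ContraField n M :=
  fun x => (g.flat x).symm.toLinearMap

end PseudoRiemannianMetric

/-- The Schouten bracket `[K, L]` of two symmetric contravariant 2-tensors, evaluated on
`(df, df, df)`. The second derivatives of `f` cancel, so this is the cubic form
`2 (K^{il} ∂_l L^{jk} - L^{il} ∂_l K^{jk}) f_i f_j f_k`, which determines the symmetric 3-tensor
`[K, L]`. -/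
def schouten (K L : ContraField n M) (f : M → ℝ) (x : M) : ℝ :=
  2 * (K.pair f (L.pair f f) x - L.pair f (K.pair f f) x)

/-- Killing 2-tensors: `[K, G] = 0`. -/
def IsKilling (g : PseudoRiemannianMetric n M) (K : SymTensor n M) : Prop :=
  ∀ f : M → ℝ, SmoothFn n f → ∀ x : M, schouten K.1 g.contra f x = 0

/-- The endomorphism of `TₓM` associated with a contravariant 2-tensor by lowering an index. -/
def endo (g : PseudoRiemannianMetric n M) (K : ContraField n M) (x : M) :
    Tan n x →ₗ[ℝ] Tan n x :=
  K x ∘ₗ (g.flat x).toLinearMap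

/-- All eigenvalues are real and simple: there are `n` distinct real eigenvalues. -/
def HasSimpleEigenvalues (g : PseudoRiemannianMetric n M) (K : ContraField n M) (x : M) : Prop :=
  ∃ (b : Module.Basis (Fin n) ℝ (Tan n x)) (μ : Fin n → ℝ),
    Function.Injective μ ∧ ∀ i, endo g K x (b i) = μ i • b i

/-- The eigenspaces (assumed to be lines) form an integrable net: around every point there are
local coordinates all of whose coordinate vector fields are eigenvector fields of `K`. -/
def HasIntegrableEigenspaces (g : PseudoRiemannianMetric n M) (K : ContraField n M) : Prop :=
  ∀ p : M, ∃ φ : PartialDiffeomorph (𝓡 n) (𝓡 n) (EuclideanSpace ℝ (Fin n)) M ∞,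
    p ∈ φ.target ∧ ∀ q ∈ φ.source, ∀ i : Fin n, ∃ μ : ℝ,
      endo g K (φ q) (mfderiv (𝓡 n) (𝓡 n) φ q (EuclideanSpace.single i (1 : ℝ))) =
        μ • mfderiv (𝓡 n) (𝓡 n) φ q (EuclideanSpace.single i (1 : ℝ))

/-- Characteristic Killing tensors: Killing tensors with simple eigenfunctions and orthogonally
integrable eigenspaces. -/
structure IsCharacteristic (g : PseudoRiemannianMetric n M) (K : SymTensor n M) : Prop where
  killing : IsKilling g K
  simple : ∀ x : M, HasSimpleEigenvalues g K.1 x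
  integrable : HasIntegrableEigenspaces g K.1

/-- `𝒦` is the Killing–Stäckel space associated with (the web of) the characteristic Killing
tensor `K`: an `n`-dimensional space of Killing tensors which are diagonalized in the web formed
by the eigenspaces of `K`. -/
structure IsKSSpaceOf (g : PseudoRiemannianMetric n M) (K : SymTensor n M)
    (𝒦 : Submodule ℝ (SymTensor n M)) : Prop where
  killing : ∀ L ∈ 𝒦, IsKilling g L
  diagonal : ∀ L ∈ 𝒦, ∀ (x : M) (v : Tan n x) (μ : ℝ), endo g K.1 x v = μ • v →
    ∃ ν : ℝ, endo g L.1 x v = ν • v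
  finrank_eq : Module.finrank ℝ 𝒦 = n

/-- `𝒦` is a Killing–Stäckel space: the one associated with some characteristic Killing tensor. -/
def IsKSSpace (g : PseudoRiemannianMetric n M) (𝒦 : Submodule ℝ (SymTensor n M)) : Prop :=
  ∃ K : SymTensor n M, IsCharacteristic g K ∧ IsKSSpaceOf g K 𝒦

/-- Smooth sections of a field `E` of subspaces of the tangent spaces. -/
def IsSection (E : ∀ x : M, Submodule ℝ (Tan n x)) (X : ∀ x : M, Tan n x) : Prop :=
  ContMDiff (𝓡 n) (𝓡 n).tangent ∞ (fun x => (⟨x, X x⟩ : TangentBundle (𝓡 n) M)) ∧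
    ∀ x, X x ∈ E x

/-- Smooth distributions of constant rank (vector subbundles of the tangent bundle). -/
structure IsDistribution (E : ∀ x : M, Submodule ℝ (Tan n x)) : Prop where
  rank_const : ∃ m : ℕ, ∀ x, Module.finrank ℝ (E x) = m
  smooth : ∀ (x : M), ∀ v ∈ E x, ∃ X, IsSection E X ∧ X x = v

/-- The orthogonal complement of a distribution. -/
def orth (g : PseudoRiemannianMetric n M) (E : ∀ x : M, Submodule ℝ (Tan n x)) (x : M) :
    Submodule ℝ (Tan n x) where
  carrier := {v | ∀ w ∈ E x, g.val x w v = 0}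
  add_mem' := by
    intro a b ha hb w hw
    simp [ha w hw, hb w hw]
  zero_mem' := by
    intro w _
    simp
  smul_mem' := by
    intro c a ha w hw
    simp [ha w hw]

/-- `⟨∇_X Y, Z⟩` for the Levi-Civita connection `∇`, by the Koszul formula. -/
def leviCivita (g : PseudoRiemannianMetric n M) (X Y Z : ∀ x : M, Tan n x) (x : M) : ℝ :=
  (mvfderiv (𝓡 n) (fun p => g.val p (Y p) (Z p)) x (X x)
    + mvfderiv (𝓡 n) (fun p => g.val p (X p) (Z p)) x (Y x)
    - mvfderiv (𝓡 n) (fun p => g.val p (X p) (Y p)) x (Z x)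
    + g.val x (VectorField.mlieBracket (𝓡 n) X Y x) (Z x)
    - g.val x (VectorField.mlieBracket (𝓡 n) X Z x) (Y x)
    - g.val x (VectorField.mlieBracket (𝓡 n) Y Z x) (X x)) / 2

/-- Geodesic distributions: `(∇_X Y)^{E^⊥} = 0` for sections `X`, `Y` of `E`. -/
def IsGeodesicDistribution (g : PseudoRiemannianMetric n M)
    (E : ∀ x : M, Submodule ℝ (Tan n x)) : Prop :=
  ∀ X Y Z, IsSection E X → IsSection E Y → IsSection (orth g E) Z →
    ∀ x, leviCivita g X Y Z x = 0

/-- Spherical distributions: there is a section `H` of `E^⊥` (the mean curvature normal) with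
`(∇_X Y)^{E^⊥} = ⟨X, Y⟩ H` and `(∇_X H)^{E^⊥} = 0` for all sections `X`, `Y` of `E`. -/
def IsSphericalDistribution (g : PseudoRiemannianMetric n M)
    (E : ∀ x : M, Submodule ℝ (Tan n x)) : Prop :=
  ∃ H, IsSection (orth g E) H ∧
    (∀ X Y Z, IsSection E X → IsSection E Y → IsSection (orth g E) Z →
      ∀ x, leviCivita g X Y Z x = g.val x (X x) (Y x) * g.val x (H x) (Z x)) ∧
    (∀ X Z, IsSection E X → IsSection (orth g E) Z → ∀ x, leviCivita g X H Z x = 0)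

/-- Killing distributions: non-degenerate spherical distributions whose orthogonal complement is
geodesic. -/
structure IsKillingDistribution (g : PseudoRiemannianMetric n M)
    (D : ∀ x : M, Submodule ℝ (Tan n x)) : Prop where
  distribution : IsDistribution D
  nondegenerate : ∀ x, D x ⊓ orth g D x = ⊥
  spherical : IsSphericalDistribution g D
  orth_geodesic : IsGeodesicDistribution g (orth g D)

/-- `K`-invariance of a distribution. -/
def IsInvariant (g : PseudoRiemannianMetric n M) (K : SymTensor n M)
    (D : ∀ x : M, Submodule ℝ (Tan n x)) : Prop :=
  ∀ (x : M), ∀ v ∈ D x, endo g K.1 x v ∈ D x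

end Manifold

section WarpedProduct

variable {n b k : ℕ}
  {M : Type*} [TopologicalSpace M] [ChartedSpace (EuclideanSpace ℝ (Fin n)) M]
  {B : Type*} [TopologicalSpace B] [ChartedSpace (EuclideanSpace ℝ (Fin b)) B]
  {F : Type*} [TopologicalSpace F] [ChartedSpace (EuclideanSpace ℝ (Fin k)) F]

/-- The push-forward of a contravariant 2-tensor at `x` along a map `φ`. -/
def push (φ : B → M) (x : B) (A : Cotan b x →ₗ[ℝ] Tan b x) :
    Cotan n (φ x) →ₗ[ℝ] Tan n (φ x) where
  toFun α := mfderiv (𝓡 b) (𝓡 n) φ x (A (α.comp (mfderiv (𝓡 b) (𝓡 n) φ x)))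
  map_add' α β := by simp [ContinuousLinearMap.add_comp]
  map_smul' c α := by simp [ContinuousLinearMap.smul_comp]

variable [IsManifold (𝓡 n) ∞ M] [IsManifold (𝓡 b) ∞ B] [IsManifold (𝓡 k) ∞ F]

/-- `Φ : B × F → M` exhibits an open subset of `M` as the warped product `B ×_ρ F` adapted to the
net `(D^⊥, D)`: `Φ` is a diffeomorphism onto an open subset, the pulled back metric is
`g_B + ρ² g_F`, and the slices `B × {y}` and `{x} × F` are mapped to integral manifolds of `D^⊥`
and `D`. -/
structure IsAdaptedWarpedProduct (g : PseudoRiemannianMetric n M)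
    (D : ∀ x : M, Submodule ℝ (Tan n x)) (gB : PseudoRiemannianMetric b B)
    (gF : PseudoRiemannianMetric k F) (ρ : B → ℝ) (Φ : B × F → M) : Prop where
  dim_pos : 0 < k
  warp_smooth : SmoothFn b ρ
  warp_pos : ∀ x, 0 < ρ x
  injective : Function.Injective Φ
  localDiffeo : IsLocalDiffeomorph ((𝓡 b).prod (𝓡 k)) (𝓡 n) ∞ Φ
  metric : ∀ (p : B × F) (u v : TangentSpace ((𝓡 b).prod (𝓡 k)) p),
    g.val (Φ p) (mfderiv ((𝓡 b).prod (𝓡 k)) (𝓡 n) Φ p u)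
        (mfderiv ((𝓡 b).prod (𝓡 k)) (𝓡 n) Φ p v) =
      gB.val p.1 (mfderiv ((𝓡 b).prod (𝓡 k)) (𝓡 b) Prod.fst p u)
          (mfderiv ((𝓡 b).prod (𝓡 k)) (𝓡 b) Prod.fst p v) +
        ρ p.1 ^ 2 * gF.val p.2 (mfderiv ((𝓡 b).prod (𝓡 k)) (𝓡 k) Prod.snd p u)
          (mfderiv ((𝓡 b).prod (𝓡 k)) (𝓡 k) Prod.snd p v)
  tangent_base : ∀ (x : B) (y : F), orth g D (Φ (x, y)) =
    (mfderiv (𝓡 b) (𝓡 n) (fun x' => Φ (x', y)) x).toLinearMap.range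
  tangent_fiber : ∀ (x : B) (y : F), D (Φ (x, y)) =
    (mfderiv (𝓡 k) (𝓡 n) (fun y' => Φ (x, y')) y).toLinearMap.range

end WarpedProduct

end KillingStackel

end

/-! Killing tensors that are diagonal in a fixed web are rigid. In web coordinates, with diagonal
components `S^i` and `G^i`, the equation `[S, G] = 0` reads `G^i ∂_i S^j = S^i ∂_i G^j`. Every first
derivative of the components of `S` is thus a linear expression in these components, so that `S`
vanishes on the connected manifold as soon as it vanishes at one point
(`eventually_eq_zero_of_schouten`, `eq_zero_of_apply_eq_zero`). Evaluation at a point therefore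
embeds a space of diagonal Killing tensors in the `n`-dimensional space of diagonal endomorphisms,
and a KS-space, being of dimension `n`, fills it (`IsKSSpaceOf.exists_endo_eq`).

On the warped product the fibers are tangent to the `K`-invariant `D`, so `K` and all members `L` of
`𝒦` have no mixed components. Testing `[L, G] = 0` on functions `u + v`, with `u` from the base and
`v` from the fiber, and separating degrees in `u` and `v` gives four equations
(`killing_equations`): the base component is Killing on `B`; it does not depend on the fiber point;
the fiber component along each slice is Killing on `F`; the differential of the fiber component
along the base is `L_B dρ⁻²` times `G_F`. Integrating the last equation produces `l` and the
decomposition of `L` (`exists_decomposition`).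

The spaces on `B` and `F` consist of all Killing tensors that are diagonal for the components of `K`
along the slices through `y₀` and `x₀`. These components are characteristic because the projections
carry eigenvectors of `K` to eigenvectors or to zero (`hasIntegrableEigenspaces_of_intertwines`),
and components of members of `𝒦` attain all diagonal values at a point, which gives the dimensions.
For the converse inclusion, some `L` in `𝒦` has the prescribed value at `(x₀, y₀)`, and rigidity on
`B` and on `F` identifies its components everywhere (`exists_mem_eq_assemble`). -/

noncomputable section

namespace KillingStackel

open Filter Topology Set

/-! ### Test functions and covectors. -/

section LocalFunctions

variable {n : ℕ} {M : Type*} [TopologicalSpace M] [ChartedSpace (EuclideanSpace ℝ (Fin n)) M]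

theorem mvfderiv_congr {f f' : M → ℝ} {x : M} (h : f =ᶠ[𝓝 x] f') :
    mvfderiv (𝓡 n) f x = mvfderiv (𝓡 n) f' x := by
  have := h.mfderiv_eq (I := 𝓡 n) (I' := 𝓘(ℝ, ℝ))
  ext v
  exact congrArg (fun (A : EuclideanSpace ℝ (Fin n) →L[ℝ] ℝ) => A v) this

theorem ContraField.pair_congr (K : ContraField n M) {f f' h h' : M → ℝ} {x : M}
    (hf : f =ᶠ[𝓝 x] f') (hh : h =ᶠ[𝓝 x] h') : K.pair f h =ᶠ[𝓝 x] K.pair f' h' := by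
  filter_upwards [hf.eventuallyEq_nhds, hh.eventuallyEq_nhds] with y hy hy'
  simp only [ContraField.pair, mvfderiv_congr hy, mvfderiv_congr hy']

theorem eq_zero_of_forall_cotan {x : M} {v : Tan n x}
    (h : ∀ α : Cotan n x, α v = 0) : v = 0 :=
  SeparatingDual.eq_zero_of_forall_dual_eq_zero (R := ℝ) (V := EuclideanSpace ℝ (Fin n)) h

variable [IsManifold (𝓡 n) ∞ M] [T2Space M]

/-- Smoothness of tensors and the Killing condition are tested on global functions only. Multiplying
by a bump function makes local functions, such as coordinates, available as test functions. -/
theorem exists_smoothFn_eventuallyEq {U : Set M} (hU : IsOpen U) {x : M} (hx : x ∈ U)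
    {f : M → ℝ} (hf : ContMDiffOn (𝓡 n) 𝓘(ℝ, ℝ) ∞ f U) :
    ∃ f' : M → ℝ, SmoothFn n f' ∧ f' =ᶠ[𝓝 x] f := by
  obtain ⟨χ, -, hχ⟩ := (SmoothBumpFunction.nhds_basis_tsupport (I := 𝓡 n) x).mem_iff.1
    (hU.mem_nhds hx)
  refine ⟨fun y => χ y * f y, contMDiff_of_tsupport fun y hy => ?_, ?_⟩
  · have hyU : y ∈ U := hχ (tsupport_mul_subset_left hy)
    exact χ.contMDiffAt.mul (hf.contMDiffAt (hU.mem_nhds hyU))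
  · filter_upwards [χ.eventuallyEq_one] with y hy
    simp [hy]

theorem exists_smoothFn_mvfderiv_eq (x : M) (α : Cotan n x) :
    ∃ f : M → ℝ, SmoothFn n f ∧ mvfderiv (𝓡 n) f x = α := by
  obtain ⟨A, hA⟩ := isInvertible_mfderiv_extChartAt (I := 𝓡 n) (mem_extChartAt_source (I := 𝓡 n) x)
  let β : EuclideanSpace ℝ (Fin n) →L[ℝ] ℝ := ContinuousLinearMap.comp α A.symm.toContinuousLinearMap
  have hβ : ContMDiff 𝓘(ℝ, EuclideanSpace ℝ (Fin n)) 𝓘(ℝ, ℝ) ∞ β := β.contMDiff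
  have hs : ContMDiffOn (𝓡 n) 𝓘(ℝ, ℝ) ∞ (β ∘ extChartAt (𝓡 n) x) (chartAt _ x).source :=
    hβ.comp_contMDiffOn contMDiffOn_extChartAt
  obtain ⟨f, hf, hfe⟩ := exists_smoothFn_eventuallyEq (chartAt _ x).open_source
    (mem_chart_source _ x) hs
  refine ⟨f, hf, ?_⟩
  rw [mvfderiv_congr hfe]
  ext v
  have h1 := mfderiv_comp_apply (I := 𝓡 n) (I' := 𝓡 n) (I'' := 𝓘(ℝ, ℝ)) x
    (hβ.mdifferentiable (by simp) _)
    (mdifferentiableAt_extChartAt (I := 𝓡 n) (mem_chart_source _ x)) v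
  refine h1.trans ?_
  rw [← hA, ContinuousLinearMap.mfderiv_eq]
  exact congrArg α (A.symm_apply_apply v)

theorem SymTensor.contMDiffAt_pair (K : SymTensor n M) {f h : M → ℝ} {U : Set M} (hU : IsOpen U)
    {x : M} (hx : x ∈ U) (hf : ContMDiffOn (𝓡 n) 𝓘(ℝ, ℝ) ∞ f U)
    (hh : ContMDiffOn (𝓡 n) 𝓘(ℝ, ℝ) ∞ h U) :
    ContMDiffAt (𝓡 n) 𝓘(ℝ, ℝ) ∞ (K.1.pair f h) x := by
  obtain ⟨f', hf', hfe⟩ := exists_smoothFn_eventuallyEq hU hx hf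
  obtain ⟨h', hh', hhe⟩ := exists_smoothFn_eventuallyEq hU hx hh
  exact (K.2.2 f' h' hf' hh').contMDiffAt.congr_of_eventuallyEq
    (ContraField.pair_congr _ hfe.symm hhe.symm)

/-- Every covector is the differential of a smooth function, so the quadratic form vanishes;
polarization then kills the symmetric tensor. -/
theorem ContraField.eq_zero_of_pair_self {K : ContraField n M} {x : M}
    (hs : ∀ α β : Cotan n x, α (K x β) = β (K x α))
    (h : ∀ f : M → ℝ, SmoothFn n f → K.pair f f x = 0) : K x = 0 := by
  have h0 : ∀ α : Cotan n x, α (K x α) = 0 := fun α => by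
    obtain ⟨f, hf, rfl⟩ := exists_smoothFn_mvfderiv_eq x α
    exact h f hf
  refine LinearMap.ext fun β => ?_
  refine eq_zero_of_forall_cotan fun α => ?_
  have h1 := h0 (α + β)
  simp only [map_add, add_apply, h0 α, h0 β, hs β α] at h1
  linarith

end LocalFunctions

/-! ### Functions with zero differential. -/

section Constant

variable {n : ℕ} {M : Type*} [TopologicalSpace M] [ChartedSpace (EuclideanSpace ℝ (Fin n)) M]
  [IsManifold (𝓡 n) ∞ M] [ConnectedSpace M]

theorem eq_of_mvfderiv_eq_zero {f : M → ℝ} (hf : SmoothFn n f)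
    (h : ∀ x, mvfderiv (𝓡 n) f x = 0) (x y : M) : f x = f y := by
  have : IsLocallyConstant f := by
    rw [IsLocallyConstant.iff_eventually_eq]
    intro p
    let e := chartAt (EuclideanSpace ℝ (Fin n)) p
    have hpe : p ∈ e.source := mem_chart_source _ p
    obtain ⟨r, hr, hball⟩ := Metric.isOpen_iff.1 e.open_target (e p) (e.map_source hpe)
    have hd : ∀ q ∈ Metric.ball (e p) r, HasFDerivWithinAt (f ∘ e.symm)
        (0 : EuclideanSpace ℝ (Fin n) →L[ℝ] ℝ) (Metric.ball (e p) r) q := by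
      intro q hq
      have hq' := hball hq
      have h1 : MDifferentiableAt (𝓡 n) (𝓡 n) e.symm q :=
        ((contMDiffOn_chart_symm (I := 𝓡 n) (n := ∞)).contMDiffAt
          (e.open_target.mem_nhds hq')).mdifferentiableAt (by simp)
      have h2 : HasMFDerivAt (𝓡 n) 𝓘(ℝ, ℝ) f (e.symm q) 0 := by
        have := (hf.mdifferentiable (by simp) (e.symm q)).hasMFDerivAt
        have h0 : mfderiv (𝓡 n) 𝓘(ℝ, ℝ) f (e.symm q) = 0 := h (e.symm q)
        rwa [h0] at this
      have h3 := h2.comp q h1.hasMFDerivAt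
      have h4 : HasMFDerivAt (𝓡 n) 𝓘(ℝ, ℝ) (f ∘ e.symm) q
        (0 : EuclideanSpace ℝ (Fin n) →L[ℝ] ℝ) := by
        have h0 : (0 : Tan n (e.symm q) →L[ℝ] ℝ).comp (mfderiv (𝓡 n) (𝓡 n) e.symm q) = 0 :=
          ContinuousLinearMap.zero_comp _
        exact Eq.mp (congrArg (HasMFDerivAt (𝓡 n) 𝓘(ℝ, ℝ) (f ∘ e.symm) q) h0) h3
      exact h4.hasFDerivAt.hasFDerivWithinAt
    have hev : ∀ᶠ y in 𝓝 p, e y ∈ Metric.ball (e p) r ∧ y ∈ e.source :=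
      ((e.continuousAt hpe).eventually (Metric.ball_mem_nhds _ hr)).and
        (e.open_source.mem_nhds hpe)
    filter_upwards [hev] with y hy
    have := (convex_ball (e p) r).norm_image_sub_le_of_norm_hasFDerivWithin_le (C := 0)
      hd (by simp) (Metric.mem_ball_self hr) hy.1
    simp only [Function.comp, e.left_inv hy.2, e.left_inv hpe, zero_mul, norm_le_zero_iff] at this
    linarith
  exact this.apply_eq_of_isPreconnected isPreconnected_univ (mem_univ _) (mem_univ _)

end Constant

/-! ### Smoothness of the contravariant metric. -/

section Contravariant

variable {n : ℕ} {M : Type*} [TopologicalSpace M] [ChartedSpace (EuclideanSpace ℝ (Fin n)) M]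

theorem contMDiffAt_det {ι : Type*} [Fintype ι] [DecidableEq ι] {A : M → Matrix ι ι ℝ} {x : M}
    (hA : ∀ i j, ContMDiffAt (𝓡 n) 𝓘(ℝ, ℝ) ∞ (fun y => A y i j) x) :
    ContMDiffAt (𝓡 n) 𝓘(ℝ, ℝ) ∞ (fun y => (A y).det) x := by
  simp only [Matrix.det_apply']
  exact contMDiffAt_finsetSum fun σ _ => contMDiffAt_const.mul
    (contMDiffAt_finsetProd fun i _ => hA _ _)

variable [IsManifold (𝓡 n) ∞ M]

theorem contMDiffAt_mvfderiv_apply {f : M → ℝ} (hf : SmoothFn n f) {X : ∀ x : M, Tan n x} {x : M}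
    (hX : ContMDiffAt (𝓡 n) (𝓡 n).tangent ∞ (fun y => (⟨y, X y⟩ : TangentBundle (𝓡 n) M)) x) :
    ContMDiffAt (𝓡 n) 𝓘(ℝ, ℝ) ∞ (fun y => mvfderiv (𝓡 n) f y (X y)) x := by
  have h1 : ContMDiff (𝓡 n).tangent 𝓘(ℝ, ℝ).tangent ∞ (tangentMap (𝓡 n) 𝓘(ℝ, ℝ) f) :=
    ContMDiff.contMDiff_tangentMap hf (by simp)
  have h2 := h1.contMDiffAt.comp x hX
  exact (contMDiff_snd_tangentBundle_modelSpace ℝ 𝓘(ℝ, ℝ)).contMDiffAt.comp x h2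

theorem PseudoRiemannianMetric.contMDiffAt_val (g : PseudoRiemannianMetric n M)
    {X Y : ∀ x : M, Tan n x} {x : M}
    (hX : ContMDiffAt (𝓡 n) (𝓡 n).tangent ∞ (fun y => (⟨y, X y⟩ : TangentBundle (𝓡 n) M)) x)
    (hY : ContMDiffAt (𝓡 n) (𝓡 n).tangent ∞ (fun y => (⟨y, Y y⟩ : TangentBundle (𝓡 n) M)) x) :
    ContMDiffAt (𝓡 n) 𝓘(ℝ, ℝ) ∞ (fun y => g.val y (X y) (Y y)) x := by
  have : ContMDiffAt (𝓡 n) ((𝓡 n).prod 𝓘(ℝ)) ∞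
      (fun m ↦ Bundle.TotalSpace.mk' ℝ (E := Bundle.Trivial M ℝ) m (g.val m (X m) (Y m))) x := by
    apply ContMDiffAt.clm_bundle_apply₂ (F₁ := EuclideanSpace ℝ (Fin n))
      (F₂ := EuclideanSpace ℝ (Fin n)) (b := fun m : M => m)
    · exact g.smooth.contMDiffAt
    · exact hX
    · exact hY
  simp only [Bundle.contMDiffAt_totalSpace] at this
  exact this.2

theorem PseudoRiemannianMetric.val_contra (g : PseudoRiemannianMetric n M) (x : M)
    (α : Cotan n x) (v : Tan n x) : g.val x (g.contra x α) v = α v :=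
  congrArg (fun β : Cotan n x => β v) ((g.flat x).apply_symm_apply α)

theorem PseudoRiemannianMetric.contra_symm (g : PseudoRiemannianMetric n M) (x : M)
    (α β : Cotan n x) : α (g.contra x β) = β (g.contra x α) := by
  rw [← g.val_contra x α, ← g.val_contra x β, g.symm]

/-- `G` is defined by pointwise inversion. In a local frame, Cramer's rule writes the components of
the gradient of `h` as quotients of smooth determinants by the Gram determinant. -/
theorem PseudoRiemannianMetric.contMDiff_pair_contra (g : PseudoRiemannianMetric n M)
    {f h : M → ℝ} (hf : SmoothFn n f) (hh : SmoothFn n h) : SmoothFn n (g.contra.pair f h) := by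
  intro x₀
  let e := trivializationAt (EuclideanSpace ℝ (Fin n)) (TangentSpace (𝓡 n) : M → Type _) x₀
  let b := (EuclideanSpace.basisFun (Fin n) ℝ).toBasis
  let s : Fin n → ∀ x : M, Tan n x := e.localFrame b
  have hx₀ : x₀ ∈ e.baseSet := FiberBundle.mem_baseSet_trivializationAt' x₀
  have hs : ∀ i, ContMDiffAt (𝓡 n) (𝓡 n).tangent ∞
      (fun y => (⟨y, s i y⟩ : TangentBundle (𝓡 n) M)) x₀ :=
    fun i => contMDiffAt_localFrame_of_mem (n := ∞) e b i hx₀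
  have hfr := e.isLocalFrameOn_localFrame_baseSet (𝓡 n) ∞ b
  let A : M → Matrix (Fin n) (Fin n) ℝ := fun y => Matrix.of fun i j => g.val y (s i y) (s j y)
  let a : M → Fin n → ℝ := fun y i => mvfderiv (𝓡 n) h y (s i y)
  have hA : ∀ i j, ContMDiffAt (𝓡 n) 𝓘(ℝ, ℝ) ∞ (fun y => A y i j) x₀ :=
    fun i j => g.contMDiffAt_val (hs i) (hs j)
  have ha : ∀ i, ContMDiffAt (𝓡 n) 𝓘(ℝ, ℝ) ∞ (fun y => a y i) x₀ :=
    fun i => contMDiffAt_mvfderiv_apply hh (hs i)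
  have key : ∀ y ∈ e.baseSet, (A y).det ≠ 0 ∧ g.contra.pair f h y =
      ∑ i, ((A y).det)⁻¹ * (A y).cramer (a y) i * mvfderiv (𝓡 n) f y (s i y) := by
    intro y hy
    let c := hfr.toBasisAt hy
    have hc : ∀ i, c i = s i y := fun i => hfr.toBasisAt_coe hy i
    -- A kernel vector of the Gram matrix would be a tangent vector orthogonal to the whole frame.
    have hdet : (A y).det ≠ 0 := by
      intro h0
      obtain ⟨v, hv, hv0⟩ := Matrix.exists_mulVec_eq_zero_iff.2 h0
      apply hv
      have : ∑ j, v j • c j = 0 := by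
        apply g.nondegenerate y
        intro w
        rw [g.symm, ← c.sum_repr w]
        simp only [map_sum, map_smul, sum_apply, smul_apply,
          smul_eq_mul, Finset.mul_sum]
        rw [Finset.sum_comm]
        refine Finset.sum_eq_zero fun i _ => ?_
        have := congrFun hv0 i
        simp only [Matrix.mulVec, dotProduct, A, Matrix.of_apply, Pi.zero_apply] at this
        rw [← mul_zero (c.repr w i), ← this, Finset.mul_sum]
        exact Finset.sum_congr rfl fun j _ => by rw [hc, hc]; ring
      funext j
      exact Fintype.linearIndependent_iff.1 c.linearIndependent v this j
    refine ⟨hdet, ?_⟩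
    let w := g.contra y (mvfderiv (𝓡 n) h y)
    have hw : (A y).mulVec (c.repr w) = a y := by
      funext i
      simp only [Matrix.mulVec, dotProduct, A, Matrix.of_apply, a]
      rw [← g.val_contra y (mvfderiv (𝓡 n) h y) (s i y), g.symm]
      change _ = g.val y (s i y) w
      conv_rhs => rw [← c.sum_repr w]
      simp only [map_sum, map_smul, smul_eq_mul, hc]
      exact Finset.sum_congr rfl fun _ _ => mul_comm _ _
    have hcr : ∀ i, ((A y).det)⁻¹ * (A y).cramer (a y) i = c.repr w i := by
      intro i
      rw [← hw, Matrix.cramer_eq_adjugate_mulVec, Matrix.mulVec_mulVec, Matrix.adjugate_mul,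
        Matrix.smul_mulVec, Matrix.one_mulVec, Pi.smul_apply, smul_eq_mul, ← mul_assoc,
        inv_mul_cancel₀ hdet, one_mul]
    change mvfderiv (𝓡 n) f y w = _
    conv_lhs => rw [← c.sum_repr w]
    simp only [map_sum, map_smul, smul_eq_mul, hc, hcr]
  have hev : g.contra.pair f h =ᶠ[𝓝 x₀] fun y =>
      ∑ i, ((A y).det)⁻¹ * (A y).cramer (a y) i * mvfderiv (𝓡 n) f y (s i y) := by
    filter_upwards [e.open_baseSet.mem_nhds hx₀] with y hy using (key y hy).2
  refine ContMDiffAt.congr_of_eventuallyEq ?_ hev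
  refine contMDiffAt_finsetSum fun i _ => ?_
  refine ContMDiffAt.mul (ContMDiffAt.mul ?_ ?_) (contMDiffAt_mvfderiv_apply hf (hs i))
  · exact (contMDiffAt_det hA).inv₀ (key x₀ hx₀).1
  · simp only [Matrix.cramer_apply]
    refine contMDiffAt_det fun k j => ?_
    simp only [Matrix.updateCol_apply]
    split_ifs
    exacts [ha k, hA k j]

/-- The contravariant metric as a symmetric tensor field. -/
def PseudoRiemannianMetric.contraTensor (g : PseudoRiemannianMetric n M) : SymTensor n M :=
  ⟨g.contra, g.contra_symm, fun _ _ hf hh => g.contMDiff_pair_contra hf hh⟩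

end Contravariant

/-- The monomials `p k * p j ^ 2` are distinct. A basis vector isolates `c i i`; on `s e_i + t e_j`
the values `(1, 1)` and `(1, -1)` for `(s, t)` give the sum and the difference of `c i j` and `c j
i`. -/
theorem coeff_eq_zero_of_cubic {ι : Type*} [Fintype ι] [DecidableEq ι] {c : ι → ι → ℝ}
    (h : ∀ p : ι → ℝ, ∑ k, ∑ j, p k * p j ^ 2 * c k j = 0) (i j : ι) : c i j = 0 := by
  have hd : ∀ i, c i i = 0 := fun i => by
    have := h (Pi.single i 1)
    rw [Fintype.sum_eq_single i (fun k hk => by simp [hk]),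
      Fintype.sum_eq_single i (fun k hk => by simp [hk])] at this
    simpa using this
  by_cases hij : i = j
  · rw [hij]; exact hd j
  have key : ∀ s t : ℝ, s * t ^ 2 * c i j + t * s ^ 2 * c j i = 0 := fun s t => by
    have := h (Pi.single i s + Pi.single j t)
    rw [Fintype.sum_eq_add i j hij (fun k hk => by simp [hk.1, hk.2])] at this
    rw [Fintype.sum_eq_add i j hij (fun k hk => by simp [hk.1, hk.2]),
      Fintype.sum_eq_add i j hij (fun k hk => by simp [hk.1, hk.2])] at this
    simp only [Pi.add_apply, Pi.single_eq_same, Pi.single_eq_of_ne hij,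
      Pi.single_eq_of_ne (Ne.symm hij), hd] at this
    linarith
  have h1 := key 1 1
  have h2 := key 1 (-1)
  linarith

/-! ### Linearity of the Schouten bracket. -/

section Schouten

variable {n : ℕ} {M : Type*} [TopologicalSpace M] [ChartedSpace (EuclideanSpace ℝ (Fin n)) M]

theorem schouten_add_left (S T U : SymTensor n M) {f : M → ℝ} (hf : SmoothFn n f) (x : M) :
    schouten (S + T).1 U.1 f x = schouten S.1 U.1 f x + schouten T.1 U.1 f x := by
  have h : ContraField.pair (S + T).1 f f = S.1.pair f f + T.1.pair f f := by
    funext y; simp [ContraField.pair]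
  have hd : mvfderiv (𝓡 n) (S.1.pair f f + T.1.pair f f) x =
      mvfderiv (𝓡 n) (S.1.pair f f) x + mvfderiv (𝓡 n) (T.1.pair f f) x :=
    mvfderiv_add ((S.2.2 f f hf hf).mdifferentiable (by simp) x)
      ((T.2.2 f f hf hf).mdifferentiable (by simp) x)
  simp only [schouten, h]
  simp only [ContraField.pair, hd, Submodule.coe_add, Pi.add_apply, LinearMap.add_apply, map_add]
  ring

theorem mvfderiv_const_mul (c : ℝ) {f : M → ℝ} {x : M}
    (hf : MDifferentiableAt (𝓡 n) 𝓘(ℝ, ℝ) f x) :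
    mvfderiv (𝓡 n) (fun y => c * f y) x = c • mvfderiv (𝓡 n) f x := by
  have h := mvfderiv_mul (I := 𝓡 n) (f := fun _ : M => c) (g := f) (x := x)
    mdifferentiableAt_const hf
  rw [mvfderiv_const] at h
  refine h.trans ?_
  simp

theorem schouten_smul_left (c : ℝ) (S U : SymTensor n M) {f : M → ℝ} (hf : SmoothFn n f) (x : M) :
    schouten (c • S).1 U.1 f x = c * schouten S.1 U.1 f x := by
  have h : ContraField.pair (c • S).1 f f = fun y => c * S.1.pair f f y := by
    funext y; simp [ContraField.pair]
  have hd := mvfderiv_const_mul c ((S.2.2 f f hf hf).mdifferentiable (by simp) x)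
  simp only [schouten, h]
  simp only [ContraField.pair] at hd ⊢
  simp only [hd, Submodule.coe_smul, Pi.smul_apply, LinearMap.smul_apply, map_smul, smul_eq_mul]
  ring

end Schouten

/-! ### Diagonal tensors in coordinates and their first-order system. -/

section Coordinates

variable {n : ℕ} {M : Type*} [TopologicalSpace M] [ChartedSpace (EuclideanSpace ℝ (Fin n)) M]
  (φ : PartialDiffeomorph (𝓡 n) (𝓡 n) (EuclideanSpace ℝ (Fin n)) M ∞)

/-- The coordinate vectors of a local parametrization. -/
def frame (q : EuclideanSpace ℝ (Fin n)) (i : Fin n) : Tan n (φ q) :=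
  mfderiv (𝓡 n) (𝓡 n) φ q (EuclideanSpace.single i (1 : ℝ))

/-- The coordinate functions of a local parametrization. -/
def coordFn (i : Fin n) (m : M) : ℝ := φ.symm m i

variable {φ}

theorem symm_apply_apply {q : EuclideanSpace ℝ (Fin n)} (hq : q ∈ φ.source) : φ.symm (φ q) = q :=
  φ.left_inv hq

theorem apply_symm_apply {m : M} (hm : m ∈ φ.target) : φ (φ.symm m) = m :=
  φ.right_inv hm

theorem symm_mem_source {m : M} (hm : m ∈ φ.target) : φ.symm m ∈ φ.source :=
  φ.map_target hm

theorem contMDiffOn_coordFn (i : Fin n) :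
    ContMDiffOn (𝓡 n) 𝓘(ℝ, ℝ) ∞ (coordFn φ i) φ.target :=
  (EuclideanSpace.proj (𝕜 := ℝ) i : EuclideanSpace ℝ (Fin n) →L[ℝ] ℝ).contMDiff.comp_contMDiffOn
    φ.symm.contMDiffOn

theorem mvfderiv_frame {q : EuclideanSpace ℝ (Fin n)} (hq : q ∈ φ.source) {h : M → ℝ}
    (hh : MDifferentiableAt (𝓡 n) 𝓘(ℝ, ℝ) h (φ q)) (j : Fin n) :
    mvfderiv (𝓡 n) h (φ q) (frame φ q j) =
      fderiv ℝ (h ∘ φ) q (EuclideanSpace.single j (1 : ℝ)) := by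
  have h1 := mfderiv_comp_apply (I := 𝓡 n) (I' := 𝓡 n) (I'' := 𝓘(ℝ, ℝ)) q hh
    (φ.mdifferentiableAt (by simp) hq) (EuclideanSpace.single j (1 : ℝ))
  refine h1.symm.trans ?_
  rw [mfderiv_eq_fderiv]
  rfl

theorem schouten_congr (S T : ContraField n M) {f f' : M → ℝ} {x : M} (h : f =ᶠ[𝓝 x] f') :
    schouten S T f x = schouten S T f' x := by
  have h1 := (S.pair_congr h (T.pair_congr h h)).eq_of_nhds
  have h2 := (T.pair_congr h (S.pair_congr h h)).eq_of_nhds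
  simp only [schouten, h1, h2]

/-- The function with constant coordinate derivatives `p`. -/
def linearFn (φ : PartialDiffeomorph (𝓡 n) (𝓡 n) (EuclideanSpace ℝ (Fin n)) M ∞)
    (p : Fin n → ℝ) (m : M) : ℝ := ∑ i, p i * coordFn φ i m

theorem contMDiffOn_linearFn (p : Fin n → ℝ) :
    ContMDiffOn (𝓡 n) 𝓘(ℝ, ℝ) ∞ (linearFn φ p) φ.target :=
  contMDiffOn_finsetSum fun i _ => contMDiffOn_const.mul (contMDiffOn_coordFn i)


/-- The coordinate vectors form a basis. -/
def frameBasis {q : EuclideanSpace ℝ (Fin n)} (hq : q ∈ φ.source) :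
    Module.Basis (Fin n) ℝ (Tan n (φ q)) :=
  (EuclideanSpace.basisFun (Fin n) ℝ).toBasis.map
    ((φ.isLocalDiffeomorphAt _ _ _ hq).mfderivToContinuousLinearEquiv (by simp)).toLinearEquiv

theorem frameBasis_apply {q : EuclideanSpace ℝ (Fin n)} (hq : q ∈ φ.source) (i : Fin n) :
    frameBasis hq i = frame φ q i := by
  have h := (EuclideanSpace.basisFun (Fin n) ℝ).toBasis.map_apply
    ((φ.isLocalDiffeomorphAt _ _ _ hq).mfderivToContinuousLinearEquiv (by simp)).toLinearEquiv i
  refine h.trans ?_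
  rw [OrthonormalBasis.coe_toBasis, EuclideanSpace.basisFun_apply]
  rfl

theorem mvfderiv_coordFn_frame {q : EuclideanSpace ℝ (Fin n)} (hq : q ∈ φ.source) (i j : Fin n) :
    mvfderiv (𝓡 n) (coordFn φ i) (φ q) (frame φ q j) = if i = j then 1 else 0 := by
  rw [mvfderiv_frame hq]
  · have : coordFn φ i ∘ φ =ᶠ[𝓝 q]
        (EuclideanSpace.proj (𝕜 := ℝ) i : EuclideanSpace ℝ (Fin n) →L[ℝ] ℝ) := by
      filter_upwards [φ.open_source.mem_nhds hq] with y hy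
      exact congrArg (fun z : EuclideanSpace ℝ (Fin n) => z i) (symm_apply_apply hy)
    rw [this.fderiv_eq, ContinuousLinearMap.fderiv]
    simp
  · exact ((contMDiffOn_coordFn i).contMDiffAt
      (φ.open_target.mem_nhds (φ.map_source hq))).mdifferentiableAt (by simp)

theorem cotan_eq_sum_coordFn {q : EuclideanSpace ℝ (Fin n)} (hq : q ∈ φ.source)
    (α : Cotan n (φ q)) :
    α = ∑ i, α (frame φ q i) • mvfderiv (𝓡 n) (coordFn φ i) (φ q) := by
  ext v
  rw [← (frameBasis hq).sum_repr v]
  simp only [map_sum, map_smul, frameBasis_apply, sum_apply, smul_apply,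
    mvfderiv_coordFn_frame hq, smul_eq_mul]
  simp

/-- A tensor is diagonal in the coordinates given by `φ`. -/
def IsDiagonalIn (φ : PartialDiffeomorph (𝓡 n) (𝓡 n) (EuclideanSpace ℝ (Fin n)) M ∞)
    (T : ContraField n M) : Prop :=
  ∀ q ∈ φ.source, ∀ i, ∃ ν : ℝ,
    T (φ q) (mvfderiv (𝓡 n) (coordFn φ i) (φ q)) = ν • frame φ q i

/-- The diagonal components of a tensor in the coordinates given by `φ`. -/
def diagCoeff (φ : PartialDiffeomorph (𝓡 n) (𝓡 n) (EuclideanSpace ℝ (Fin n)) M ∞)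
    (T : ContraField n M) (i : Fin n) (q : EuclideanSpace ℝ (Fin n)) : ℝ :=
  T.pair (coordFn φ i) (coordFn φ i) (φ q)

theorem IsDiagonalIn.apply_coordFn {T : ContraField n M} (hT : IsDiagonalIn φ T)
    {q : EuclideanSpace ℝ (Fin n)} (hq : q ∈ φ.source) (i : Fin n) :
    T (φ q) (mvfderiv (𝓡 n) (coordFn φ i) (φ q)) = diagCoeff φ T i q • frame φ q i := by
  obtain ⟨ν, hν⟩ := hT q hq i
  rw [diagCoeff, ContraField.pair, hν, map_smul, mvfderiv_coordFn_frame hq]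
  simp

theorem IsDiagonalIn.eq_zero {T : ContraField n M} (hT : IsDiagonalIn φ T)
    {q : EuclideanSpace ℝ (Fin n)} (hq : q ∈ φ.source) (h : ∀ i, diagCoeff φ T i q = 0) :
    T (φ q) = 0 := by
  refine LinearMap.ext fun α => ?_
  rw [cotan_eq_sum_coordFn hq α]
  simp [hT.apply_coordFn hq, h]

theorem mvfderiv_linearFn_frame (p : Fin n → ℝ) {q : EuclideanSpace ℝ (Fin n)}
    (hq : q ∈ φ.source) (j : Fin n) :
    mvfderiv (𝓡 n) (linearFn φ p) (φ q) (frame φ q j) = p j := by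
  rw [mvfderiv_frame hq]
  · let β : EuclideanSpace ℝ (Fin n) →L[ℝ] ℝ :=
      ∑ i, p i • (EuclideanSpace.proj (𝕜 := ℝ) i : EuclideanSpace ℝ (Fin n) →L[ℝ] ℝ)
    have : linearFn φ p ∘ φ =ᶠ[𝓝 q] β := by
      filter_upwards [φ.open_source.mem_nhds hq] with y hy
      have : ∀ i, coordFn φ i (φ y) = y i := fun i =>
        congrArg (fun z : EuclideanSpace ℝ (Fin n) => z i) (symm_apply_apply hy)
      simp [linearFn, this, β]
    rw [this.fderiv_eq, ContinuousLinearMap.fderiv]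
    simp [β]
  · exact ((contMDiffOn_linearFn p).contMDiffAt
      (φ.open_target.mem_nhds (φ.map_source hq))).mdifferentiableAt (by simp)

theorem IsDiagonalIn.apply_linearFn {T : ContraField n M} (hT : IsDiagonalIn φ T)
    {q : EuclideanSpace ℝ (Fin n)} (hq : q ∈ φ.source) (p : Fin n → ℝ) :
    T (φ q) (mvfderiv (𝓡 n) (linearFn φ p) (φ q)) =
      ∑ i, (p i * diagCoeff φ T i q) • frame φ q i := by
  rw [cotan_eq_sum_coordFn hq (mvfderiv (𝓡 n) (linearFn φ p) (φ q)), map_sum]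
  refine Finset.sum_congr rfl fun i _ => ?_
  rw [map_smul, hT.apply_coordFn hq, mvfderiv_linearFn_frame p hq, smul_smul]

theorem IsDiagonalIn.pair_linearFn {T : ContraField n M} (hT : IsDiagonalIn φ T)
    {q : EuclideanSpace ℝ (Fin n)} (hq : q ∈ φ.source) (p : Fin n → ℝ) :
    T.pair (linearFn φ p) (linearFn φ p) (φ q) = ∑ i, p i ^ 2 * diagCoeff φ T i q := by
  rw [ContraField.pair, hT.apply_linearFn hq, map_sum]
  refine Finset.sum_congr rfl fun i _ => ?_
  rw [map_smul, mvfderiv_linearFn_frame p hq, smul_eq_mul]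
  ring

variable [IsManifold (𝓡 n) ∞ M] [T2Space M]

theorem contDiffOn_diagCoeff (T : SymTensor n M) (i : Fin n) :
    ContDiffOn ℝ ∞ (diagCoeff φ T.1 i) φ.source := by
  have h : ContMDiffOn (𝓡 n) 𝓘(ℝ, ℝ) ∞ (diagCoeff φ T.1 i) φ.source := fun q hq =>
    ((SymTensor.contMDiffAt_pair T φ.open_target (φ.map_source hq) (contMDiffOn_coordFn i)
      (contMDiffOn_coordFn i)).comp q
        (φ.contMDiffOn.contMDiffAt (φ.open_source.mem_nhds hq))).contMDiffWithinAt
  exact h.contDiffOn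

theorem differentiableAt_diagCoeff (T : SymTensor n M) (i : Fin n)
    {q : EuclideanSpace ℝ (Fin n)} (hq : q ∈ φ.source) :
    DifferentiableAt ℝ (diagCoeff φ T.1 i) q :=
  ((contDiffOn_diagCoeff T i).contDiffAt (φ.open_source.mem_nhds hq)).differentiableAt (by simp)

/-- The test function has constant coordinate derivatives `p`, so only the components of `T` are
differentiated and the result is a cubic polynomial in `p`. -/
theorem pair_linearFn_pair_linearFn {S T : SymTensor n M} (hS : IsDiagonalIn φ S.1)
    (hT : IsDiagonalIn φ T.1) {q : EuclideanSpace ℝ (Fin n)} (hq : q ∈ φ.source) (p : Fin n → ℝ) :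
    S.1.pair (linearFn φ p) (T.1.pair (linearFn φ p) (linearFn φ p)) (φ q) =
      ∑ i, ∑ j, p i * p j ^ 2 * (diagCoeff φ S.1 i q *
        fderiv ℝ (diagCoeff φ T.1 j) q (EuclideanSpace.single i 1)) := by
  rw [ContraField.pair, S.2.1, hS.apply_linearFn hq, map_sum]
  refine Finset.sum_congr rfl fun i _ => ?_
  have hd : MDifferentiableAt (𝓡 n) 𝓘(ℝ, ℝ)
      (T.1.pair (linearFn φ p) (linearFn φ p)) (φ q) :=
    (SymTensor.contMDiffAt_pair T φ.open_target (φ.map_source hq) (contMDiffOn_linearFn p)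
      (contMDiffOn_linearFn p)).mdifferentiableAt (by simp)
  have he : T.1.pair (linearFn φ p) (linearFn φ p) ∘ φ =ᶠ[𝓝 q]
      fun y => ∑ j, p j ^ 2 * diagCoeff φ T.1 j y := by
    filter_upwards [φ.open_source.mem_nhds hq] with y hy using hT.pair_linearFn hy p
  rw [map_smul, mvfderiv_frame hq hd, he.fderiv_eq, fderiv_fun_sum (fun j _ =>
    (differentiableAt_diagCoeff T j hq).const_mul _), sum_apply, smul_eq_mul, Finset.mul_sum]
  refine Finset.sum_congr rfl fun j _ => ?_
  rw [fderiv_const_mul (differentiableAt_diagCoeff T j hq), smul_apply, smul_eq_mul]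
  ring

/-- The bracket on coordinate-linear functions is a cubic form in `p` that vanishes for all `p`;
these are its coefficients. -/
theorem diagCoeff_mul_fderiv_eq {S T : SymTensor n M} (hS : IsDiagonalIn φ S.1)
    (hT : IsDiagonalIn φ T.1)
    (hST : ∀ f : M → ℝ, SmoothFn n f → ∀ x : M, schouten S.1 T.1 f x = 0)
    {q : EuclideanSpace ℝ (Fin n)} (hq : q ∈ φ.source) (i j : Fin n) :
    diagCoeff φ S.1 i q * fderiv ℝ (diagCoeff φ T.1 j) q (EuclideanSpace.single i 1) =
      diagCoeff φ T.1 i q * fderiv ℝ (diagCoeff φ S.1 j) q (EuclideanSpace.single i 1) := by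
  rw [← sub_eq_zero]
  refine coeff_eq_zero_of_cubic (c := fun i j =>
    diagCoeff φ S.1 i q * fderiv ℝ (diagCoeff φ T.1 j) q (EuclideanSpace.single i 1) -
      diagCoeff φ T.1 i q * fderiv ℝ (diagCoeff φ S.1 j) q (EuclideanSpace.single i 1))
    (fun p => ?_) i j
  obtain ⟨f, hf, hfe⟩ := exists_smoothFn_eventuallyEq φ.open_target (φ.map_source hq)
    (contMDiffOn_linearFn p)
  have h := hST f hf (φ q)
  rw [schouten_congr _ _ hfe, schouten, pair_linearFn_pair_linearFn hS hT hq,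
    pair_linearFn_pair_linearFn hT hS hq] at h
  simp only [mul_sub, Finset.sum_sub_distrib]
  linarith

/-- Division by the components of `T` leaves a system `∂_i S^j = A_ij S^i`. Along a ray from the
given point it is a homogeneous linear differential equation with zero initial value, so Grönwall's
inequality gives zero on a ball. -/
theorem eventually_eq_zero_of_schouten {S T : SymTensor n M} (hS : IsDiagonalIn φ S.1)
    (hT : IsDiagonalIn φ T.1) (hT0 : ∀ q ∈ φ.source, ∀ i, diagCoeff φ T.1 i q ≠ 0)
    (hST : ∀ f : M → ℝ, SmoothFn n f → ∀ x : M, schouten S.1 T.1 f x = 0)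
    {x : M} (hx : x ∈ φ.target) (hSx : S.1 x = 0) : ∀ᶠ y in 𝓝 x, S.1 y = 0 := by
  set q₀ := φ.symm x with hq₀
  have hq₀s : q₀ ∈ φ.source := symm_mem_source hx
  obtain ⟨r, hr, hball⟩ := Metric.nhds_basis_closedBall.mem_iff.1 (φ.open_source.mem_nhds hq₀s)
  let A : Fin n → Fin n → EuclideanSpace ℝ (Fin n) → ℝ := fun i j q =>
    fderiv ℝ (diagCoeff φ T.1 j) q (EuclideanSpace.single i 1) / diagCoeff φ T.1 i q
  have hA : ∀ i j, ContinuousOn (A i j) (Metric.closedBall q₀ r) := fun i j => by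
    refine ContinuousOn.div ?_ ((contDiffOn_diagCoeff T i).continuousOn.mono hball)
      fun q hq => hT0 q (hball hq) i
    exact (((contDiffOn_diagCoeff T j).continuousOn_fderiv_of_isOpen φ.open_source
      (by simp)).mono hball).clm_apply continuousOn_const
  have hC : ∀ i j, ∃ C, ∀ q ∈ Metric.closedBall q₀ r, ‖A i j q‖ ≤ C := fun i j =>
    (isCompact_closedBall q₀ r).exists_bound_of_continuousOn (hA i j)
  choose C hC using hC
  have hd : ∀ q ∈ φ.source, ∀ i j,
      fderiv ℝ (diagCoeff φ S.1 j) q (EuclideanSpace.single i 1) = diagCoeff φ S.1 i q * A i j q := by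
    intro q hq i j
    have h1 := diagCoeff_mul_fderiv_eq hS hT hST hq i j
    have h2 := hT0 q hq i
    simp only [A]
    field_simp
    linarith
  have hzero : ∀ q ∈ Metric.closedBall q₀ r, ∀ i, diagCoeff φ S.1 i q = 0 := by
    intro q hq
    let w := q - q₀
    let γ : ℝ → EuclideanSpace ℝ (Fin n) := fun t => q₀ + t • w
    have hγ : ∀ t ∈ Icc (0 : ℝ) 1, γ t ∈ Metric.closedBall q₀ r := fun t ht => by
      rw [Metric.mem_closedBall, dist_eq_norm] at hq ⊢
      simp only [γ, add_sub_cancel_left, norm_smul, Real.norm_eq_abs, abs_of_nonneg ht.1]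
      exact (mul_le_of_le_one_left (norm_nonneg _) ht.2).trans hq
    have hγd : ∀ t, HasDerivAt γ w t := fun t => by
      have := ((hasDerivAt_id t).smul_const w).const_add q₀
      rwa [one_smul] at this
    let F : ℝ → Fin n → ℝ := fun t j => diagCoeff φ S.1 j (γ t)
    let F' : ℝ → Fin n → ℝ := fun t j => fderiv ℝ (diagCoeff φ S.1 j) (γ t) w
    have hF : ∀ t ∈ Icc (0 : ℝ) 1, HasDerivAt F (F' t) t := fun t ht => by
      rw [hasDerivAt_pi]
      intro j
      exact (differentiableAt_diagCoeff S j (hball (hγ t ht))).hasFDerivAt.comp_hasDerivAt t (hγd t)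
    have hF' : ∀ t ∈ Icc (0 : ℝ) 1, ∀ j, F' t j = ∑ i, w i * (F t i * A i j (γ t)) := by
      intro t ht j
      have hw : w = ∑ i, w i • EuclideanSpace.single i (1 : ℝ) := by
        have := (EuclideanSpace.basisFun (Fin n) ℝ).sum_repr w
        simpa using this.symm
      simp only [F']
      conv_lhs => rw [hw]
      rw [map_sum]
      refine Finset.sum_congr rfl fun i _ => ?_
      rw [map_smul, smul_eq_mul, hd _ (hball (hγ t ht))]
    have h0 : F 0 = 0 := by
      funext j
      have h1 : φ (γ 0) = x := by
        rw [show γ 0 = q₀ by simp [γ]]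
        exact apply_symm_apply hx
      have h2 : ∀ y, y = x → S.1 y = 0 := fun y hy => hy ▸ hSx
      simp only [F, diagCoeff, ContraField.pair, h2 _ h1]
      simp
    -- The `A i j` are bounded by `C i j` on the compact ball, which contains the whole segment;
    -- summing over `j` as well dominates the sup norm.
    have hb : ∀ t ∈ Icc (0 : ℝ) 1, ‖F' t‖ ≤ (∑ j, ∑ i, ‖w i‖ * |C i j|) * ‖F t‖ := by
      intro t ht
      have hnn : ∀ j, 0 ≤ ∑ i, ‖w i‖ * |C i j| := fun j =>
        Finset.sum_nonneg fun i _ => by positivity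
      rw [pi_norm_le_iff_of_nonneg (mul_nonneg (Finset.sum_nonneg fun j _ => hnn j)
        (norm_nonneg _))]
      intro j
      rw [hF' t ht]
      calc ‖∑ i, w i * (F t i * A i j (γ t))‖ ≤ ∑ i, ‖w i‖ * |C i j| * ‖F t‖ := by
            refine (norm_sum_le _ _).trans (Finset.sum_le_sum fun i _ => ?_)
            rw [norm_mul, norm_mul, mul_assoc, mul_comm ‖F t i‖]
            gcongr
            · exact (hC i j _ (hγ t ht)).trans (le_abs_self _)
            · exact norm_le_pi_norm _ _
        _ = (∑ i, ‖w i‖ * |C i j|) * ‖F t‖ := by rw [Finset.sum_mul]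
        _ ≤ _ := by
          exact mul_le_mul_of_nonneg_right (Finset.single_le_sum
            (f := fun j => ∑ i, ‖w i‖ * |C i j|) (fun j _ => hnn j) (Finset.mem_univ j))
            (norm_nonneg _)
    have := eq_zero_of_abs_deriv_le_mul_abs_self_of_eq_zero_right (f := F) (f' := F') (a := 0)
      (b := 1) (fun t ht => (hF t ht).continuousAt.continuousWithinAt)
      (fun t ht => (hF t (Ico_subset_Icc_self ht)).hasDerivWithinAt) h0
      (fun t ht => hb t (Ico_subset_Icc_self ht)) 1 (by simp)
    intro i
    have h1 := congrFun this i
    simpa [F, γ, w] using h1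
  have hc : ContinuousAt φ.symm x :=
    (φ.symm.contMDiffOn.contMDiffAt (φ.open_target.mem_nhds hx)).continuousAt
  filter_upwards [hc.preimage_mem_nhds (Metric.closedBall_mem_nhds _ hr),
    φ.open_target.mem_nhds hx] with y hy hyt
  rw [← apply_symm_apply hyt]
  exact hS.eq_zero (symm_mem_source hyt) (hzero _ hy)

end Coordinates

/-! ### Linear algebra of a simple spectrum. -/

section Eigenvectors

variable {ι V : Type*} [AddCommGroup V] [Module ℝ V] {A : V →ₗ[ℝ] V}
  {b : Module.Basis ι ℝ V} {μ : ι → ℝ}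

/-- Comparing `i`-th coordinates in `A v = r v` gives `(μ i - r) v_i = 0`. -/
theorem repr_eq_zero_of_eigenvector (hb : ∀ i, A (b i) = μ i • b i) {v : V} {r : ℝ}
    (hv : A v = r • v) {i : ι} (hi : μ i ≠ r) : b.repr v i = 0 := by
  have h : ∀ w, b.repr (A w) i = μ i * b.repr w i := by
    intro w
    have : (Finsupp.lapply i ∘ₗ b.repr.toLinearMap ∘ₗ A) =
        μ i • (Finsupp.lapply i ∘ₗ b.repr.toLinearMap) := by
      refine b.ext fun j => ?_
      by_cases hij : j = i
      · subst hij
        simp [hb]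
      · simp [hb, Finsupp.single_eq_of_ne (Ne.symm hij)]
    exact congrArg (fun T : V →ₗ[ℝ] ℝ => T w) this
  have h1 := h v
  rw [hv, map_smul, Finsupp.smul_apply, smul_eq_mul] at h1
  have : (μ i - r) * b.repr v i = 0 := by linarith
  exact (mul_eq_zero.1 this).resolve_left (sub_ne_zero.2 hi)

theorem exists_eq_smul_of_eigenvector (hb : ∀ i, A (b i) = μ i • b i)
    (hμ : Function.Injective μ) {v w : V} {r : ℝ} (hv : A v = r • v) (hw : A w = r • w)
    (hv0 : v ≠ 0) : ∃ c : ℝ, w = c • v := by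
  obtain ⟨i, hi⟩ : ∃ i, b.repr v i ≠ 0 := by
    by_contra! h
    exact hv0 (b.repr.map_eq_zero_iff.1 (Finsupp.ext h))
  have hir : μ i = r := by
    by_contra h
    exact hi (repr_eq_zero_of_eigenvector hb hv h)
  refine ⟨b.repr w i / b.repr v i, b.repr.injective (Finsupp.ext fun j => ?_)⟩
  rw [map_smul, Finsupp.smul_apply, smul_eq_mul]
  by_cases hj : j = i
  · subst hj
    field_simp
  · have hjr : μ j ≠ r := fun h => hj (hμ (h.trans hir.symm))
    rw [repr_eq_zero_of_eigenvector hb hv hjr, repr_eq_zero_of_eigenvector hb hw hjr, mul_zero]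

/-- `T` acts as the function `c` of `A`. Eigenvalues prescribed as a function of the eigenvalues of
`A` make sense without reference to an eigenbasis. -/
theorem apply_eigenvector_of_basis [Fintype ι] (hb : ∀ i, A (b i) = μ i • b i) {T : V →ₗ[ℝ] V}
    {c : ℝ → ℝ} (hT : ∀ i, T (b i) = c (μ i) • b i) {v : V} {r : ℝ} (hv : A v = r • v) :
    T v = c r • v := by
  conv_lhs => rw [← b.sum_repr v]
  conv_rhs => rw [← b.sum_repr v]
  rw [map_sum, Finset.smul_sum]
  refine Finset.sum_congr rfl fun i _ => ?_
  by_cases hi : μ i = r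
  · rw [map_smul, hT, hi, smul_comm]
  · rw [repr_eq_zero_of_eigenvector hb hv hi]
    simp

end Eigenvectors

/-! ### Rigidity and dimension of spaces of diagonal Killing tensors. -/

section Uniqueness

variable {n : ℕ} {M : Type*} [TopologicalSpace M] [ChartedSpace (EuclideanSpace ℝ (Fin n)) M]
  [IsManifold (𝓡 n) ∞ M] {g : PseudoRiemannianMetric n M}

theorem val_endo_comm (g : PseudoRiemannianMetric n M) (K : SymTensor n M) (x : M)
    (v w : Tan n x) : g.val x (endo g K.1 x v) w = g.val x v (endo g K.1 x w) := by
  rw [g.symm]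
  exact K.2.1 x (g.flat x w) (g.flat x v)

theorem val_eq_zero_of_eigenvectors {K : SymTensor n M} {x : M} {v w : Tan n x} {r s : ℝ}
    (hv : endo g K.1 x v = r • v) (hw : endo g K.1 x w = s • w) (hrs : r ≠ s) :
    g.val x v w = 0 := by
  have h := val_endo_comm g K x v w
  rw [hv, hw] at h
  simp only [map_smul, smul_apply, smul_eq_mul] at h
  have : (r - s) * g.val x v w = 0 := by linarith
  exact (mul_eq_zero.1 this).resolve_left (sub_ne_zero.2 hrs)

theorem endo_flat_symm (K : ContraField n M) (x : M) (α : Cotan n x) :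
    endo g K x ((g.flat x).symm α) = K x α := by
  simp [endo]

theorem eq_of_endo_eq {K L : ContraField n M} {x : M} (h : endo g K x = endo g L x) :
    K x = L x := by
  refine LinearMap.ext fun α => ?_
  rw [← endo_flat_symm (g := g) K, ← endo_flat_symm (g := g) L, h]

theorem endo_contra (x : M) : endo g g.contra x = LinearMap.id := by
  refine LinearMap.ext fun v => ?_
  simp [endo, PseudoRiemannianMetric.contra]

/-- Every eigenvector of `K` is an eigenvector of `L`. -/
def IsDiagonalFor (g : PseudoRiemannianMetric n M) (K L : ContraField n M) : Prop :=
  ∀ (x : M) (v : Tan n x) (μ : ℝ), endo g K x v = μ • v → ∃ ν : ℝ, endo g L x v = ν • v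

theorem isDiagonalFor_contra (K : ContraField n M) : IsDiagonalFor g K g.contra :=
  fun x v _ _ => ⟨1, by rw [endo_contra, one_smul, LinearMap.id_apply]⟩

variable {φ : PartialDiffeomorph (𝓡 n) (𝓡 n) (EuclideanSpace ℝ (Fin n)) M ∞} {K : SymTensor n M}

/-- `K` is self-adjoint for `g`, so eigenvectors with different eigenvalues are orthogonal. Two
coordinate vectors cannot share an eigenvalue: simplicity would make them proportional. -/
theorem val_frame_eq_zero (hK : ∀ x : M, HasSimpleEigenvalues g K.1 x)
    (hφ : ∀ q ∈ φ.source, ∀ i : Fin n, ∃ μ : ℝ,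
      endo g K.1 (φ q) (frame φ q i) = μ • frame φ q i)
    {q : EuclideanSpace ℝ (Fin n)} (hq : q ∈ φ.source) {i j : Fin n} (hij : i ≠ j) :
    g.val (φ q) (frame φ q i) (frame φ q j) = 0 := by
  obtain ⟨r, hr⟩ := hφ q hq i
  obtain ⟨s, hs⟩ := hφ q hq j
  refine val_eq_zero_of_eigenvectors hr hs fun hrs => ?_
  obtain ⟨b, μ, hμ, hb⟩ := hK (φ q)
  rw [← hrs] at hs
  rw [← frameBasis_apply hq] at hr hs
  obtain ⟨c, hc⟩ := exists_eq_smul_of_eigenvector hb hμ hr hs ((frameBasis hq).ne_zero i)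
  have := congrArg (fun v => (frameBasis hq).repr v j) hc
  simp [Finsupp.single_eq_of_ne (Ne.symm hij)] at this

/-- Orthogonality of the web coordinates makes the covector of `∂_i` a multiple of `dx_i`. This
passes from diagonal endomorphisms to diagonal contravariant components. -/
theorem flat_frame (hK : ∀ x : M, HasSimpleEigenvalues g K.1 x)
    (hφ : ∀ q ∈ φ.source, ∀ i : Fin n, ∃ μ : ℝ,
      endo g K.1 (φ q) (frame φ q i) = μ • frame φ q i)
    {q : EuclideanSpace ℝ (Fin n)} (hq : q ∈ φ.source) (i : Fin n) :
    g.flat (φ q) (frame φ q i) =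
      g.val (φ q) (frame φ q i) (frame φ q i) • mvfderiv (𝓡 n) (coordFn φ i) (φ q) := by
  rw [cotan_eq_sum_coordFn hq (g.flat (φ q) (frame φ q i))]
  refine Fintype.sum_eq_single i fun j hj => ?_
  have : g.flat (φ q) (frame φ q i) (frame φ q j) = 0 := val_frame_eq_zero hK hφ hq (Ne.symm hj)
  rw [this, zero_smul]

theorem val_frame_self_ne_zero (hK : ∀ x : M, HasSimpleEigenvalues g K.1 x)
    (hφ : ∀ q ∈ φ.source, ∀ i : Fin n, ∃ μ : ℝ,
      endo g K.1 (φ q) (frame φ q i) = μ • frame φ q i)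
    {q : EuclideanSpace ℝ (Fin n)} (hq : q ∈ φ.source) (i : Fin n) :
    g.val (φ q) (frame φ q i) (frame φ q i) ≠ 0 := by
  intro h
  have h1 := flat_frame hK hφ hq i
  rw [h, zero_smul, LinearEquiv.map_eq_zero_iff, ← frameBasis_apply hq] at h1
  exact (frameBasis hq).ne_zero i h1

theorem IsDiagonalFor.isDiagonalIn {L : ContraField n M} (hL : IsDiagonalFor g K.1 L)
    (hK : ∀ x : M, HasSimpleEigenvalues g K.1 x)
    (hφ : ∀ q ∈ φ.source, ∀ i : Fin n, ∃ μ : ℝ,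
      endo g K.1 (φ q) (frame φ q i) = μ • frame φ q i) : IsDiagonalIn φ L := by
  intro q hq i
  obtain ⟨μ, hμ⟩ := hφ q hq i
  obtain ⟨ν, hν⟩ := hL (φ q) _ μ hμ
  have h0 := val_frame_self_ne_zero hK hφ hq i
  have h1 : endo g L (φ q) (frame φ q i) = L (φ q) (g.flat (φ q) (frame φ q i)) := rfl
  rw [h1, flat_frame hK hφ hq, map_smul] at hν
  refine ⟨(g.val (φ q) (frame φ q i) (frame φ q i))⁻¹ * ν, ?_⟩
  rw [mul_smul, ← hν, smul_smul, inv_mul_cancel₀ h0, one_smul]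

theorem diagCoeff_contra_ne_zero (hK : ∀ x : M, HasSimpleEigenvalues g K.1 x)
    (hφ : ∀ q ∈ φ.source, ∀ i : Fin n, ∃ μ : ℝ,
      endo g K.1 (φ q) (frame φ q i) = μ • frame φ q i)
    {q : EuclideanSpace ℝ (Fin n)} (hq : q ∈ φ.source) (i : Fin n) :
    diagCoeff φ g.contra i q ≠ 0 := by
  intro h
  have h1 := ((isDiagonalFor_contra K.1).isDiagonalIn hK hφ).apply_coordFn hq i
  rw [h, zero_smul] at h1
  have h2 : mvfderiv (𝓡 n) (coordFn φ i) (φ q) = 0 := (g.flat (φ q)).symm.map_eq_zero_iff.1 h1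
  have h3 := mvfderiv_coordFn_frame hq i i
  rw [h2] at h3
  simp at h3

/-- The eigenvalues of diagonal tensors at a point. -/
def evalDiag (g : PseudoRiemannianMetric n M) {x : M} (b : Module.Basis (Fin n) ℝ (Tan n x)) :
    SymTensor n M →ₗ[ℝ] (Fin n → ℝ) where
  toFun L i := b.repr (endo g L.1 x (b i)) i
  map_add' L L' := by
    funext i
    simp [endo]
  map_smul' c L := by
    funext i
    simp [endo]

theorem endo_eq_evalDiag_smul {x : M} {b : Module.Basis (Fin n) ℝ (Tan n x)} {μ : Fin n → ℝ}
    (hb : ∀ i, endo g K.1 x (b i) = μ i • b i) {L : SymTensor n M}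
    (hL : IsDiagonalFor g K.1 L.1) (i : Fin n) :
    endo g L.1 x (b i) = evalDiag g b L i • b i := by
  obtain ⟨ν, hν⟩ := hL x (b i) _ (hb i)
  simp [evalDiag, hν]

/-- The space of all Killing tensors that are diagonal in the eigenvectors of `K`. -/
def killingSpace (g : PseudoRiemannianMetric n M) (K : SymTensor n M) :
    Submodule ℝ (SymTensor n M) where
  carrier := {L | IsKilling g L ∧ IsDiagonalFor g K.1 L.1}
  add_mem' := by
    rintro L L' ⟨hL, hd⟩ ⟨hL', hd'⟩
    refine ⟨fun f hf x => ?_, fun x v μ hv => ?_⟩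
    · have := schouten_add_left L L' g.contraTensor hf x
      exact this.trans (by rw [show g.contraTensor.1 = g.contra from rfl, hL f hf x, hL' f hf x,
        add_zero])
    · obtain ⟨ν, hν⟩ := hd x v μ hv
      obtain ⟨ν', hν'⟩ := hd' x v μ hv
      refine ⟨ν + ν', ?_⟩
      rw [add_smul, ← hν, ← hν']
      rfl
  zero_mem' := by
    refine ⟨fun f hf x => ?_, fun x v μ _ => ⟨0, by simp [endo]⟩⟩
    have := schouten_smul_left 0 (0 : SymTensor n M) g.contraTensor hf x
    rw [zero_smul, zero_mul] at this
    exact this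
  smul_mem' := by
    rintro c L ⟨hL, hd⟩
    refine ⟨fun f hf x => ?_, fun x v μ hv => ?_⟩
    · have := schouten_smul_left c L g.contraTensor hf x
      exact this.trans (by rw [show g.contraTensor.1 = g.contra from rfl, hL f hf x, mul_zero])
    · obtain ⟨ν, hν⟩ := hd x v μ hv
      refine ⟨c * ν, ?_⟩
      rw [mul_smul, ← hν]
      rfl

theorem contraTensor_mem_killingSpace (g : PseudoRiemannianMetric n M) (K : SymTensor n M) :
    g.contraTensor ∈ killingSpace g K :=
  ⟨fun f _ x => by simp [schouten, PseudoRiemannianMetric.contraTensor], isDiagonalFor_contra K.1⟩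

variable [T2Space M]

theorem isOpen_ne_zero (L : SymTensor n M) : IsOpen {x | L.1 x ≠ 0} := by
  rw [isOpen_iff_mem_nhds]
  intro x hx
  obtain ⟨f, hf, hfx⟩ : ∃ f, SmoothFn n f ∧ L.1.pair f f x ≠ 0 := by
    by_contra! h
    exact hx (ContraField.eq_zero_of_pair_self (L.2.1 x) h)
  have hc := (L.2.2 f f hf hf).continuous
  filter_upwards [hc.continuousAt.eventually_ne hfx] with y hy h0
  exact hy (by simp [ContraField.pair, h0])

/-- The zero set is closed by continuity and open by the first-order system in web coordinates
around each of its points. -/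
theorem eq_zero_of_apply_eq_zero [ConnectedSpace M] (hK : IsCharacteristic g K)
    {L : SymTensor n M} (hL : IsKilling g L) (hKL : IsDiagonalFor g K.1 L.1) {x : M}
    (hx : L.1 x = 0) : L = 0 := by
  have ho : IsOpen {y | L.1 y = 0} := by
    rw [isOpen_iff_mem_nhds]
    intro y hy
    obtain ⟨φ, hyφ, hφ⟩ := hK.integrable y
    exact eventually_eq_zero_of_schouten (T := g.contraTensor)
      (hKL.isDiagonalIn hK.simple hφ) ((isDiagonalFor_contra K.1).isDiagonalIn hK.simple hφ)
      (fun q hq i => diagCoeff_contra_ne_zero hK.simple hφ hq i) hL hyφ hy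
  have hcl : IsClopen {y | L.1 y = 0} := ⟨⟨isOpen_ne_zero L⟩, ho⟩
  have hu := hcl.eq_univ ⟨x, hx⟩
  refine Subtype.ext (funext fun y => ?_)
  have : y ∈ {y | L.1 y = 0} := hu ▸ mem_univ y
  exact this

theorem eq_of_apply_eq [ConnectedSpace M] (hK : IsCharacteristic g K)
    {𝒦 : Submodule ℝ (SymTensor n M)} (hkill : ∀ L ∈ 𝒦, IsKilling g L)
    (hdiag : ∀ L ∈ 𝒦, IsDiagonalFor g K.1 L.1) {L L' : SymTensor n M} (hL : L ∈ 𝒦)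
    (hL' : L' ∈ 𝒦) {x : M} (hx : L.1 x = L'.1 x) : L = L' := by
  have hm := 𝒦.sub_mem hL hL'
  refine sub_eq_zero.1 (eq_zero_of_apply_eq_zero hK (hkill _ hm) (hdiag _ hm) (x := x) ?_)
  exact sub_eq_zero.2 hx

theorem evalDiag_injective [ConnectedSpace M] (hK : IsCharacteristic g K)
    {𝒦 : Submodule ℝ (SymTensor n M)} (hkill : ∀ L ∈ 𝒦, IsKilling g L)
    (hdiag : ∀ L ∈ 𝒦, IsDiagonalFor g K.1 L.1) {x : M} {b : Module.Basis (Fin n) ℝ (Tan n x)}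
    {μ : Fin n → ℝ} (hb : ∀ i, endo g K.1 x (b i) = μ i • b i) :
    Function.Injective (evalDiag g b ∘ₗ 𝒦.subtype) := by
  intro L L' h
  refine Subtype.ext (eq_of_apply_eq hK hkill hdiag L.2 L'.2 (x := x) (eq_of_endo_eq (g := g) ?_))
  refine b.ext fun i => ?_
  rw [endo_eq_evalDiag_smul hb (hdiag _ L.2), endo_eq_evalDiag_smul hb (hdiag _ L'.2)]
  exact congrArg (· • b i) (congrFun h i)

/-- Evaluation at `x` is an injective linear map from the `n`-dimensional `𝒦` to `ℝⁿ`, hence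
surjective: any eigenvalues can be prescribed at one point. -/
theorem IsKSSpaceOf.exists_endo_eq [ConnectedSpace M] (hK : IsCharacteristic g K)
    {𝒦 : Submodule ℝ (SymTensor n M)} (h𝒦 : IsKSSpaceOf g K 𝒦) (x : M) (c : ℝ → ℝ) :
    ∃ L ∈ 𝒦, ∀ (v : Tan n x) (μ : ℝ), endo g K.1 x v = μ • v → endo g L.1 x v = c μ • v := by
  obtain ⟨b, μ, hμ, hb⟩ := hK.simple x
  have hinj := evalDiag_injective hK h𝒦.killing h𝒦.diagonal hb
  have : FiniteDimensional ℝ 𝒦 := FiniteDimensional.of_injective _ hinj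
  have hrank : Module.finrank ℝ 𝒦 = Module.finrank ℝ (Fin n → ℝ) := by
    rw [h𝒦.finrank_eq]; simp
  have hsurj : Function.Surjective (evalDiag g b ∘ₗ 𝒦.subtype) := by
    rw [← LinearMap.range_eq_top]
    apply Submodule.eq_top_of_finrank_eq
    rw [LinearMap.finrank_range_of_inj hinj, hrank]
  obtain ⟨L, hL⟩ := hsurj fun i => c (μ i)
  refine ⟨L.1, L.2, fun v r hv => apply_eigenvector_of_basis hb (fun i => ?_) hv⟩
  rw [endo_eq_evalDiag_smul hb (h𝒦.diagonal _ L.2)]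
  exact congrArg (· • b i) (congrFun hL i)

theorem IsKSSpaceOf.exists_endo_eq_of_diagonal [ConnectedSpace M] (hK : IsCharacteristic g K)
    {𝒦 : Submodule ℝ (SymTensor n M)} (h𝒦 : IsKSSpaceOf g K 𝒦) (x : M)
    (T : Tan n x →ₗ[ℝ] Tan n x)
    (hT : ∀ (v : Tan n x) (μ : ℝ), endo g K.1 x v = μ • v → ∃ ν : ℝ, T v = ν • v) :
    ∃ L ∈ 𝒦, endo g L.1 x = T := by
  obtain ⟨b, μ, hμ, hb⟩ := hK.simple x
  choose ν hν using fun i => hT (b i) (μ i) (hb i)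
  -- The `μ i` are distinct, so the values `ν i` define a function of the eigenvalue; its value 0
  -- off the spectrum plays no role.
  obtain ⟨L, hL, hLc⟩ := h𝒦.exists_endo_eq hK x (Function.extend μ ν 0)
  refine ⟨L, hL, b.ext fun i => ?_⟩
  rw [hLc _ _ (hb i), hμ.extend_apply, hν]

/-- Evaluation at `x` is injective by rigidity and surjective by hypothesis, so one point suffices
to find the dimension. -/
theorem isKSSpaceOf_killingSpace [ConnectedSpace M] (hK : IsCharacteristic g K) {x : M}
    (h : ∀ c : ℝ → ℝ, ∃ L ∈ killingSpace g K, ∀ (v : Tan n x) (μ : ℝ),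
      endo g K.1 x v = μ • v → endo g L.1 x v = c μ • v) :
    IsKSSpaceOf g K (killingSpace g K) := by
  refine ⟨fun L hL => hL.1, fun L hL => hL.2, ?_⟩
  obtain ⟨b, μ, hμ, hb⟩ := hK.simple x
  have hinj := evalDiag_injective hK (𝒦 := killingSpace g K) (fun L hL => hL.1)
    (fun L hL => hL.2) hb
  have hsurj : Function.Surjective (evalDiag g b ∘ₗ (killingSpace g K).subtype) := by
    intro c
    obtain ⟨L, hL, hLc⟩ := h (Function.extend μ c 0)
    refine ⟨⟨L, hL⟩, funext fun i => ?_⟩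
    have := hLc (b i) _ (hb i)
    rw [hμ.extend_apply] at this
    change b.repr (endo g L.1 x (b i)) i = c i
    simp [this]
  have := (LinearEquiv.ofBijective _ ⟨hinj, hsurj⟩).finrank_eq
  simpa using this

end Uniqueness

/-- Used to select, among the images of an eigenbasis or of the coordinate vectors under a
projection, those that form a basis of the target. -/
theorem exists_basis_of_span_eq_top {ι V : Type*} [Finite ι] [AddCommGroup V] [Module ℝ V]
    {m : ℕ} (hm : Module.finrank ℝ V = m) {v : ι → V} (hv : ⊤ ≤ Submodule.span ℝ (range v)) :
    ∃ (σ : Fin m → ι) (b : Module.Basis (Fin m) ℝ V), Function.Injective σ ∧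
      ∀ i, b i = v (σ i) := by
  obtain ⟨κ, a, ha, hspan, hli⟩ := exists_linearIndependent' ℝ v
  have : Finite κ := Finite.of_injective a ha
  have : Fintype κ := Fintype.ofFinite κ
  let b := Module.Basis.mk hli (hspan ▸ hv)
  have hcard : Fintype.card κ = m := by rw [← hm, Module.finrank_eq_card_basis b]
  let e := Fintype.equivFinOfCardEq hcard
  exact ⟨a ∘ e.symm, b.reindex e, ha.comp e.symm.injective, fun i => by simp [b]⟩

theorem finrank_tan {m : ℕ} {N : Type*} [TopologicalSpace N]
    [ChartedSpace (EuclideanSpace ℝ (Fin m)) N] (z : N) : Module.finrank ℝ (Tan m z) = m :=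
  finrank_euclideanSpace_fin (𝕜 := ℝ) (n := m)

/-! ### The inverse function theorem for parametrizations. -/

section InverseFunction

variable {m : ℕ} {N : Type*} [TopologicalSpace N] [ChartedSpace (EuclideanSpace ℝ (Fin m)) N]
  [IsManifold (𝓡 m) ∞ N]

theorem exists_partialDiffeomorph_of_bijective_mfderiv {ψ : EuclideanSpace ℝ (Fin m) → N}
    {V : Set (EuclideanSpace ℝ (Fin m))} (hV : IsOpen V) (hψ : ContMDiffOn (𝓡 m) (𝓡 m) ∞ ψ V)
    {u : EuclideanSpace ℝ (Fin m)} (hu : u ∈ V)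
    (hb : Function.Bijective (mfderiv (𝓡 m) (𝓡 m) ψ u)) :
    ∃ φ : PartialDiffeomorph (𝓡 m) (𝓡 m) (EuclideanSpace ℝ (Fin m)) N ∞,
      u ∈ φ.source ∧ φ.source ⊆ V ∧ EqOn φ ψ φ.source := by
  let e := chartAt (EuclideanSpace ℝ (Fin m)) (ψ u)
  let h : EuclideanSpace ℝ (Fin m) → EuclideanSpace ℝ (Fin m) := e ∘ ψ
  let V' := V ∩ ψ ⁻¹' e.source
  have hV' : IsOpen V' := hψ.continuousOn.isOpen_inter_preimage hV e.open_source
  have huV' : u ∈ V' := ⟨hu, mem_chart_source _ _⟩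
  have he : ContMDiffOn (𝓡 m) (𝓡 m) ∞ e e.source := contMDiffOn_chart
  have hh : ContDiffOn ℝ ∞ h V' := by
    have : ContMDiffOn (𝓡 m) (𝓡 m) ∞ h V' :=
      he.comp (hψ.mono inter_subset_left) inter_subset_right
    exact this.contDiffOn
  have hhu : ContDiffAt ℝ ∞ h u := hh.contDiffAt (hV'.mem_nhds huV')
  have hbij : Function.Bijective (fderiv ℝ h u) := by
    have h1 : mfderiv (𝓡 m) (𝓡 m) h u =
        (mfderiv (𝓡 m) (𝓡 m) e (ψ u)).comp (mfderiv (𝓡 m) (𝓡 m) ψ u) :=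
      mfderiv_comp u ((he.contMDiffAt (e.open_source.mem_nhds huV'.2)).mdifferentiableAt (by simp))
        ((hψ.contMDiffAt (hV.mem_nhds hu)).mdifferentiableAt (by simp))
    obtain ⟨A, hA⟩ := isInvertible_mfderiv_extChartAt (I := 𝓡 m)
      (mem_extChartAt_source (I := 𝓡 m) (ψ u))
    have hA' : mfderiv (𝓡 m) (𝓡 m) e (ψ u) = A.toContinuousLinearMap := hA.symm
    rw [mfderiv_eq_fderiv] at h1
    rw [h1, hA']
    exact A.bijective.comp hb
  let A : EuclideanSpace ℝ (Fin m) ≃L[ℝ] EuclideanSpace ℝ (Fin m) :=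
    ContinuousLinearEquiv.ofBijective (fderiv ℝ h u) (LinearMap.ker_eq_bot.2 hbij.1)
      (LinearMap.range_eq_top.2 hbij.2)
  have hA : HasFDerivAt h (A : EuclideanSpace ℝ (Fin m) →L[ℝ] EuclideanSpace ℝ (Fin m)) u :=
    (hhu.differentiableAt (by simp)).hasFDerivAt
  let O := hhu.toOpenPartialHomeomorph h hA (by simp)
  have hOu : u ∈ O.source := hhu.mem_toOpenPartialHomeomorph_source hA (by simp)
  -- The inverse must be smooth on its whole domain, not only at the image of `u`; hence the
  -- restriction to the open set where the derivative is invertible.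
  let V'' := V' ∩ fderiv ℝ h ⁻¹' range ((↑) : (EuclideanSpace ℝ (Fin m) ≃L[ℝ]
    EuclideanSpace ℝ (Fin m)) → EuclideanSpace ℝ (Fin m) →L[ℝ] EuclideanSpace ℝ (Fin m))
  have hV'' : IsOpen V'' := (hh.continuousOn_fderiv_of_isOpen hV' (by simp)).isOpen_inter_preimage
    hV' ContinuousLinearEquiv.isOpen
  let O' := O.restrOpen V'' hV''
  have hO' : ∀ y ∈ O'.target, ContDiffAt ℝ ∞ O'.symm y := by
    intro y hy
    have hy' : O'.symm y ∈ O.source ∩ V'' := by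
      have := O'.map_target hy
      rwa [OpenPartialHomeomorph.restrOpen_source] at this
    obtain ⟨A', hA'⟩ := hy'.2.2
    refine O'.contDiffAt_symm (f₀' := A') hy ?_ (hh.contDiffAt (hV'.mem_nhds hy'.2.1))
    have := ((hh.contDiffAt (hV'.mem_nhds hy'.2.1)).differentiableAt (by simp)).hasFDerivAt
    rw [← hA'] at this
    exact this
  let P := O'.trans e.symm
  have hPs : ∀ z ∈ P.source, z ∈ V'' := by
    intro z hz
    have hz' : z ∈ O.source ∩ V'' := by
      have : z ∈ O'.source := hz.1
      rwa [OpenPartialHomeomorph.restrOpen_source] at this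
    exact hz'.2
  have hPeq : EqOn P ψ P.source := fun z hz => e.left_inv (hPs z hz).1.2
  refine ⟨⟨P.toPartialEquiv, P.open_source, P.open_target, ?_, ?_⟩, ?_, fun z hz => (hPs z hz).1.1,
    hPeq⟩
  · exact (hψ.mono fun z hz => (hPs z hz).1.1).congr hPeq
  · intro y hy
    have hy1 : y ∈ e.source := hy.1
    have hy2 : e y ∈ O'.target := hy.2
    have h1 : ContMDiffAt (𝓡 m) (𝓡 m) ∞ O'.symm (e y) := (hO' _ hy2).contMDiffAt
    exact (h1.comp y (he.contMDiffAt (e.open_source.mem_nhds hy1))).contMDiffWithinAt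
  · refine ⟨?_, ?_⟩
    · change u ∈ O'.source
      rw [OpenPartialHomeomorph.restrOpen_source]
      exact ⟨hOu, huV', A, rfl⟩
    · exact e.map_source huV'.2

end InverseFunction

/-! ### Transfer of simple eigenvalues and web coordinates along projections. -/

section Transfer

variable {n m : ℕ} {M : Type*} [TopologicalSpace M] [ChartedSpace (EuclideanSpace ℝ (Fin n)) M]
  [IsManifold (𝓡 n) ∞ M] {N : Type*} [TopologicalSpace N]
  [ChartedSpace (EuclideanSpace ℝ (Fin m)) N] [IsManifold (𝓡 m) ∞ N]
  {g : PseudoRiemannianMetric n M} {K : ContraField n M}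
  {gN : PseudoRiemannianMetric m N} {KN : ContraField m N}

/-- `A` maps `K` to `KN` up to an affine change of the eigenvalues. -/
def Intertwines (g : PseudoRiemannianMetric n M) (K : ContraField n M)
    (gN : PseudoRiemannianMetric m N) (KN : ContraField m N) {x : M} {z : N}
    (A : Tan n x →L[ℝ] Tan m z) : Prop :=
  ∃ a c : ℝ, a ≠ 0 ∧ ∀ v, endo gN KN z (A v) = A (a • endo g K x v + c • v)

theorem top_le_span_of_surjective {ι V W : Type*} [AddCommGroup V] [Module ℝ V] [AddCommGroup W]
    [Module ℝ W] (b : Module.Basis ι ℝ V) {A : V →ₗ[ℝ] W} (hA : Function.Surjective A) :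
    ⊤ ≤ Submodule.span ℝ (range (A ∘ b)) := by
  rw [range_comp, Submodule.span_image, b.span_eq, Submodule.map_top, LinearMap.range_eq_top.2 hA]

/-- Images of an eigenbasis span the target, and those forming a basis have eigenvalues `a μ + c`,
still distinct because `a ≠ 0`. -/
theorem HasSimpleEigenvalues.of_intertwines {x : M} {z : N} (hK : HasSimpleEigenvalues g K x)
    {A : Tan n x →L[ℝ] Tan m z} (hA : Function.Surjective A) (h : Intertwines g K gN KN A) :
    HasSimpleEigenvalues gN KN z := by
  obtain ⟨b, μ, hμ, hb⟩ := hK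
  obtain ⟨a, c, ha, h⟩ := h
  obtain ⟨σ, b', hσ, hb'⟩ := exists_basis_of_span_eq_top (finrank_tan z)
    (top_le_span_of_surjective b (A := A.toLinearMap) hA)
  refine ⟨b', fun i => a * μ (σ i) + c, fun i j hij => ?_, fun i => ?_⟩
  · have hij : a * μ (σ i) + c = a * μ (σ j) + c := hij
    exact hσ (hμ (mul_left_cancel₀ ha (by linarith)))
  · rw [hb']
    change endo gN KN z (A (b (σ i))) = _ • A (b (σ i))
    rw [h, hb, smul_smul, ← add_smul, map_smul]

/-- Choose `m` coordinate vectors at `x` whose images under the differential of `π` form a basis.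
The coordinate plane through `x` that they span, followed by `π`, is a local parametrization of `N`
by the inverse function theorem. Its coordinate vectors are images of coordinate vectors of the web
of `K`, hence eigenvectors of `KN`. -/
theorem hasIntegrableEigenspaces_of_intertwines (hK : HasIntegrableEigenspaces g K)
    (h : ∀ z : N, ∃ (W : Set M) (π : M → N) (x : M), IsOpen W ∧ ContMDiffOn (𝓡 n) (𝓡 m) ∞ π W ∧
      x ∈ W ∧ π x = z ∧ Function.Surjective (mfderiv (𝓡 n) (𝓡 m) π x) ∧
      ∀ y ∈ W, Intertwines g K gN KN (mfderiv (𝓡 n) (𝓡 m) π y)) :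
    HasIntegrableEigenspaces gN KN := by
  intro z
  obtain ⟨W, π, x, hW, hπ, hxW, rfl, hsurj, hint⟩ := h z
  obtain ⟨φ, hxφ, hφ⟩ := hK x
  obtain ⟨q, hq, rfl⟩ : ∃ q ∈ φ.source, φ q = x := ⟨φ.symm x, symm_mem_source hxφ,
    apply_symm_apply hxφ⟩
  obtain ⟨σ, b, hσ, hb⟩ := exists_basis_of_span_eq_top (finrank_tan (π (φ q)))
    (top_le_span_of_surjective (frameBasis hq)
      (A := (mfderiv (𝓡 n) (𝓡 m) π (φ q)).toLinearMap) hsurj)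
  let J : EuclideanSpace ℝ (Fin m) →L[ℝ] EuclideanSpace ℝ (Fin n) :=
    ∑ i, (EuclideanSpace.proj (𝕜 := ℝ) i : EuclideanSpace ℝ (Fin m) →L[ℝ] ℝ).smulRight
      (EuclideanSpace.single (σ i) (1 : ℝ))
  have hJ : ∀ i, J (EuclideanSpace.single i 1) = EuclideanSpace.single (σ i) 1 := fun i => by
    simp only [J, sum_apply, ContinuousLinearMap.smulRight_apply]
    rw [Fintype.sum_eq_single i fun j hj => by simp [hj]]
    simp
  -- The affine coordinate plane through `q` in the selected directions `σ i`.
  let τ : EuclideanSpace ℝ (Fin m) → EuclideanSpace ℝ (Fin n) := fun u => q + J u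
  have hτ : ContMDiff (𝓡 m) (𝓡 n) ∞ τ := (contDiff_const.add J.contDiff).contMDiff
  have hτd : ∀ u, mfderiv (𝓡 m) (𝓡 n) τ u = J := fun u => by
    rw [mfderiv_eq_fderiv]
    exact (J.hasFDerivAt.const_add q).fderiv
  let S := φ.source ∩ φ ⁻¹' W
  have hS : IsOpen S := φ.contMDiffOn.continuousOn.isOpen_inter_preimage φ.open_source hW
  let V := τ ⁻¹' S
  have hV : IsOpen V := hS.preimage hτ.continuous
  let ψ : EuclideanSpace ℝ (Fin m) → N := fun u => π (φ (τ u))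
  have hψ : ContMDiffOn (𝓡 m) (𝓡 m) ∞ ψ V := by
    have h1 : ContMDiffOn (𝓡 n) (𝓡 m) ∞ (π ∘ φ) S :=
      hπ.comp (φ.contMDiffOn.mono inter_subset_left) inter_subset_right
    exact h1.comp hτ.contMDiffOn fun u hu => hu
  have hψd : ∀ u ∈ V, ∀ i, mfderiv (𝓡 m) (𝓡 m) ψ u (EuclideanSpace.single i (1 : ℝ)) =
      mfderiv (𝓡 n) (𝓡 m) π (φ (τ u)) (frame φ (τ u) (σ i)) := by
    intro u hu i
    have hd1 := φ.mdifferentiableAt (by simp) hu.1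
    have hd2 : MDifferentiableAt (𝓡 n) (𝓡 m) π (φ (τ u)) :=
      (hπ.contMDiffAt (hW.mem_nhds hu.2)).mdifferentiableAt (by simp)
    have h1 := mfderiv_comp_apply (I := 𝓡 m) (I' := 𝓡 n) (I'' := 𝓡 m) u
      (hd2.comp (τ u) hd1) (hτ.mdifferentiable (by simp) u)
      (EuclideanSpace.single i (1 : ℝ) : EuclideanSpace ℝ (Fin m))
    refine h1.trans ?_
    have h2 : mfderiv (𝓡 m) (𝓡 n) τ u (EuclideanSpace.single i (1 : ℝ)) =
        EuclideanSpace.single (σ i) (1 : ℝ) :=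
      (congrArg (fun T : EuclideanSpace ℝ (Fin m) →L[ℝ] EuclideanSpace ℝ (Fin n) =>
        T (EuclideanSpace.single i (1 : ℝ))) (hτd u)).trans (hJ i)
    exact (congrArg (mfderiv (𝓡 n) (𝓡 m) (π ∘ φ) (τ u)) h2).trans
      (mfderiv_comp_apply (τ u) hd2 hd1 _)
  have hτ0 : τ 0 = q := by simp [τ]
  have h0 : (0 : EuclideanSpace ℝ (Fin m)) ∈ V := by
    change τ 0 ∈ S
    rw [hτ0]
    exact ⟨hq, hxW⟩
  have hψ0 : ψ 0 = π (φ q) := by simp only [ψ, hτ0]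
  have hbij : Function.Bijective (mfderiv (𝓡 m) (𝓡 m) ψ 0) := by
    let T : EuclideanSpace ℝ (Fin m) →L[ℝ] EuclideanSpace ℝ (Fin m) := mfderiv (𝓡 m) (𝓡 m) ψ 0
    let b' : Module.Basis (Fin m) ℝ (EuclideanSpace ℝ (Fin m)) := b
    let e := (EuclideanSpace.basisFun (Fin m) ℝ).toBasis.equiv b' (Equiv.refl _)
    have hF : ∀ y, y = q → ∀ j, (mfderiv (𝓡 n) (𝓡 m) π (φ y) (frame φ y j) :
        EuclideanSpace ℝ (Fin m)) = mfderiv (𝓡 n) (𝓡 m) π (φ q) (frame φ q j) := by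
      rintro _ rfl j
      rfl
    have hT : T.toLinearMap = e.toLinearMap := by
      refine (EuclideanSpace.basisFun (Fin m) ℝ).toBasis.ext fun i => ?_
      have h1 : b' i = mfderiv (𝓡 n) (𝓡 m) π (φ q) (frame φ q (σ i)) := by
        rw [← frameBasis_apply hq]
        exact hb i
      rw [LinearEquiv.coe_coe, Module.Basis.equiv_apply, Equiv.refl_apply, h1,
        OrthonormalBasis.coe_toBasis, EuclideanSpace.basisFun_apply]
      exact (hψd 0 h0 i).trans (hF _ hτ0 _)
    change Function.Bijective T.toLinearMap
    rw [hT]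
    exact e.bijective
  obtain ⟨χ, h0χ, hχV, hχ⟩ := exists_partialDiffeomorph_of_bijective_mfderiv hV hψ h0 hbij
  refine ⟨χ, ?_, fun u hu i => ?_⟩
  · rw [← hψ0, ← hχ h0χ]
    exact χ.map_source h0χ
  · have he : χ =ᶠ[𝓝 u] ψ := hχ.eventuallyEq_of_mem (χ.open_source.mem_nhds hu)
    have huV := hχV hu
    obtain ⟨μ, hμ⟩ := hφ (τ u) huV.1 (σ i)
    obtain ⟨a, c, -, hac⟩ := hint _ huV.2
    have hμ : endo g K (φ (τ u)) (frame φ (τ u) (σ i)) = μ • frame φ (τ u) (σ i) := hμ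
    have h1 := hac (frame φ (τ u) (σ i))
    rw [hμ, smul_smul, ← add_smul, map_smul, ← hψd u huV] at h1
    refine ⟨a * μ + c, ?_⟩
    rw [he.mfderiv_eq]
    have hc : ∀ z, z = ψ u → ∀ w : EuclideanSpace ℝ (Fin m), endo gN KN (ψ u) w = (a * μ + c) • w →
        endo gN KN z w = (a * μ + c) • w := by
      rintro _ rfl w hw
      exact hw
    exact hc _ (hχ hu) _ h1

end Transfer

/-! ### Components of tensors on a product. -/

section Product

variable {n b k : ℕ}
  {M : Type*} [TopologicalSpace M] [ChartedSpace (EuclideanSpace ℝ (Fin n)) M]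
  {B : Type*} [TopologicalSpace B] [ChartedSpace (EuclideanSpace ℝ (Fin b)) B]
  {F : Type*} [TopologicalSpace F] [ChartedSpace (EuclideanSpace ℝ (Fin k)) F]
  {Φ : B × F → M}

/-- The differential of a local diffeomorphism `B × F → M`. -/
def diffEquiv (hl : IsLocalDiffeomorph ((𝓡 b).prod (𝓡 k)) (𝓡 n) ∞ Φ) (p : B × F) :
    TangentSpace ((𝓡 b).prod (𝓡 k)) p ≃L[ℝ] Tan n (Φ p) :=
  (hl p).mfderivToContinuousLinearEquiv (by simp)

/-- The differential of the projection to the base. -/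
def projB (hl : IsLocalDiffeomorph ((𝓡 b).prod (𝓡 k)) (𝓡 n) ∞ Φ) (p : B × F) :
    Tan n (Φ p) →L[ℝ] Tan b p.1 :=
  (mfderiv ((𝓡 b).prod (𝓡 k)) (𝓡 b) Prod.fst p).comp (diffEquiv hl p).symm.toContinuousLinearMap

/-- The differential of the projection to the fiber. -/
def projF (hl : IsLocalDiffeomorph ((𝓡 b).prod (𝓡 k)) (𝓡 n) ∞ Φ) (p : B × F) :
    Tan n (Φ p) →L[ℝ] Tan k p.2 :=
  (mfderiv ((𝓡 b).prod (𝓡 k)) (𝓡 k) Prod.snd p).comp (diffEquiv hl p).symm.toContinuousLinearMap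

/-- The differential of the inclusion of a base slice. -/
def inclB (Φ : B × F → M) (p : B × F) : Tan b p.1 →L[ℝ] Tan n (Φ p) :=
  mfderiv (𝓡 b) (𝓡 n) (fun x => Φ (x, p.2)) p.1

/-- The differential of the inclusion of a fiber slice. -/
def inclF (Φ : B × F → M) (p : B × F) : Tan k p.2 →L[ℝ] Tan n (Φ p) :=
  mfderiv (𝓡 k) (𝓡 n) (fun y => Φ (p.1, y)) p.2

theorem contMDiff_sliceB (hl : IsLocalDiffeomorph ((𝓡 b).prod (𝓡 k)) (𝓡 n) ∞ Φ) (y : F) :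
    ContMDiff (𝓡 b) (𝓡 n) ∞ (fun x => Φ (x, y)) :=
  hl.contMDiff.comp (contMDiff_id.prodMk contMDiff_const)

theorem contMDiff_sliceF (hl : IsLocalDiffeomorph ((𝓡 b).prod (𝓡 k)) (𝓡 n) ∞ Φ) (x : B) :
    ContMDiff (𝓡 k) (𝓡 n) ∞ (fun y => Φ (x, y)) :=
  hl.contMDiff.comp (contMDiff_const.prodMk contMDiff_id)

variable (hl : IsLocalDiffeomorph ((𝓡 b).prod (𝓡 k)) (𝓡 n) ∞ Φ)

theorem diffEquiv_apply (p : B × F) (v : TangentSpace ((𝓡 b).prod (𝓡 k)) p) :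
    diffEquiv hl p v = mfderiv ((𝓡 b).prod (𝓡 k)) (𝓡 n) Φ p v := rfl

theorem inclB_eq (p : B × F) (u : Tan b p.1) :
    inclB Φ p u = diffEquiv hl p ((u, 0) : EuclideanSpace ℝ (Fin b) × EuclideanSpace ℝ (Fin k)) := by
  have h1 : MDifferentiableAt (𝓡 b) ((𝓡 b).prod (𝓡 k)) (fun x => (x, p.2)) p.1 :=
    mdifferentiableAt_id.prodMk mdifferentiableAt_const
  have h := mfderiv_comp_apply (I := 𝓡 b) (I' := (𝓡 b).prod (𝓡 k)) (I'' := 𝓡 n) p.1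
    (hl.contMDiff.mdifferentiable (by simp) (p.1, p.2)) h1 u
  refine h.trans ?_
  rw [mfderiv_prod_left]
  rfl

theorem inclF_eq (p : B × F) (w : Tan k p.2) :
    inclF Φ p w = diffEquiv hl p ((0, w) : EuclideanSpace ℝ (Fin b) × EuclideanSpace ℝ (Fin k)) := by
  have h1 : MDifferentiableAt (𝓡 k) ((𝓡 b).prod (𝓡 k)) (fun y => (p.1, y)) p.2 :=
    mdifferentiableAt_const.prodMk mdifferentiableAt_id
  have h := mfderiv_comp_apply (I := 𝓡 k) (I' := (𝓡 b).prod (𝓡 k)) (I'' := 𝓡 n) p.2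
    (hl.contMDiff.mdifferentiable (by simp) (p.1, p.2)) h1 w
  refine h.trans ?_
  rw [mfderiv_prod_right]
  rfl

theorem projB_diffEquiv (p : B × F) (v : EuclideanSpace ℝ (Fin b) × EuclideanSpace ℝ (Fin k)) :
    projB hl p (diffEquiv hl p v) = v.1 := by
  have h : projB hl p (diffEquiv hl p v) = mfderiv ((𝓡 b).prod (𝓡 k)) (𝓡 b) Prod.fst p v :=
    congrArg (mfderiv ((𝓡 b).prod (𝓡 k)) (𝓡 b) Prod.fst p) ((diffEquiv hl p).symm_apply_apply v)
  rw [h, mfderiv_fst]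
  rfl

theorem projF_diffEquiv (p : B × F) (v : EuclideanSpace ℝ (Fin b) × EuclideanSpace ℝ (Fin k)) :
    projF hl p (diffEquiv hl p v) = v.2 := by
  have h : projF hl p (diffEquiv hl p v) = mfderiv ((𝓡 b).prod (𝓡 k)) (𝓡 k) Prod.snd p v :=
    congrArg (mfderiv ((𝓡 b).prod (𝓡 k)) (𝓡 k) Prod.snd p) ((diffEquiv hl p).symm_apply_apply v)
  rw [h, mfderiv_snd]
  rfl

@[simp]
theorem projB_inclB (p : B × F) (u : Tan b p.1) : projB hl p (inclB Φ p u) = u := by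
  rw [inclB_eq hl, projB_diffEquiv]

@[simp]
theorem projB_inclF (p : B × F) (w : Tan k p.2) : projB hl p (inclF Φ p w) = 0 := by
  rw [inclF_eq hl, projB_diffEquiv]
  rfl

@[simp]
theorem projF_inclB (p : B × F) (u : Tan b p.1) : projF hl p (inclB Φ p u) = 0 := by
  rw [inclB_eq hl, projF_diffEquiv]
  rfl

@[simp]
theorem projF_inclF (p : B × F) (w : Tan k p.2) : projF hl p (inclF Φ p w) = w := by
  rw [inclF_eq hl, projF_diffEquiv]

theorem projB_surjective (p : B × F) :
    Function.Surjective (projB hl p) := fun u => ⟨inclB Φ p u, projB_inclB hl p u⟩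

theorem projF_surjective (p : B × F) :
    Function.Surjective (projF hl p) := fun w => ⟨inclF Φ p w, projF_inclF hl p w⟩

theorem inclB_projB_add (p : B × F) (v : Tan n (Φ p)) :
    inclB Φ p (projB hl p v) + inclF Φ p (projF hl p v) = v := by
  obtain ⟨v, rfl⟩ := (diffEquiv hl p).surjective v
  have h : ∀ w : EuclideanSpace ℝ (Fin b) × EuclideanSpace ℝ (Fin k),
      inclB Φ p (projB hl p (diffEquiv hl p w)) + inclF Φ p (projF hl p (diffEquiv hl p w)) =
        diffEquiv hl p w := by
    intro w
    rw [projB_diffEquiv, projF_diffEquiv]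
    refine (congrArg₂ (· + ·) (inclB_eq hl p w.1) (inclF_eq hl p w.2)).trans ?_
    refine ((diffEquiv hl p).map_add _ _).symm.trans ?_
    exact congrArg (diffEquiv hl p) (Prod.ext (add_zero w.1) (zero_add w.2))
  exact h v

theorem cotan_eq_comp_add (p : B × F) (α : Cotan n (Φ p)) :
    α = (α.comp (inclB Φ p)).comp (projB hl p) + (α.comp (inclF Φ p)).comp (projF hl p) := by
  ext v
  conv_lhs => rw [← inclB_projB_add hl p v]
  simp

/-- The component of a tensor along the base. -/
def compB (L : ContraField n M) (p : B × F) : Cotan b p.1 →ₗ[ℝ] Tan b p.1 where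
  toFun α := projB hl p (L (Φ p) (α.comp (projB hl p)))
  map_add' α β := by simp [ContinuousLinearMap.add_comp]
  map_smul' c α := by simp [ContinuousLinearMap.smul_comp]

/-- The component of a tensor along the fiber. -/
def compF (L : ContraField n M) (p : B × F) : Cotan k p.2 →ₗ[ℝ] Tan k p.2 where
  toFun α := projF hl p (L (Φ p) (α.comp (projF hl p)))
  map_add' α β := by simp [ContinuousLinearMap.add_comp]
  map_smul' c α := by simp [ContinuousLinearMap.smul_comp]

theorem compB_apply (L : ContraField n M) (p : B × F) (α : Cotan b p.1) :
    compB hl L p α = projB hl p (L (Φ p) (α.comp (projB hl p))) := rfl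

theorem compF_apply (L : ContraField n M) (p : B × F) (α : Cotan k p.2) :
    compF hl L p α = projF hl p (L (Φ p) (α.comp (projF hl p))) := rfl

theorem compB_symm (L : SymTensor n M) (p : B × F) (α β : Cotan b p.1) :
    α (compB hl L.1 p β) = β (compB hl L.1 p α) :=
  L.2.1 (Φ p) (α.comp (projB hl p)) (β.comp (projB hl p))

theorem compF_symm (L : SymTensor n M) (p : B × F) (α β : Cotan k p.2) :
    α (compF hl L.1 p β) = β (compF hl L.1 p α) :=
  L.2.1 (Φ p) (α.comp (projF hl p)) (β.comp (projF hl p))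

/-- The mixed components of a tensor vanish. -/
def Splits (L : SymTensor n M) : Prop :=
  ∀ (p : B × F) (β : Cotan k p.2), projB hl p (L.1 (Φ p) (β.comp (projF hl p))) = 0

variable {hl}

theorem Splits.projF_eq_zero {L : SymTensor n M} (hL : Splits hl L) (p : B × F)
    (α : Cotan b p.1) : projF hl p (L.1 (Φ p) (α.comp (projB hl p))) = 0 := by
  refine eq_zero_of_forall_cotan fun β => ?_
  have h := L.2.1 (Φ p) (β.comp (projF hl p)) (α.comp (projB hl p))
  have h2 : α (projB hl p (L.1 (Φ p) (β.comp (projF hl p)))) = 0 := by rw [hL p β, map_zero]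
  exact h.trans h2

theorem Splits.apply_eq {L : SymTensor n M} (hL : Splits hl L) (p : B × F) (α : Cotan n (Φ p)) :
    L.1 (Φ p) α = inclB Φ p (compB hl L.1 p (α.comp (inclB Φ p))) +
      inclF Φ p (compF hl L.1 p (α.comp (inclF Φ p))) := by
  conv_lhs => rw [cotan_eq_comp_add hl p α, map_add, ← inclB_projB_add hl p (_ + _)]
  simp only [map_add, hL p, hL.projF_eq_zero p, compB_apply, compF_apply, add_zero, zero_add]

theorem mvfderiv_inclB (hl : IsLocalDiffeomorph ((𝓡 b).prod (𝓡 k)) (𝓡 n) ∞ Φ) (p : B × F)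
    {h : M → ℝ} (hh : MDifferentiableAt (𝓡 n) 𝓘(ℝ, ℝ) h (Φ p)) (u : Tan b p.1) :
    mvfderiv (𝓡 n) h (Φ p) (inclB Φ p u) =
      mvfderiv (𝓡 b) (fun x => h (Φ (x, p.2))) p.1 u :=
  (mfderiv_comp_apply (I := 𝓡 b) (I' := 𝓡 n) (I'' := 𝓘(ℝ, ℝ)) p.1 hh
    ((contMDiff_sliceB hl p.2).mdifferentiable (by simp) p.1) u).symm

theorem mvfderiv_inclF (hl : IsLocalDiffeomorph ((𝓡 b).prod (𝓡 k)) (𝓡 n) ∞ Φ) (p : B × F)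
    {h : M → ℝ} (hh : MDifferentiableAt (𝓡 n) 𝓘(ℝ, ℝ) h (Φ p)) (w : Tan k p.2) :
    mvfderiv (𝓡 n) h (Φ p) (inclF Φ p w) =
      mvfderiv (𝓡 k) (fun y => h (Φ (p.1, y))) p.2 w :=
  (mfderiv_comp_apply (I := 𝓡 k) (I' := 𝓡 n) (I'' := 𝓘(ℝ, ℝ)) p.2 hh
    ((contMDiff_sliceF hl p.1).mdifferentiable (by simp) p.2) w).symm

theorem eventually_sliceB {P : B × F → Prop} {p : B × F} (h : ∀ᶠ q in 𝓝 p, P q) :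
    ∀ᶠ x in 𝓝 p.1, P (x, p.2) :=
  (Continuous.prodMk_left p.2).continuousAt.eventually h

theorem eventually_sliceF {P : B × F → Prop} {p : B × F} (h : ∀ᶠ q in 𝓝 p, P q) :
    ∀ᶠ y in 𝓝 p.2, P (p.1, y) :=
  (Continuous.prodMk_right p.1).continuousAt.eventually h

theorem mvfderiv_add_const' {m : ℕ} {N : Type*} [TopologicalSpace N]
    [ChartedSpace (EuclideanSpace ℝ (Fin m)) N] {f : N → ℝ} {x : N}
    (hf : MDifferentiableAt (𝓡 m) 𝓘(ℝ, ℝ) f x) (c : ℝ) :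
    mvfderiv (𝓡 m) (fun y => f y + c) x = mvfderiv (𝓡 m) f x := by
  have h := mvfderiv_add (I := 𝓡 m) (g := f) (g' := fun _ => c) (x := x) hf mdifferentiableAt_const
  rw [mvfderiv_const, add_zero] at h
  exact h

theorem mvfderiv_lift (hl : IsLocalDiffeomorph ((𝓡 b).prod (𝓡 k)) (𝓡 n) ∞ Φ) {p : B × F}
    {f : M → ℝ} {u : B → ℝ} {v : F → ℝ} (hf : SmoothFn n f) (hu : SmoothFn b u)
    (hv : SmoothFn k v) (hfe : ∀ᶠ q in 𝓝 p, f (Φ q) = u q.1 + v q.2) :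
    mvfderiv (𝓡 n) f (Φ p) = (mvfderiv (𝓡 b) u p.1).comp (projB hl p) +
      (mvfderiv (𝓡 k) v p.2).comp (projF hl p) := by
  have hfd : MDifferentiableAt (𝓡 n) 𝓘(ℝ, ℝ) f (Φ p) := hf.mdifferentiable (by simp) _
  ext w
  conv_lhs => rw [← inclB_projB_add hl p w]
  rw [map_add, mvfderiv_inclB hl p hfd, mvfderiv_inclF hl p hfd]
  have h1 : (fun x => f (Φ (x, p.2))) =ᶠ[𝓝 p.1] fun x => u x + v p.2 := eventually_sliceB hfe
  have h2 : (fun y => f (Φ (p.1, y))) =ᶠ[𝓝 p.2] fun y => v y + u p.1 := by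
    filter_upwards [eventually_sliceF hfe] with y hy
    rw [hy, add_comm]
  rw [mvfderiv_congr h1, mvfderiv_congr h2, mvfderiv_add_const' (hu.mdifferentiable (by simp) _),
    mvfderiv_add_const' (hv.mdifferentiable (by simp) _)]
  rfl

/-- The value of the base component of `L` on the differentials of functions on the base. -/
def pairB (hl : IsLocalDiffeomorph ((𝓡 b).prod (𝓡 k)) (𝓡 n) ∞ Φ) (L : ContraField n M)
    (u u' : B → ℝ) (p : B × F) : ℝ :=
  mvfderiv (𝓡 b) u p.1 (compB hl L p (mvfderiv (𝓡 b) u' p.1))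

/-- The value of the fiber component of `L` on the differentials of functions on the fiber. -/
def pairF (hl : IsLocalDiffeomorph ((𝓡 b).prod (𝓡 k)) (𝓡 n) ∞ Φ) (L : ContraField n M)
    (v v' : F → ℝ) (p : B × F) : ℝ :=
  mvfderiv (𝓡 k) v p.2 (compF hl L p (mvfderiv (𝓡 k) v' p.2))

theorem pairB_neg (hl : IsLocalDiffeomorph ((𝓡 b).prod (𝓡 k)) (𝓡 n) ∞ Φ) (T : ContraField n M)
    (u : B → ℝ) : pairB hl T (-u) (-u) = pairB hl T u u := by
  funext p
  simp [pairB, mvfderiv_neg]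

theorem ContraField.pair_neg {m : ℕ} {N : Type*} [TopologicalSpace N]
    [ChartedSpace (EuclideanSpace ℝ (Fin m)) N] (T : ContraField m N) (u : N → ℝ) :
    T.pair (-u) (-u) = T.pair u u := by
  funext p
  simp [ContraField.pair, mvfderiv_neg]

theorem Splits.pair_lift {L : SymTensor n M} (hL : Splits hl L) {p : B × F} {f f' : M → ℝ}
    {u u' : B → ℝ} {v v' : F → ℝ} (hf : SmoothFn n f) (hf' : SmoothFn n f') (hu : SmoothFn b u)
    (hu' : SmoothFn b u') (hv : SmoothFn k v) (hv' : SmoothFn k v')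
    (hfe : ∀ᶠ q in 𝓝 p, f (Φ q) = u q.1 + v q.2)
    (hfe' : ∀ᶠ q in 𝓝 p, f' (Φ q) = u' q.1 + v' q.2) :
    L.1.pair f f' (Φ p) = pairB hl L.1 u u' p + pairF hl L.1 v v' p := by
  rw [ContraField.pair, mvfderiv_lift hl hf hu hv hfe, mvfderiv_lift hl hf' hu' hv' hfe', map_add]
  simp only [map_add, add_apply, ContinuousLinearMap.comp_apply, hL p, hL.projF_eq_zero p, pairB,
    pairF, compB_apply, compF_apply, add_zero, zero_add, map_zero]

/-- A local diffeomorphism `B × F → M` admits local projections to the factors whose differentials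
are `projB` and `projF`. -/
theorem exists_local_projections (hl : IsLocalDiffeomorph ((𝓡 b).prod (𝓡 k)) (𝓡 n) ∞ Φ)
    (p : B × F) : ∃ (W : Set M) (π : M → B) (σ : M → F), IsOpen W ∧ Φ p ∈ W ∧
      ContMDiffOn (𝓡 n) (𝓡 b) ∞ π W ∧ ContMDiffOn (𝓡 n) (𝓡 k) ∞ σ W ∧ π (Φ p) = p.1 ∧
      σ (Φ p) = p.2 ∧ ∀ m ∈ W, ∃ q : B × F, Φ q = m ∧ π (Φ q) = q.1 ∧ σ (Φ q) = q.2 ∧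
        (∀ v, (mfderiv (𝓡 n) (𝓡 b) π (Φ q) v : EuclideanSpace ℝ (Fin b)) = projB hl q v) ∧
        ∀ v, (mfderiv (𝓡 n) (𝓡 k) σ (Φ q) v : EuclideanSpace ℝ (Fin k)) = projF hl q v := by
  obtain ⟨Ψ, hp, hΨ⟩ := hl p
  have hinv : ∀ q ∈ Ψ.source, Ψ.symm (Φ q) = q := fun q hq => by
    rw [hΨ hq]
    exact Ψ.left_inv hq
  have hmem : ∀ q ∈ Ψ.source, Φ q ∈ Ψ.target := fun q hq => by
    rw [hΨ hq]
    exact Ψ.map_source hq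
  have hπ : ContMDiffOn (𝓡 n) (𝓡 b) ∞ (fun m => (Ψ.symm m).1) Ψ.target :=
    contMDiff_fst.comp_contMDiffOn Ψ.symm.contMDiffOn
  have hσ : ContMDiffOn (𝓡 n) (𝓡 k) ∞ (fun m => (Ψ.symm m).2) Ψ.target :=
    contMDiff_snd.comp_contMDiffOn Ψ.symm.contMDiffOn
  refine ⟨Ψ.target, fun m => (Ψ.symm m).1, fun m => (Ψ.symm m).2, Ψ.open_target, hmem p hp, hπ, hσ,
    congrArg Prod.fst (hinv p hp), congrArg Prod.snd (hinv p hp), fun m hm => ?_⟩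
  have hq : Ψ.symm m ∈ Ψ.source := Ψ.map_target hm
  refine ⟨Ψ.symm m, (hΨ hq).trans (Ψ.right_inv hm), congrArg Prod.fst (hinv _ hq),
    congrArg Prod.snd (hinv _ hq), fun v => ?_, fun v => ?_⟩
  · generalize Ψ.symm m = q at hq v ⊢
    obtain ⟨w, rfl⟩ := (diffEquiv hl q).surjective v
    have h1 := mfderiv_comp_apply (I := (𝓡 b).prod (𝓡 k)) (I' := 𝓡 n) (I'' := 𝓡 b) q
      ((hπ.contMDiffAt (Ψ.open_target.mem_nhds (hmem q hq))).mdifferentiableAt (by simp))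
      (hl.contMDiff.mdifferentiable (by simp) q) w
    have he : (fun m => (Ψ.symm m).1) ∘ Φ =ᶠ[𝓝 q] Prod.fst := by
      filter_upwards [Ψ.open_source.mem_nhds hq] with z hz using congrArg Prod.fst (hinv z hz)
    have h2 : projB hl q (diffEquiv hl q w) = mfderiv ((𝓡 b).prod (𝓡 k)) (𝓡 b) Prod.fst q w :=
      congrArg (mfderiv ((𝓡 b).prod (𝓡 k)) (𝓡 b) Prod.fst q) ((diffEquiv hl q).symm_apply_apply w)
    rw [h2]
    refine h1.symm.trans ?_
    rw [he.mfderiv_eq]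
    rfl
  · generalize Ψ.symm m = q at hq v ⊢
    obtain ⟨w, rfl⟩ := (diffEquiv hl q).surjective v
    have h1 := mfderiv_comp_apply (I := (𝓡 b).prod (𝓡 k)) (I' := 𝓡 n) (I'' := 𝓡 k) q
      ((hσ.contMDiffAt (Ψ.open_target.mem_nhds (hmem q hq))).mdifferentiableAt (by simp))
      (hl.contMDiff.mdifferentiable (by simp) q) w
    have he : (fun m => (Ψ.symm m).2) ∘ Φ =ᶠ[𝓝 q] Prod.snd := by
      filter_upwards [Ψ.open_source.mem_nhds hq] with z hz using congrArg Prod.snd (hinv z hz)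
    have h2 : projF hl q (diffEquiv hl q w) = mfderiv ((𝓡 b).prod (𝓡 k)) (𝓡 k) Prod.snd q w :=
      congrArg (mfderiv ((𝓡 b).prod (𝓡 k)) (𝓡 k) Prod.snd q) ((diffEquiv hl q).symm_apply_apply w)
    rw [h2]
    refine h1.symm.trans ?_
    rw [he.mfderiv_eq]
    rfl

variable [IsManifold (𝓡 n) ∞ M] [T2Space M]

/-- Turns functions on the factors into global test functions on `M`; the formula can only be kept
near `p`. -/
theorem exists_lift (hl : IsLocalDiffeomorph ((𝓡 b).prod (𝓡 k)) (𝓡 n) ∞ Φ) (p : B × F)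
    {u : B → ℝ} {v : F → ℝ} (hu : SmoothFn b u) (hv : SmoothFn k v) :
    ∃ f : M → ℝ, SmoothFn n f ∧ ∀ᶠ q in 𝓝 p, f (Φ q) = u q.1 + v q.2 := by
  obtain ⟨Ψ, hp, hΨ⟩ := hl p
  have hs : ContMDiff ((𝓡 b).prod (𝓡 k)) 𝓘(ℝ, ℝ) ∞ (fun q : B × F => u q.1 + v q.2) :=
    (hu.comp contMDiff_fst).add (hv.comp contMDiff_snd)
  obtain ⟨f, hf, hfe⟩ := exists_smoothFn_eventuallyEq Ψ.open_target (Ψ.map_source hp)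
    (hs.comp_contMDiffOn Ψ.symm.contMDiffOn)
  refine ⟨f, hf, ?_⟩
  have hc : ContinuousAt Ψ p :=
    (Ψ.contMDiffOn.contMDiffAt (Ψ.open_source.mem_nhds hp)).continuousAt
  filter_upwards [hc.eventually hfe, Ψ.open_source.mem_nhds hp] with q hq hqs
  have h1 : Ψ.symm (Ψ q) = q := Ψ.left_inv hqs
  have h2 : f (Ψ q) = u (Ψ.symm (Ψ q)).1 + v (Ψ.symm (Ψ q)).2 := hq
  rw [hΨ hqs]
  rw [h1] at h2
  exact h2

/-- Near each point this is `L(df, df')` for lifts `f`, `f'` of `u`, `u'` that are constant along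
the fiber. -/
theorem contMDiff_pairB (L : SymTensor n M) {u u' : B → ℝ} (hu : SmoothFn b u)
    (hu' : SmoothFn b u') :
    ContMDiff ((𝓡 b).prod (𝓡 k)) 𝓘(ℝ, ℝ) ∞ (pairB (F := F) hl L.1 u u') := by
  intro p
  have h0 : SmoothFn k (fun _ : F => (0 : ℝ)) := contMDiff_const
  obtain ⟨f, hf, hfe⟩ := exists_lift hl p hu h0
  obtain ⟨f', hf', hfe'⟩ := exists_lift hl p hu' h0
  have hs := ((L.2.2 f f' hf hf').comp hl.contMDiff).contMDiffAt (x := p)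
  refine hs.congr_of_eventuallyEq ?_
  filter_upwards [hfe.eventually_nhds, hfe'.eventually_nhds] with q hq hq'
  simp only [Function.comp, ContraField.pair, mvfderiv_lift hl hf hu h0 hq,
    mvfderiv_lift hl hf' hu' h0 hq', mvfderiv_const, ContinuousLinearMap.zero_comp, add_zero]
  rfl

theorem contMDiff_pairF (L : SymTensor n M) {v v' : F → ℝ} (hv : SmoothFn k v)
    (hv' : SmoothFn k v') :
    ContMDiff ((𝓡 b).prod (𝓡 k)) 𝓘(ℝ, ℝ) ∞ (pairF (B := B) hl L.1 v v') := by
  intro p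
  have h0 : SmoothFn b (fun _ : B => (0 : ℝ)) := contMDiff_const
  obtain ⟨f, hf, hfe⟩ := exists_lift hl p h0 hv
  obtain ⟨f', hf', hfe'⟩ := exists_lift hl p h0 hv'
  have hs := ((L.2.2 f f' hf hf').comp hl.contMDiff).contMDiffAt (x := p)
  refine hs.congr_of_eventuallyEq ?_
  filter_upwards [hfe.eventually_nhds, hfe'.eventually_nhds] with q hq hq'
  simp only [Function.comp, ContraField.pair, mvfderiv_lift hl hf h0 hv hq,
    mvfderiv_lift hl hf' h0 hv' hq', mvfderiv_const, ContinuousLinearMap.zero_comp, zero_add]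
  rfl

/-- The base component of a tensor along the slice through `y`. -/
def toB (hl : IsLocalDiffeomorph ((𝓡 b).prod (𝓡 k)) (𝓡 n) ∞ Φ) (y : F) (L : SymTensor n M) :
    SymTensor b B :=
  ⟨fun x => compB hl L.1 (x, y), fun x => compB_symm hl L (x, y), fun _ _ hu hu' =>
    (contMDiff_pairB (hl := hl) L hu hu').comp (contMDiff_id.prodMk contMDiff_const)⟩

/-- The fiber component of a tensor along the slice through `x`. -/
def toF (hl : IsLocalDiffeomorph ((𝓡 b).prod (𝓡 k)) (𝓡 n) ∞ Φ) (x : B) (L : SymTensor n M) :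
    SymTensor k F :=
  ⟨fun y => compF hl L.1 (x, y), fun y => compF_symm hl L (x, y), fun _ _ hv hv' =>
    (contMDiff_pairF (hl := hl) L hv hv').comp (contMDiff_const.prodMk contMDiff_id)⟩

/-- Without mixed components, the four terms have degrees `u³`, `u v²`, `u² v` and `v³`; this
bigrading is what later separates the Killing equation. -/
theorem Splits.pair_pair_lift {L T : SymTensor n M} (hL : Splits hl L) (hT : Splits hl T)
    {p : B × F} {f : M → ℝ} {u : B → ℝ} {v : F → ℝ} (hf : SmoothFn n f) (hu : SmoothFn b u)
    (hv : SmoothFn k v) (hfe : ∀ᶠ q in 𝓝 p, f (Φ q) = u q.1 + v q.2) :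
    L.1.pair f (T.1.pair f f) (Φ p) =
      mvfderiv (𝓡 b) (fun x => pairB hl T.1 u u (x, p.2)) p.1
          (compB hl L.1 p (mvfderiv (𝓡 b) u p.1)) +
        mvfderiv (𝓡 b) (fun x => pairF hl T.1 v v (x, p.2)) p.1
          (compB hl L.1 p (mvfderiv (𝓡 b) u p.1)) +
        (mvfderiv (𝓡 k) (fun y => pairB hl T.1 u u (p.1, y)) p.2
            (compF hl L.1 p (mvfderiv (𝓡 k) v p.2)) +
          mvfderiv (𝓡 k) (fun y => pairF hl T.1 v v (p.1, y)) p.2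
            (compF hl L.1 p (mvfderiv (𝓡 k) v p.2))) := by
  have hT1 : ∀ᶠ q in 𝓝 p, T.1.pair f f (Φ q) = pairB hl T.1 u u q + pairF hl T.1 v v q := by
    filter_upwards [hfe.eventually_nhds] with q hq using hT.pair_lift hf hf hu hu hv hv hq hq
  have hd : MDifferentiableAt (𝓡 n) 𝓘(ℝ, ℝ) (T.1.pair f f) (Φ p) :=
    (T.2.2 f f hf hf).mdifferentiable (by simp) _
  have hcB : (mvfderiv (𝓡 n) f (Φ p)).comp (inclB Φ p) = mvfderiv (𝓡 b) u p.1 := by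
    ext w
    simp [mvfderiv_lift hl hf hu hv hfe]
  have hcF : (mvfderiv (𝓡 n) f (Φ p)).comp (inclF Φ p) = mvfderiv (𝓡 k) v p.2 := by
    ext w
    simp [mvfderiv_lift hl hf hu hv hfe]
  have h1 : (fun x => T.1.pair f f (Φ (x, p.2))) =ᶠ[𝓝 p.1]
      (fun x => pairB hl T.1 u u (x, p.2)) + fun x => pairF hl T.1 v v (x, p.2) :=
    eventually_sliceB hT1
  have h2 : (fun y => T.1.pair f f (Φ (p.1, y))) =ᶠ[𝓝 p.2]
      (fun y => pairB hl T.1 u u (p.1, y)) + fun y => pairF hl T.1 v v (p.1, y) :=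
    eventually_sliceF hT1
  have hB1 : ContMDiff (𝓡 b) 𝓘(ℝ, ℝ) ∞ (fun x => pairB hl T.1 u u (x, p.2)) :=
    (contMDiff_pairB (hl := hl) T hu hu).comp (contMDiff_id.prodMk contMDiff_const)
  have hB2 : ContMDiff (𝓡 b) 𝓘(ℝ, ℝ) ∞ (fun x => pairF hl T.1 v v (x, p.2)) :=
    (contMDiff_pairF (hl := hl) T hv hv).comp (contMDiff_id.prodMk contMDiff_const)
  have hF1 : ContMDiff (𝓡 k) 𝓘(ℝ, ℝ) ∞ (fun y => pairB hl T.1 u u (p.1, y)) :=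
    (contMDiff_pairB (hl := hl) T hu hu).comp (contMDiff_const.prodMk contMDiff_id)
  have hF2 : ContMDiff (𝓡 k) 𝓘(ℝ, ℝ) ∞ (fun y => pairF hl T.1 v v (p.1, y)) :=
    (contMDiff_pairF (hl := hl) T hv hv).comp (contMDiff_const.prodMk contMDiff_id)
  rw [ContraField.pair, L.2.1, hL.apply_eq, map_add, mvfderiv_inclB hl p hd,
    mvfderiv_inclF hl p hd, hcB, hcF, mvfderiv_congr h1, mvfderiv_congr h2,
    mvfderiv_add (hB1.mdifferentiable (by simp) _) (hB2.mdifferentiable (by simp) _),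
    mvfderiv_add (hF1.mdifferentiable (by simp) _) (hF2.mdifferentiable (by simp) _)]
  rfl

end Product

/-! ### Splitting of tensors on the warped product. -/

section Warped

variable {n b k : ℕ}
  {M : Type*} [TopologicalSpace M] [ChartedSpace (EuclideanSpace ℝ (Fin n)) M]
  {B : Type*} [TopologicalSpace B] [ChartedSpace (EuclideanSpace ℝ (Fin b)) B]
  {F : Type*} [TopologicalSpace F] [ChartedSpace (EuclideanSpace ℝ (Fin k)) F]
  [IsManifold (𝓡 n) ∞ M] [IsManifold (𝓡 b) ∞ B] [IsManifold (𝓡 k) ∞ F]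
  {g : PseudoRiemannianMetric n M} {D : ∀ x : M, Submodule ℝ (Tan n x)}
  {gB : PseudoRiemannianMetric b B} {gF : PseudoRiemannianMetric k F} {ρ : B → ℝ} {Φ : B × F → M}

namespace IsAdaptedWarpedProduct

theorem val_eq (hΦ : IsAdaptedWarpedProduct g D gB gF ρ Φ) (p : B × F) (v w : Tan n (Φ p)) :
    g.val (Φ p) v w = gB.val p.1 (projB hΦ.localDiffeo p v) (projB hΦ.localDiffeo p w) +
      ρ p.1 ^ 2 * gF.val p.2 (projF hΦ.localDiffeo p v) (projF hΦ.localDiffeo p w) := by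
  have h := hΦ.metric p ((diffEquiv hΦ.localDiffeo p).symm v) ((diffEquiv hΦ.localDiffeo p).symm w)
  rw [← diffEquiv_apply hΦ.localDiffeo, ← diffEquiv_apply hΦ.localDiffeo,
    ContinuousLinearEquiv.apply_symm_apply, ContinuousLinearEquiv.apply_symm_apply] at h
  exact h

theorem flat_eq (hΦ : IsAdaptedWarpedProduct g D gB gF ρ Φ) (p : B × F) (v : Tan n (Φ p)) :
    g.flat (Φ p) v =
      (gB.flat p.1 (projB hΦ.localDiffeo p v)).comp (projB hΦ.localDiffeo p) +
      ρ p.1 ^ 2 • (gF.flat p.2 (projF hΦ.localDiffeo p v)).comp (projF hΦ.localDiffeo p) := by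
  ext w
  exact hΦ.val_eq p v w

theorem rho_sq_ne_zero (hΦ : IsAdaptedWarpedProduct g D gB gF ρ Φ) (x : B) : ρ x ^ 2 ≠ 0 :=
  pow_ne_zero 2 (hΦ.warp_pos x).ne'

theorem projB_endo (hΦ : IsAdaptedWarpedProduct g D gB gF ρ Φ) {L : SymTensor n M}
    (hL : Splits hΦ.localDiffeo L) (p : B × F) (v : Tan n (Φ p)) :
    projB hΦ.localDiffeo p (endo g L.1 (Φ p) v) =
      compB hΦ.localDiffeo L.1 p (gB.flat p.1 (projB hΦ.localDiffeo p v)) := by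
  have h : endo g L.1 (Φ p) v = L.1 (Φ p) (g.flat (Φ p) v) := rfl
  rw [h, hΦ.flat_eq, map_add, map_smul, map_add, map_smul, hL p, smul_zero, add_zero]
  rfl

theorem projF_endo (hΦ : IsAdaptedWarpedProduct g D gB gF ρ Φ) {L : SymTensor n M}
    (hL : Splits hΦ.localDiffeo L) (p : B × F) (v : Tan n (Φ p)) :
    projF hΦ.localDiffeo p (endo g L.1 (Φ p) v) =
      ρ p.1 ^ 2 • compF hΦ.localDiffeo L.1 p (gF.flat p.2 (projF hΦ.localDiffeo p v)) := by
  have h : endo g L.1 (Φ p) v = L.1 (Φ p) (g.flat (Φ p) v) := rfl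
  rw [h, hΦ.flat_eq, map_add, map_smul, map_add, map_smul, hL.projF_eq_zero p, zero_add]
  rfl

theorem endo_inclB (hΦ : IsAdaptedWarpedProduct g D gB gF ρ Φ) {L : SymTensor n M}
    (hL : Splits hΦ.localDiffeo L) (p : B × F) (u : Tan b p.1) :
    endo g L.1 (Φ p) (inclB Φ p u) =
      inclB Φ p (compB hΦ.localDiffeo L.1 p (gB.flat p.1 u)) := by
  rw [← inclB_projB_add hΦ.localDiffeo p (endo g L.1 (Φ p) (inclB Φ p u)), hΦ.projB_endo hL,
    hΦ.projF_endo hL, projB_inclB, projF_inclB]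
  simp

theorem endo_inclF (hΦ : IsAdaptedWarpedProduct g D gB gF ρ Φ) {L : SymTensor n M}
    (hL : Splits hΦ.localDiffeo L) (p : B × F) (w : Tan k p.2) :
    endo g L.1 (Φ p) (inclF Φ p w) =
      ρ p.1 ^ 2 • inclF Φ p (compF hΦ.localDiffeo L.1 p (gF.flat p.2 w)) := by
  rw [← inclB_projB_add hΦ.localDiffeo p (endo g L.1 (Φ p) (inclF Φ p w)), hΦ.projB_endo hL,
    hΦ.projF_endo hL, projB_inclF, projF_inclF]
  simp

theorem splits_of_projB_endo_inclF (hΦ : IsAdaptedWarpedProduct g D gB gF ρ Φ) {L : SymTensor n M}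
    (h : ∀ (p : B × F) (w : Tan k p.2),
      projB hΦ.localDiffeo p (endo g L.1 (Φ p) (inclF Φ p w)) = 0) :
    Splits hΦ.localDiffeo L := by
  intro p β
  have h1 := h p ((gF.flat p.2).symm β)
  have h2 : endo g L.1 (Φ p) (inclF Φ p ((gF.flat p.2).symm β)) =
      L.1 (Φ p) (g.flat (Φ p) (inclF Φ p ((gF.flat p.2).symm β))) := rfl
  rw [h2, hΦ.flat_eq, projB_inclF, projF_inclF, LinearEquiv.apply_symm_apply, map_zero,
    ContinuousLinearMap.zero_comp, zero_add, map_smul, map_smul] at h1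
  exact (smul_eq_zero.1 h1).resolve_left (hΦ.rho_sq_ne_zero p.1)

theorem splits_of_invariant (hΦ : IsAdaptedWarpedProduct g D gB gF ρ Φ) {K : SymTensor n M}
    (hKD : IsInvariant g K D) : Splits hΦ.localDiffeo K := by
  refine hΦ.splits_of_projB_endo_inclF fun p w => ?_
  have h1 : inclF Φ p w ∈ D (Φ p) := by
    have := hΦ.tangent_fiber p.1 p.2
    exact this ▸ LinearMap.mem_range_self _ w
  have h2 := hKD (Φ p) _ h1
  have h3 : ∀ v ∈ D (Φ p), ∃ w : Tan k p.2, inclF Φ p w = v := by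
    have := hΦ.tangent_fiber p.1 p.2
    intro v hv
    exact LinearMap.mem_range.1 (this ▸ hv)
  obtain ⟨w', hw'⟩ := h3 _ h2
  rw [← hw', projB_inclF]

theorem endo_inclF_projF (hΦ : IsAdaptedWarpedProduct g D gB gF ρ Φ) {L : SymTensor n M}
    (hL : Splits hΦ.localDiffeo L) (p : B × F) (v : Tan n (Φ p)) :
    endo g L.1 (Φ p) (inclF Φ p (projF hΦ.localDiffeo p v)) =
      inclF Φ p (projF hΦ.localDiffeo p (endo g L.1 (Φ p) v)) := by
  rw [hΦ.endo_inclF hL, hΦ.projF_endo hL, map_smul]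

theorem endo_inclB_projB (hΦ : IsAdaptedWarpedProduct g D gB gF ρ Φ) {L : SymTensor n M}
    (hL : Splits hΦ.localDiffeo L) (p : B × F) (v : Tan n (Φ p)) :
    endo g L.1 (Φ p) (inclB Φ p (projB hΦ.localDiffeo p v)) =
      inclB Φ p (projB hΦ.localDiffeo p (endo g L.1 (Φ p) v)) := by
  rw [hΦ.endo_inclB hL, hΦ.projB_endo hL]

/-- As `K` splits, the fiber part of an eigenvector of `K` satisfies the same eigenvalue equation,
so `L` multiplies it by a scalar and keeps it tangent to the fiber. Such parts span the fiber
directions. -/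
theorem splits_of_isDiagonalFor (hΦ : IsAdaptedWarpedProduct g D gB gF ρ Φ) {K L : SymTensor n M}
    (hKs : ∀ x : M, HasSimpleEigenvalues g K.1 x) (hK : Splits hΦ.localDiffeo K)
    (hL : IsDiagonalFor g K.1 L.1) : Splits hΦ.localDiffeo L := by
  refine hΦ.splits_of_projB_endo_inclF fun p w => ?_
  obtain ⟨c, μ, -, hc⟩ := hKs (Φ p)
  have h : (projB hΦ.localDiffeo p).toLinearMap ∘ₗ endo g L.1 (Φ p) ∘ₗ (inclF Φ p).toLinearMap ∘ₗ
      (projF hΦ.localDiffeo p).toLinearMap = 0 := by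
    refine c.ext fun i => ?_
    obtain ⟨ν, hν⟩ := hL (Φ p) (inclF Φ p (projF hΦ.localDiffeo p (c i))) (μ i)
      (by rw [hΦ.endo_inclF_projF hK, hc, map_smul, map_smul])
    change projB hΦ.localDiffeo p
      (endo g L.1 (Φ p) (inclF Φ p (projF hΦ.localDiffeo p (c i)))) = 0
    rw [hν, map_smul, projB_inclF, smul_zero]
  have h1 := LinearMap.congr_fun h (inclF Φ p w)
  have h2 : projB hΦ.localDiffeo p
    (endo g L.1 (Φ p) (inclF Φ p (projF hΦ.localDiffeo p (inclF Φ p w)))) = 0 := h1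
  rwa [projF_inclF] at h2

/-- The base part of an eigenvector lies in the same eigenspace, which is a line, so it is a
multiple `c v`. If `c = 0` the base part vanishes; otherwise the fiber part of `v` does. -/
theorem projB_eq_zero_or_projF_eq_zero (hΦ : IsAdaptedWarpedProduct g D gB gF ρ Φ)
    {K : SymTensor n M} (hKs : ∀ x : M, HasSimpleEigenvalues g K.1 x)
    (hK : Splits hΦ.localDiffeo K) {p : B × F} {v : Tan n (Φ p)} {μ : ℝ}
    (hv : endo g K.1 (Φ p) v = μ • v) :
    projB hΦ.localDiffeo p v = 0 ∨ projF hΦ.localDiffeo p v = 0 := by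
  by_cases hv0 : v = 0
  · left; rw [hv0, map_zero]
  obtain ⟨b, r, hr, hb⟩ := hKs (Φ p)
  obtain ⟨c, hc⟩ := exists_eq_smul_of_eigenvector hb hr hv
    (w := inclB Φ p (projB hΦ.localDiffeo p v))
    (by rw [hΦ.endo_inclB_projB hK, hv, map_smul, map_smul]) hv0
  have h1 := congrArg (projF hΦ.localDiffeo p) hc
  have h2 := congrArg (projB hΦ.localDiffeo p) hc
  rw [projF_inclB, map_smul] at h1
  rw [projB_inclB, map_smul] at h2
  rcases smul_eq_zero.1 h1.symm with h | h
  · left; rw [h2, h, zero_smul]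
  · exact Or.inr h

theorem splits_contra (hΦ : IsAdaptedWarpedProduct g D gB gF ρ Φ) :
    Splits hΦ.localDiffeo g.contraTensor := by
  refine hΦ.splits_of_projB_endo_inclF fun p w => ?_
  have : endo g g.contraTensor.1 (Φ p) = LinearMap.id := endo_contra (Φ p)
  rw [this, LinearMap.id_apply, projB_inclF]

theorem compB_contra (hΦ : IsAdaptedWarpedProduct g D gB gF ρ Φ) (p : B × F) :
    compB hΦ.localDiffeo g.contraTensor.1 p = gB.contra p.1 := by
  refine LinearMap.ext fun α => ?_
  obtain ⟨u, rfl⟩ := (gB.flat p.1).surjective α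
  have h := hΦ.projB_endo hΦ.splits_contra p (inclB Φ p u)
  have h1 : endo g g.contraTensor.1 (Φ p) = LinearMap.id := endo_contra (Φ p)
  rw [h1, LinearMap.id_apply, projB_inclB] at h
  rw [← h]
  exact ((gB.flat p.1).symm_apply_apply u).symm

theorem compF_contra (hΦ : IsAdaptedWarpedProduct g D gB gF ρ Φ) (p : B × F) :
    compF hΦ.localDiffeo g.contraTensor.1 p = (ρ p.1 ^ 2)⁻¹ • gF.contra p.2 := by
  refine LinearMap.ext fun α => ?_
  obtain ⟨w, rfl⟩ := (gF.flat p.2).surjective α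
  have h := hΦ.projF_endo hΦ.splits_contra p (inclF Φ p w)
  have h1 : endo g g.contraTensor.1 (Φ p) = LinearMap.id := endo_contra (Φ p)
  rw [h1, LinearMap.id_apply, projF_inclF] at h
  have h2 : gF.contra p.2 (gF.flat p.2 w) = w := (gF.flat p.2).symm_apply_apply w
  rw [LinearMap.smul_apply, h2]
  conv_rhs => rw [h]
  rw [smul_smul, inv_mul_cancel₀ (hΦ.rho_sq_ne_zero p.1), one_smul]

theorem smooth_inv_sq (hΦ : IsAdaptedWarpedProduct g D gB gF ρ Φ) :
    SmoothFn b (fun x => (ρ x ^ 2)⁻¹) := fun x =>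
  ((hΦ.warp_smooth x).pow 2).inv₀ (hΦ.rho_sq_ne_zero x)

end IsAdaptedWarpedProduct

end Warped

/-! ### Separation of the Killing equation. -/

section Decomposition

variable {n b k : ℕ}
  {M : Type*} [TopologicalSpace M] [ChartedSpace (EuclideanSpace ℝ (Fin n)) M]
  {B : Type*} [TopologicalSpace B] [ChartedSpace (EuclideanSpace ℝ (Fin b)) B]
  {F : Type*} [TopologicalSpace F] [ChartedSpace (EuclideanSpace ℝ (Fin k)) F]
  [IsManifold (𝓡 n) ∞ M] [IsManifold (𝓡 b) ∞ B] [IsManifold (𝓡 k) ∞ F] [T2Space M]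
  {g : PseudoRiemannianMetric n M} {D : ∀ x : M, Submodule ℝ (Tan n x)}
  {gB : PseudoRiemannianMetric b B} {gF : PseudoRiemannianMetric k F} {ρ : B → ℝ} {Φ : B × F → M}
  {L : SymTensor n M} {u : B → ℝ} {v : F → ℝ}

namespace IsAdaptedWarpedProduct

theorem killing_identity (hΦ : IsAdaptedWarpedProduct g D gB gF ρ Φ)
    (hL : Splits hΦ.localDiffeo L) (hk : IsKilling g L) (hu : SmoothFn b u) (hv : SmoothFn k v)
    (p : B × F) :
    mvfderiv (𝓡 b) (gB.contra.pair u u) p.1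
        (compB hΦ.localDiffeo L.1 p (mvfderiv (𝓡 b) u p.1)) +
      gF.contra.pair v v p.2 * mvfderiv (𝓡 b) (fun x => (ρ x ^ 2)⁻¹) p.1
        (compB hΦ.localDiffeo L.1 p (mvfderiv (𝓡 b) u p.1)) +
      (ρ p.1 ^ 2)⁻¹ * mvfderiv (𝓡 k) (gF.contra.pair v v) p.2
        (compF hΦ.localDiffeo L.1 p (mvfderiv (𝓡 k) v p.2)) =
    mvfderiv (𝓡 b) (fun x => pairB hΦ.localDiffeo L.1 u u (x, p.2)) p.1
        (gB.contra p.1 (mvfderiv (𝓡 b) u p.1)) +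
      mvfderiv (𝓡 b) (fun x => pairF hΦ.localDiffeo L.1 v v (x, p.2)) p.1
        (gB.contra p.1 (mvfderiv (𝓡 b) u p.1)) +
      (ρ p.1 ^ 2)⁻¹ * mvfderiv (𝓡 k) (fun y => pairB hΦ.localDiffeo L.1 u u (p.1, y)) p.2
        (gF.contra p.2 (mvfderiv (𝓡 k) v p.2)) +
      (ρ p.1 ^ 2)⁻¹ * mvfderiv (𝓡 k) (fun y => pairF hΦ.localDiffeo L.1 v v (p.1, y)) p.2
        (gF.contra p.2 (mvfderiv (𝓡 k) v p.2)) := by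
  obtain ⟨f, hf, hfe⟩ := exists_lift hΦ.localDiffeo p hu hv
  have h := hk f hf (Φ p)
  have hG : g.contra = g.contraTensor.1 := rfl
  have hpB : ∀ q : B × F, pairB hΦ.localDiffeo g.contraTensor.1 u u q =
      gB.contra.pair u u q.1 := fun q => by
    rw [pairB, hΦ.compB_contra]; rfl
  have hpF : ∀ q : B × F, pairF hΦ.localDiffeo g.contraTensor.1 v v q =
      (ρ q.1 ^ 2)⁻¹ * gF.contra.pair v v q.2 := fun q => by
    rw [pairF, hΦ.compF_contra, LinearMap.smul_apply, map_smul]; rfl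
  have h1 : mvfderiv (𝓡 b) (fun x => (ρ x ^ 2)⁻¹ * gF.contra.pair v v p.2) p.1 =
      gF.contra.pair v v p.2 • mvfderiv (𝓡 b) (fun x => (ρ x ^ 2)⁻¹) p.1 := by
    simp only [mul_comm _ (gF.contra.pair v v p.2)]
    exact mvfderiv_const_mul _ (hΦ.smooth_inv_sq.mdifferentiable (by simp) _)
  have h2 : mvfderiv (𝓡 k) (fun y => (ρ p.1 ^ 2)⁻¹ * gF.contra.pair v v y) p.2 =
      (ρ p.1 ^ 2)⁻¹ • mvfderiv (𝓡 k) (gF.contra.pair v v) p.2 :=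
    mvfderiv_const_mul _ ((gF.contMDiff_pair_contra hv hv).mdifferentiable (by simp) _)
  rw [hG, schouten, hL.pair_pair_lift hΦ.splits_contra hf hu hv hfe,
    hΦ.splits_contra.pair_pair_lift hL hf hu hv hfe] at h
  simp only [hpB, hpF, hΦ.compB_contra, hΦ.compF_contra, h1, h2, mvfderiv_const,
    LinearMap.smul_apply, smul_apply, map_smul, smul_eq_mul, zero_apply] at h
  linarith

/-- These are the parts of `killing_identity` of degrees `u³`, `u v²`, `u² v` and `v³`. -/
theorem killing_equations (hΦ : IsAdaptedWarpedProduct g D gB gF ρ Φ)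
    (hL : Splits hΦ.localDiffeo L) (hk : IsKilling g L) (hu : SmoothFn b u) (hv : SmoothFn k v)
    (p : B × F) :
    (mvfderiv (𝓡 b) (gB.contra.pair u u) p.1
        (compB hΦ.localDiffeo L.1 p (mvfderiv (𝓡 b) u p.1)) =
      mvfderiv (𝓡 b) (fun x => pairB hΦ.localDiffeo L.1 u u (x, p.2)) p.1
        (gB.contra p.1 (mvfderiv (𝓡 b) u p.1))) ∧
    (gF.contra.pair v v p.2 * mvfderiv (𝓡 b) (fun x => (ρ x ^ 2)⁻¹) p.1
        (compB hΦ.localDiffeo L.1 p (mvfderiv (𝓡 b) u p.1)) =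
      mvfderiv (𝓡 b) (fun x => pairF hΦ.localDiffeo L.1 v v (x, p.2)) p.1
        (gB.contra p.1 (mvfderiv (𝓡 b) u p.1))) ∧
    (mvfderiv (𝓡 k) (fun y => pairB hΦ.localDiffeo L.1 u u (p.1, y)) p.2
        (gF.contra p.2 (mvfderiv (𝓡 k) v p.2)) = 0) ∧
    (mvfderiv (𝓡 k) (gF.contra.pair v v) p.2
        (compF hΦ.localDiffeo L.1 p (mvfderiv (𝓡 k) v p.2)) =
      mvfderiv (𝓡 k) (fun y => pairF hΦ.localDiffeo L.1 v v (p.1, y)) p.2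
        (gF.contra p.2 (mvfderiv (𝓡 k) v p.2))) := by
  have hρ := hΦ.rho_sq_ne_zero p.1
  -- Putting `u` or `v` equal to zero isolates the pure terms. Replacing `u` by `-u` changes the
  -- sign of the `u v²` terms but not of the `u² v` terms, which separates the mixed ones.
  have huv := hΦ.killing_identity hL hk hu hv p
  have hnv := hΦ.killing_identity hL hk (u := -u) (ContMDiff.neg hu) hv p
  have h0v := hΦ.killing_identity hL hk (u := fun _ => 0) contMDiff_const hv p
  have hu0 := hΦ.killing_identity hL hk (v := fun _ => 0) hu contMDiff_const p
  simp only [pairB_neg, ContraField.pair_neg, mvfderiv_neg, map_neg, mul_neg] at hnv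
  simp only [mvfderiv_const, map_zero, mul_zero, zero_add, add_zero, pairB, zero_apply] at h0v
  simp only [ContraField.pair, mvfderiv_const, map_zero, zero_mul, mul_zero, add_zero,
    pairF, zero_apply] at hu0
  have h3 := mul_left_cancel₀ (inv_ne_zero hρ) h0v
  refine ⟨hu0, ?_, ?_, h3⟩
  · simp only [ContraField.pair, pairB, pairF] at *
    linarith
  · refine mul_left_cancel₀ (inv_ne_zero hρ) ?_
    rw [mul_zero]
    simp only [ContraField.pair, pairB, pairF] at *
    linarith

theorem isKilling_toB (hΦ : IsAdaptedWarpedProduct g D gB gF ρ Φ)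
    (hL : Splits hΦ.localDiffeo L) (hk : IsKilling g L) (y : F) :
    IsKilling gB (toB hΦ.localDiffeo y L) := by
  intro u hu x
  have hv : SmoothFn k (fun _ : F => (0 : ℝ)) := contMDiff_const
  have h := (hΦ.killing_equations hL hk hu hv (x, y)).1
  have h1 : (toB hΦ.localDiffeo y L).1.pair u (gB.contra.pair u u) x =
      mvfderiv (𝓡 b) (gB.contra.pair u u) x
        (compB hΦ.localDiffeo L.1 (x, y) (mvfderiv (𝓡 b) u x)) :=
    (toB hΦ.localDiffeo y L).2.1 x _ _
  have h2 : gB.contra.pair u ((toB hΦ.localDiffeo y L).1.pair u u) x =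
      mvfderiv (𝓡 b) (fun x => pairB hΦ.localDiffeo L.1 u u (x, y)) x
        (gB.contra x (mvfderiv (𝓡 b) u x)) := gB.contra_symm x _ _
  rw [schouten, h1, h2, h, sub_self, mul_zero]

theorem isKilling_toF (hΦ : IsAdaptedWarpedProduct g D gB gF ρ Φ)
    (hL : Splits hΦ.localDiffeo L) (hk : IsKilling g L) (x : B) :
    IsKilling gF (toF hΦ.localDiffeo x L) := by
  intro v hv y
  have hu : SmoothFn b (fun _ : B => (0 : ℝ)) := contMDiff_const
  have h := (hΦ.killing_equations hL hk hu hv (x, y)).2.2.2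
  have h1 : (toF hΦ.localDiffeo x L).1.pair v (gF.contra.pair v v) y =
      mvfderiv (𝓡 k) (gF.contra.pair v v) y
        (compF hΦ.localDiffeo L.1 (x, y) (mvfderiv (𝓡 k) v y)) :=
    (toF hΦ.localDiffeo x L).2.1 y _ _
  have h2 : gF.contra.pair v ((toF hΦ.localDiffeo x L).1.pair v v) y =
      mvfderiv (𝓡 k) (fun y => pairF hΦ.localDiffeo L.1 v v (x, y)) y
        (gF.contra y (mvfderiv (𝓡 k) v y)) := gF.contra_symm y _ _
  rw [schouten, h1, h2, h, sub_self, mul_zero]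

/-- The `u v²` equation gives the derivative in the direction of the gradient of `u`; every tangent
vector of `B` is such a gradient. -/
theorem mvfderiv_pairF [T2Space B] (hΦ : IsAdaptedWarpedProduct g D gB gF ρ Φ)
    (hL : Splits hΦ.localDiffeo L) (hk : IsKilling g L) (hv : SmoothFn k v) (x : B) (y : F) :
    mvfderiv (𝓡 b) (fun x => pairF hΦ.localDiffeo L.1 v v (x, y)) x =
      gF.contra.pair v v y • gB.flat x (compB hΦ.localDiffeo L.1 (x, y)
        (mvfderiv (𝓡 b) (fun x => (ρ x ^ 2)⁻¹) x)) := by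
  ext w
  obtain ⟨u, hu, huw⟩ := exists_smoothFn_mvfderiv_eq x (gB.flat x w)
  have h := (hΦ.killing_equations hL hk hu hv (x, y)).2.1
  have h2 : gB.contra x (mvfderiv (𝓡 b) u x) = w := by
    rw [huw]
    exact (gB.flat x).symm_apply_apply w
  have h3 : mvfderiv (𝓡 b) (fun x => (ρ x ^ 2)⁻¹) x
      (compB hΦ.localDiffeo L.1 (x, y) (mvfderiv (𝓡 b) u x)) =
      gB.flat x (compB hΦ.localDiffeo L.1 (x, y)
        (mvfderiv (𝓡 b) (fun x => (ρ x ^ 2)⁻¹) x)) w := by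
    rw [compB_symm hΦ.localDiffeo L (x, y), huw]
    exact gB.symm x _ _
  rw [h2] at h
  rw [smul_apply, smul_eq_mul, ← h3]
  exact h.symm

variable [T2Space B] [T2Space F] [ConnectedSpace F]

/-- The `u² v` equation says that the base component has zero derivative along every gradient on the
connected fiber. -/
theorem compB_eq_compB (hΦ : IsAdaptedWarpedProduct g D gB gF ρ Φ)
    (hL : Splits hΦ.localDiffeo L) (hk : IsKilling g L) (x : B) (y y' : F) :
    compB hΦ.localDiffeo L.1 (x, y) = compB hΦ.localDiffeo L.1 (x, y') := by
  have hpair : ∀ u : B → ℝ, SmoothFn b u →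
      pairB hΦ.localDiffeo L.1 u u (x, y) = pairB hΦ.localDiffeo L.1 u u (x, y') := by
    intro u hu
    refine eq_of_mvfderiv_eq_zero (f := fun y => pairB hΦ.localDiffeo L.1 u u (x, y))
      ((contMDiff_pairB (hl := hΦ.localDiffeo) L hu hu).comp
        (contMDiff_const.prodMk contMDiff_id)) (fun z => ?_) y y'
    ext w
    obtain ⟨v, hv, hvw⟩ := exists_smoothFn_mvfderiv_eq z (gF.flat z w)
    have h := (hΦ.killing_equations hL hk hu hv (x, z)).2.2.1
    have h2 : gF.contra z (mvfderiv (𝓡 k) v z) = w := by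
      rw [hvw]
      exact (gF.flat z).symm_apply_apply w
    rw [h2] at h
    exact h
  let T : ContraField b B := fun x =>
    compB hΦ.localDiffeo L.1 (x, y) - compB hΦ.localDiffeo L.1 (x, y')
  have hT : T x = 0 := by
    refine ContraField.eq_zero_of_pair_self (fun α β => ?_) fun u hu => ?_
    · simp only [T, LinearMap.sub_apply, map_sub]
      rw [compB_symm hΦ.localDiffeo L (x, y), compB_symm hΦ.localDiffeo L (x, y')]
    · have := hpair u hu
      simp only [pairB] at this
      simp only [ContraField.pair, T, LinearMap.sub_apply, map_sub, this, sub_self]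
  exact sub_eq_zero.1 hT

/-- For every `v`, the differential along the base of the fiber component on `(dv, dv)` is `G_F(dv,
dv)` times one common 1-form, `L_B dρ⁻²`. A single `v₀` with `G_F(dv₀, dv₀) ≠ 0` provides a
primitive `l`, which then works for all `v` because `B` is connected. -/
theorem exists_decomposition [ConnectedSpace B] (hΦ : IsAdaptedWarpedProduct g D gB gF ρ Φ)
    (hL : Splits hΦ.localDiffeo L) (hk : IsKilling g L) (x₀ : B) (y₀ : F) :
    ∃ l : B → ℝ, SmoothFn b l ∧ l x₀ = 0 ∧
      (∀ x y, compF hΦ.localDiffeo L.1 (x, y) =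
        l x • gF.contra y + compF hΦ.localDiffeo L.1 (x₀, y)) ∧
      ∀ x, mvfderiv (𝓡 b) l x = gB.flat x ((toB hΦ.localDiffeo y₀ L).1 x
        (mvfderiv (𝓡 b) (fun x' => (ρ x' ^ 2)⁻¹) x)) := by
  -- The fiber has positive dimension, so `G_F` is not zero at `y₀`.
  obtain ⟨v₀, hv₀, hne⟩ : ∃ v₀ : F → ℝ, SmoothFn k v₀ ∧ gF.contra.pair v₀ v₀ y₀ ≠ 0 := by
    by_contra! h
    have h0 : gF.contra y₀ = 0 := ContraField.eq_zero_of_pair_self (gF.contra_symm y₀) h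
    have : Nontrivial (Tan k y₀) := Module.nontrivial_of_finrank_pos (R := ℝ)
      (by rw [finrank_tan]; exact hΦ.dim_pos)
    obtain ⟨w, hw⟩ := exists_ne (0 : Tan k y₀)
    apply hw
    have h1 : gF.contra y₀ (gF.flat y₀ w) = w := (gF.flat y₀).symm_apply_apply w
    rw [← h1, h0, LinearMap.zero_apply]
  have hsm : ∀ (v : F → ℝ), SmoothFn k v → ∀ y,
      SmoothFn b (fun x => pairF hΦ.localDiffeo L.1 v v (x, y)) := fun v hv y =>
    (contMDiff_pairF (hl := hΦ.localDiffeo) L hv hv).comp (contMDiff_id.prodMk contMDiff_const)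
  let γ := gF.contra.pair v₀ v₀ y₀
  let l : B → ℝ := fun x => γ⁻¹ * (pairF hΦ.localDiffeo L.1 v₀ v₀ (x, y₀) +
    -pairF hΦ.localDiffeo L.1 v₀ v₀ (x₀, y₀))
  have hl : SmoothFn b l := contMDiff_const.mul ((hsm v₀ hv₀ y₀).add contMDiff_const)
  have hd : ∀ x y, mvfderiv (𝓡 b) l x = gB.flat x (compB hΦ.localDiffeo L.1 (x, y)
      (mvfderiv (𝓡 b) (fun x' => (ρ x' ^ 2)⁻¹) x)) := by
    intro x y
    have h1 := (hsm v₀ hv₀ y₀).mdifferentiable (by simp) x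
    refine (mvfderiv_const_mul γ⁻¹ (f := fun x => pairF hΦ.localDiffeo L.1 v₀ v₀ (x, y₀) +
      -pairF hΦ.localDiffeo L.1 v₀ v₀ (x₀, y₀)) (h1.add mdifferentiableAt_const)).trans ?_
    rw [mvfderiv_add_const' h1, hΦ.mvfderiv_pairF hL hk hv₀, smul_smul, inv_mul_cancel₀ hne,
      one_smul, hΦ.compB_eq_compB hL hk x y₀ y]
  have hpair : ∀ (v : F → ℝ), SmoothFn k v → ∀ x y, pairF hΦ.localDiffeo L.1 v v (x, y) =
      l x * gF.contra.pair v v y + pairF hΦ.localDiffeo L.1 v v (x₀, y) := by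
    intro v hv x y
    have h1 := hsm v hv y
    have h2 : SmoothFn b (fun x => (-gF.contra.pair v v y) * l x) := contMDiff_const.mul hl
    have h := eq_of_mvfderiv_eq_zero (f := (fun x => pairF hΦ.localDiffeo L.1 v v (x, y)) +
      fun x => (-gF.contra.pair v v y) * l x) (ContMDiff.add h1 h2) (fun z => ?_) x x₀
    · have hl0 : l x₀ = 0 := by simp [l]
      simp only [Pi.add_apply, hl0, mul_zero, add_zero] at h
      linarith
    · rw [mvfderiv_add (h1.mdifferentiable (by simp) z) (h2.mdifferentiable (by simp) z),
        mvfderiv_const_mul _ (hl.mdifferentiable (by simp) z), hΦ.mvfderiv_pairF hL hk hv, hd z y,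
        neg_smul, add_neg_cancel]
  refine ⟨l, hl, by simp [l], fun x y => ?_, fun x => hd x y₀⟩
  let T : ContraField k F := fun y => compF hΦ.localDiffeo L.1 (x, y) -
    (l x • gF.contra y + compF hΦ.localDiffeo L.1 (x₀, y))
  have hT : T y = 0 := by
    refine ContraField.eq_zero_of_pair_self (fun α β => ?_) fun v hv => ?_
    · simp only [T, LinearMap.sub_apply, LinearMap.add_apply, LinearMap.smul_apply, map_sub,
        map_add, map_smul]
      rw [compF_symm hΦ.localDiffeo L (x, y), compF_symm hΦ.localDiffeo L (x₀, y),
        gF.contra_symm]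
    · have := hpair v hv x y
      simp only [pairF, ContraField.pair] at this
      simp only [ContraField.pair, T, LinearMap.sub_apply, LinearMap.add_apply,
        LinearMap.smul_apply, map_sub, map_add, map_smul, smul_eq_mul, this, sub_self]
  exact sub_eq_zero.1 hT

end IsAdaptedWarpedProduct

end Decomposition

/-! ### The KS-spaces of the factors and reassembly. -/

section KSSpaces

variable {n b k : ℕ}
  {M : Type*} [TopologicalSpace M] [ChartedSpace (EuclideanSpace ℝ (Fin n)) M]
  {B : Type*} [TopologicalSpace B] [ChartedSpace (EuclideanSpace ℝ (Fin b)) B]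
  {F : Type*} [TopologicalSpace F] [ChartedSpace (EuclideanSpace ℝ (Fin k)) F]
  [IsManifold (𝓡 k) ∞ F] {gF : PseudoRiemannianMetric k F} {Φ : B × F → M}

/-- The tensor `A + c G_F + C` on the warped product. -/
def assemble (gF : PseudoRiemannianMetric k F) (Φ : B × F → M) (x : B) (y : F)
    (A : Cotan b x →ₗ[ℝ] Tan b x) (c : ℝ) (C : Cotan k y →ₗ[ℝ] Tan k y) :
    Cotan n (Φ (x, y)) →ₗ[ℝ] Tan n (Φ (x, y)) :=
  push (fun x' => Φ (x', y)) x A + c • push (fun y' => Φ (x, y')) y (gF.contra y) +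
    push (fun y' => Φ (x, y')) y C

theorem assemble_apply (x : B) (y : F) (A : Cotan b x →ₗ[ℝ] Tan b x) (c : ℝ)
    (C : Cotan k y →ₗ[ℝ] Tan k y) (α : Cotan n (Φ (x, y))) :
    assemble gF Φ x y A c C α = inclB Φ (x, y) (A (α.comp (inclB Φ (x, y)))) +
      inclF Φ (x, y) ((c • gF.contra y + C) (α.comp (inclF Φ (x, y)))) := by
  rw [LinearMap.add_apply, LinearMap.smul_apply, map_add, map_smul, ← add_assoc]
  rfl

variable [IsManifold (𝓡 n) ∞ M] [IsManifold (𝓡 b) ∞ B]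
  {g : PseudoRiemannianMetric n M} {D : ∀ x : M, Submodule ℝ (Tan n x)}
  {gB : PseudoRiemannianMetric b B} {ρ : B → ℝ}

theorem Intertwines.congr {m : ℕ} {N : Type*} [TopologicalSpace N]
    [ChartedSpace (EuclideanSpace ℝ (Fin m)) N] [IsManifold (𝓡 m) ∞ N] {K : ContraField n M}
    {gN : PseudoRiemannianMetric m N} {KN : ContraField m N} {x : M} {z z' : N}
    {A : Tan n x →L[ℝ] Tan m z} {A' : Tan n x →L[ℝ] Tan m z'} (h : Intertwines g K gN KN A)
    (hz : z' = z) (hA : ∀ v, (A' v : EuclideanSpace ℝ (Fin m)) = A v) :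
    Intertwines g K gN KN A' := by
  subst hz
  have : A' = A := ContinuousLinearMap.ext hA
  rwa [this]

namespace IsAdaptedWarpedProduct

theorem flat_comp_inclB (hΦ : IsAdaptedWarpedProduct g D gB gF ρ Φ) (p : B × F) (v : Tan n (Φ p)) :
    (g.flat (Φ p) v).comp (inclB Φ p) = gB.flat p.1 (projB hΦ.localDiffeo p v) := by
  ext u
  rw [hΦ.flat_eq]
  simp

theorem flat_comp_inclF (hΦ : IsAdaptedWarpedProduct g D gB gF ρ Φ) (p : B × F) (v : Tan n (Φ p)) :
    (g.flat (Φ p) v).comp (inclF Φ p) =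
      ρ p.1 ^ 2 • gF.flat p.2 (projF hΦ.localDiffeo p v) := by
  ext u
  rw [hΦ.flat_eq]
  simp

theorem assemble_flat (hΦ : IsAdaptedWarpedProduct g D gB gF ρ Φ) {x : B} {y : F}
    (A : Cotan b x →ₗ[ℝ] Tan b x) (c : ℝ) (C : Cotan k y →ₗ[ℝ] Tan k y) (v : Tan n (Φ (x, y))) :
    assemble gF Φ x y A c C (g.flat (Φ (x, y)) v) =
      inclB Φ (x, y) (A (gB.flat x (projB hΦ.localDiffeo (x, y) v))) +
      ρ x ^ 2 • inclF Φ (x, y) (c • projF hΦ.localDiffeo (x, y) v +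
        C (gF.flat y (projF hΦ.localDiffeo (x, y) v))) := by
  have h3 : gF.contra y (gF.flat y (projF hΦ.localDiffeo (x, y) v)) =
    projF hΦ.localDiffeo (x, y) v := (gF.flat y).symm_apply_apply _
  rw [assemble_apply, hΦ.flat_comp_inclB, hΦ.flat_comp_inclF, map_smul, map_smul,
    LinearMap.add_apply, LinearMap.smul_apply, h3]

variable {K L : SymTensor n M}

theorem eq_assemble (hΦ : IsAdaptedWarpedProduct g D gB gF ρ Φ) (hL : Splits hΦ.localDiffeo L)
    {x : B} {y : F} {A : Cotan b x →ₗ[ℝ] Tan b x} {c : ℝ} {C : Cotan k y →ₗ[ℝ] Tan k y}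
    (hA : compB hΦ.localDiffeo L.1 (x, y) = A)
    (hC : compF hΦ.localDiffeo L.1 (x, y) = c • gF.contra y + C) :
    L.1 (Φ (x, y)) = assemble gF Φ x y A c C := by
  refine LinearMap.ext fun α => ?_
  rw [hL.apply_eq, assemble_apply, ← hC, ← hA]

variable [T2Space M]

theorem endo_inclB_of_endo_toB (hΦ : IsAdaptedWarpedProduct g D gB gF ρ Φ)
    (hL : Splits hΦ.localDiffeo L) {x : B} {y₀ : F} {u : Tan b x} {μ : ℝ}
    (hu : endo gB (toB hΦ.localDiffeo y₀ L).1 x u = μ • u) :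
    endo g L.1 (Φ (x, y₀)) (inclB Φ (x, y₀) u) = μ • inclB Φ (x, y₀) u := by
  have h : compB hΦ.localDiffeo L.1 (x, y₀) (gB.flat x u) = μ • u := hu
  rw [hΦ.endo_inclB hL, ← map_smul]
  exact congrArg (inclB Φ (x, y₀)) h

theorem endo_toB_of_endo_inclB (hΦ : IsAdaptedWarpedProduct g D gB gF ρ Φ)
    (hL : Splits hΦ.localDiffeo L) {x : B} {y₀ : F} {u : Tan b x} {ν : ℝ}
    (hu : endo g L.1 (Φ (x, y₀)) (inclB Φ (x, y₀) u) = ν • inclB Φ (x, y₀) u) :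
    endo gB (toB hΦ.localDiffeo y₀ L).1 x u = ν • u := by
  have h := congrArg (projB hΦ.localDiffeo (x, y₀)) hu
  rw [hΦ.projB_endo hL, map_smul, projB_inclB] at h
  exact h

/-- On the fiber `g` is `ρ² g_F`, so lowering an index with `g` instead of `g_F` multiplies the
eigenvalue by `ρ²`. -/
theorem endo_inclF_of_endo_toF (hΦ : IsAdaptedWarpedProduct g D gB gF ρ Φ)
    (hL : Splits hΦ.localDiffeo L) {x₀ : B} {y : F} {w : Tan k y} {μ : ℝ}
    (hw : endo gF (toF hΦ.localDiffeo x₀ L).1 y w = μ • w) :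
    endo g L.1 (Φ (x₀, y)) (inclF Φ (x₀, y) w) = (ρ x₀ ^ 2 * μ) • inclF Φ (x₀, y) w := by
  have h : compF hΦ.localDiffeo L.1 (x₀, y) (gF.flat y w) = μ • w := hw
  rw [hΦ.endo_inclF hL, mul_smul, ← map_smul _ μ]
  exact congrArg (fun z => ρ x₀ ^ 2 • inclF Φ (x₀, y) z) h

theorem endo_toF_of_endo_inclF (hΦ : IsAdaptedWarpedProduct g D gB gF ρ Φ)
    (hL : Splits hΦ.localDiffeo L) {x₀ : B} {y : F} {w : Tan k y} {ν : ℝ}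
    (hw : endo g L.1 (Φ (x₀, y)) (inclF Φ (x₀, y) w) = (ρ x₀ ^ 2 * ν) • inclF Φ (x₀, y) w) :
    endo gF (toF hΦ.localDiffeo x₀ L).1 y w = ν • w := by
  have h := congrArg (projF hΦ.localDiffeo (x₀, y)) hw
  rw [hΦ.projF_endo hL, map_smul, projF_inclF, mul_smul] at h
  exact smul_right_injective _ (hΦ.rho_sq_ne_zero x₀) h

theorem toB_mem_killingSpace (hΦ : IsAdaptedWarpedProduct g D gB gF ρ Φ)
    (hKs : Splits hΦ.localDiffeo K) (hL : Splits hΦ.localDiffeo L) (hk : IsKilling g L)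
    (hd : IsDiagonalFor g K.1 L.1) (y₀ : F) :
    toB hΦ.localDiffeo y₀ L ∈ killingSpace gB (toB hΦ.localDiffeo y₀ K) := by
  refine ⟨hΦ.isKilling_toB hL hk y₀, fun x u μ hu => ?_⟩
  obtain ⟨ν, hν⟩ := hd _ _ _ (hΦ.endo_inclB_of_endo_toB hKs hu)
  exact ⟨ν, hΦ.endo_toB_of_endo_inclB hL hν⟩

theorem toF_mem_killingSpace (hΦ : IsAdaptedWarpedProduct g D gB gF ρ Φ)
    (hKs : Splits hΦ.localDiffeo K) (hL : Splits hΦ.localDiffeo L) (hk : IsKilling g L)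
    (hd : IsDiagonalFor g K.1 L.1) (x₀ : B) :
    toF hΦ.localDiffeo x₀ L ∈ killingSpace gF (toF hΦ.localDiffeo x₀ K) := by
  refine ⟨hΦ.isKilling_toF hL hk x₀, fun y w μ hw => ?_⟩
  obtain ⟨ν, hν⟩ := hd _ _ _ (hΦ.endo_inclF_of_endo_toF hKs hw)
  refine ⟨(ρ x₀ ^ 2)⁻¹ * ν, hΦ.endo_toF_of_endo_inclF hL ?_⟩
  rw [hν, ← mul_assoc, mul_inv_cancel₀ (hΦ.rho_sq_ne_zero x₀), one_mul]

variable [T2Space B] [T2Space F] [ConnectedSpace F]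

theorem intertwines_projB (hΦ : IsAdaptedWarpedProduct g D gB gF ρ Φ)
    (hL : Splits hΦ.localDiffeo L) (hk : IsKilling g L) (y₀ : F) (p : B × F) :
    Intertwines g L.1 gB (toB hΦ.localDiffeo y₀ L).1 (projB hΦ.localDiffeo p) := by
  refine ⟨1, 0, one_ne_zero, fun v => ?_⟩
  rw [one_smul, zero_smul, add_zero, hΦ.projB_endo hL]
  exact congrArg (fun T : Cotan b p.1 →ₗ[ℝ] Tan b p.1 =>
    T (gB.flat p.1 (projB hΦ.localDiffeo p v))) (hΦ.compB_eq_compB hL hk p.1 y₀ p.2)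

theorem intertwines_projF [ConnectedSpace B] (hΦ : IsAdaptedWarpedProduct g D gB gF ρ Φ)
    (hL : Splits hΦ.localDiffeo L) (hk : IsKilling g L) (x₀ : B) (p : B × F) :
    Intertwines g L.1 gF (toF hΦ.localDiffeo x₀ L).1 (projF hΦ.localDiffeo p) := by
  obtain ⟨l, -, -, hl, -⟩ := hΦ.exists_decomposition hL hk x₀ p.2
  -- On the fiber directions the endomorphism of `L` is `ρ² (l + L_F)`; solving for `L_F` gives
  -- these constants.
  refine ⟨(ρ p.1 ^ 2)⁻¹, -l p.1, inv_ne_zero (hΦ.rho_sq_ne_zero p.1), fun v => ?_⟩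
  have h1 : compF hΦ.localDiffeo L.1 p (gF.flat p.2 (projF hΦ.localDiffeo p v)) =
      l p.1 • projF hΦ.localDiffeo p v +
        endo gF (toF hΦ.localDiffeo x₀ L).1 p.2 (projF hΦ.localDiffeo p v) := by
    have h2 := congrArg (fun T : Cotan k p.2 →ₗ[ℝ] Tan k p.2 =>
      T (gF.flat p.2 (projF hΦ.localDiffeo p v))) (hl p.1 p.2)
    have h3 : gF.contra p.2 (gF.flat p.2 (projF hΦ.localDiffeo p v)) = projF hΦ.localDiffeo p v :=
      (gF.flat p.2).symm_apply_apply _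
    simp only [LinearMap.add_apply, LinearMap.smul_apply, h3] at h2
    exact h2
  rw [map_add, map_smul, map_smul, hΦ.projF_endo hL, smul_smul,
    inv_mul_cancel₀ (hΦ.rho_sq_ne_zero p.1), one_smul, h1, neg_smul]
  abel

theorem isCharacteristic_toB (hΦ : IsAdaptedWarpedProduct g D gB gF ρ Φ)
    (hK : IsCharacteristic g K) (hKs : Splits hΦ.localDiffeo K) (y₀ : F) :
    IsCharacteristic gB (toB hΦ.localDiffeo y₀ K) := by
  refine ⟨hΦ.isKilling_toB hKs hK.killing y₀, fun x => ?_, ?_⟩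
  · exact (hK.simple (Φ (x, y₀))).of_intertwines (projB_surjective hΦ.localDiffeo (x, y₀))
      (hΦ.intertwines_projB hKs hK.killing y₀ (x, y₀))
  · refine hasIntegrableEigenspaces_of_intertwines hK.integrable fun x => ?_
    obtain ⟨W, π, σ, hW, hmem, hπ, -, hπp, -, hq⟩ :=
      exists_local_projections hΦ.localDiffeo (x, y₀)
    refine ⟨W, π, Φ (x, y₀), hW, hπ, hmem, hπp, ?_, fun m hm => ?_⟩
    · have hs : ∀ m ∈ W, Function.Surjective (mfderiv (𝓡 n) (𝓡 b) π m) := by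
        intro m hm u
        obtain ⟨q, rfl, -, -, h2, -⟩ := hq m hm
        obtain ⟨v, hv⟩ := projB_surjective hΦ.localDiffeo q u
        exact ⟨v, (h2 v).trans hv⟩
      exact hs _ hmem
    · obtain ⟨q, rfl, h1, -, h2, -⟩ := hq m hm
      exact (hΦ.intertwines_projB hKs hK.killing y₀ q).congr h1 h2

theorem isCharacteristic_toF [ConnectedSpace B] (hΦ : IsAdaptedWarpedProduct g D gB gF ρ Φ)
    (hK : IsCharacteristic g K) (hKs : Splits hΦ.localDiffeo K) (x₀ : B) :
    IsCharacteristic gF (toF hΦ.localDiffeo x₀ K) := by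
  refine ⟨hΦ.isKilling_toF hKs hK.killing x₀, fun y => ?_, ?_⟩
  · exact (hK.simple (Φ (x₀, y))).of_intertwines (projF_surjective hΦ.localDiffeo (x₀, y))
      (hΦ.intertwines_projF hKs hK.killing x₀ (x₀, y))
  · refine hasIntegrableEigenspaces_of_intertwines hK.integrable fun y => ?_
    obtain ⟨W, π, σ, hW, hmem, -, hσ, -, hσp, hq⟩ :=
      exists_local_projections hΦ.localDiffeo (x₀, y)
    refine ⟨W, σ, Φ (x₀, y), hW, hσ, hmem, hσp, ?_, fun m hm => ?_⟩
    · have hs : ∀ m ∈ W, Function.Surjective (mfderiv (𝓡 n) (𝓡 k) σ m) := by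
        intro m hm w
        obtain ⟨q, rfl, -, -, -, h2⟩ := hq m hm
        obtain ⟨v, hv⟩ := projF_surjective hΦ.localDiffeo q w
        exact ⟨v, (h2 v).trans hv⟩
      exact hs _ hmem
    · obtain ⟨q, rfl, -, h1, -, h2⟩ := hq m hm
      exact (hΦ.intertwines_projF hKs hK.killing x₀ q).congr h1 h2

/-- Base components of members of `𝒦` already attain all diagonal values at `x₀`. -/
theorem isKSSpace_killingSpace_toB [ConnectedSpace M] [ConnectedSpace B]
    (hΦ : IsAdaptedWarpedProduct g D gB gF ρ Φ) (hK : IsCharacteristic g K)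
    (hKs : Splits hΦ.localDiffeo K) {𝒦 : Submodule ℝ (SymTensor n M)} (h𝒦 : IsKSSpaceOf g K 𝒦)
    (x₀ : B) (y₀ : F) : IsKSSpace gB (killingSpace gB (toB hΦ.localDiffeo y₀ K)) := by
  have hc := hΦ.isCharacteristic_toB hK hKs y₀
  refine ⟨_, hc, isKSSpaceOf_killingSpace hc (x := x₀) fun c => ?_⟩
  obtain ⟨L, hL, hLc⟩ := h𝒦.exists_endo_eq hK (Φ (x₀, y₀)) c
  have hLs := hΦ.splits_of_isDiagonalFor hK.simple hKs (h𝒦.diagonal L hL)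
  exact ⟨_, hΦ.toB_mem_killingSpace hKs hLs (h𝒦.killing L hL) (h𝒦.diagonal L hL) y₀,
    fun u μ hu => hΦ.endo_toB_of_endo_inclB hLs (hLc _ _ (hΦ.endo_inclB_of_endo_toB hKs hu))⟩

theorem isKSSpace_killingSpace_toF [ConnectedSpace M] [ConnectedSpace B]
    (hΦ : IsAdaptedWarpedProduct g D gB gF ρ Φ) (hK : IsCharacteristic g K)
    (hKs : Splits hΦ.localDiffeo K) {𝒦 : Submodule ℝ (SymTensor n M)} (h𝒦 : IsKSSpaceOf g K 𝒦)
    (x₀ : B) (y₀ : F) : IsKSSpace gF (killingSpace gF (toF hΦ.localDiffeo x₀ K)) := by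
  have hc := hΦ.isCharacteristic_toF hK hKs x₀
  refine ⟨_, hc, isKSSpaceOf_killingSpace hc (x := y₀) fun c => ?_⟩
  -- An eigenvalue `μ` of the fiber component corresponds to `ρ² μ` on `M`, both for `K` and for
  -- `L`; `c` is conjugated accordingly.
  obtain ⟨L, hL, hLc⟩ := h𝒦.exists_endo_eq hK (Φ (x₀, y₀))
    (fun s => ρ x₀ ^ 2 * c ((ρ x₀ ^ 2)⁻¹ * s))
  have hLs := hΦ.splits_of_isDiagonalFor hK.simple hKs (h𝒦.diagonal L hL)
  refine ⟨_, hΦ.toF_mem_killingSpace hKs hLs (h𝒦.killing L hL) (h𝒦.diagonal L hL) x₀,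
    fun w μ hw => hΦ.endo_toF_of_endo_inclF hLs ?_⟩
  rw [hLc _ _ (hΦ.endo_inclF_of_endo_toF hKs hw), ← mul_assoc (ρ x₀ ^ 2)⁻¹,
    inv_mul_cancel₀ (hΦ.rho_sq_ne_zero x₀), one_mul]

/-- The assembled tensor is diagonal for `K` at `(x₀, y₀)`, so some `L` in `𝒦` has this value there.
The components of `L` lie in the same rigid spaces as `LB` and `l(x₀) G_F + LF`, so agreement at one
point is agreement everywhere. The functions `l` then have equal differentials and differ by a
constant. -/
theorem exists_mem_eq_assemble [ConnectedSpace M] [ConnectedSpace B]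
    (hΦ : IsAdaptedWarpedProduct g D gB gF ρ Φ) (hK : IsCharacteristic g K)
    (hKs : Splits hΦ.localDiffeo K) {𝒦 : Submodule ℝ (SymTensor n M)} (h𝒦 : IsKSSpaceOf g K 𝒦)
    (x₀ : B) (y₀ : F) {LB : SymTensor b B}
    (hLB : LB ∈ killingSpace gB (toB hΦ.localDiffeo y₀ K)) {LF : SymTensor k F}
    (hLF : LF ∈ killingSpace gF (toF hΦ.localDiffeo x₀ K)) {l : B → ℝ} (hl : SmoothFn b l)
    (hdl : ∀ x : B, mvfderiv (𝓡 b) l x =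
      gB.flat x (LB.1 x (mvfderiv (𝓡 b) (fun x' => (ρ x' ^ 2)⁻¹) x))) :
    ∃ L ∈ 𝒦, ∀ x y, L.1 (Φ (x, y)) = assemble gF Φ x y (LB.1 x) (l x) (LF.1 y) := by
  obtain ⟨L, hL, hLT⟩ := h𝒦.exists_endo_eq_of_diagonal hK (Φ (x₀, y₀))
    (assemble gF Φ x₀ y₀ (LB.1 x₀) (l x₀) (LF.1 y₀) ∘ₗ (g.flat (Φ (x₀, y₀))).toLinearMap) (by
      intro v μ hv
      have hT : (assemble gF Φ x₀ y₀ (LB.1 x₀) (l x₀) (LF.1 y₀) ∘ₗ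
          (g.flat (Φ (x₀, y₀))).toLinearMap) v = _ :=
        hΦ.assemble_flat (LB.1 x₀) (l x₀) (LF.1 y₀) v
      rw [hT]
      have hdec := inclB_projB_add hΦ.localDiffeo (x₀, y₀) v
      -- An eigenvector of `K` is tangent to the fiber or to the base, so only one block of the
      -- assembled tensor acts on it.
      rcases hΦ.projB_eq_zero_or_projF_eq_zero hK.simple hKs hv with h0 | h0
      · rw [h0, map_zero, zero_add] at hdec
        have h1 : endo g K.1 (Φ (x₀, y₀)) (inclF Φ (x₀, y₀) (projF hΦ.localDiffeo (x₀, y₀) v)) =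
            (ρ x₀ ^ 2 * ((ρ x₀ ^ 2)⁻¹ * μ)) •
              inclF Φ (x₀, y₀) (projF hΦ.localDiffeo (x₀, y₀) v) := by
          rw [hdec, hv, ← mul_assoc, mul_inv_cancel₀ (hΦ.rho_sq_ne_zero x₀), one_mul]
        obtain ⟨ν, hν⟩ := hLF.2 y₀ _ _ (hΦ.endo_toF_of_endo_inclF hKs h1)
        have hν' : LF.1 y₀ (gF.flat y₀ (projF hΦ.localDiffeo (x₀, y₀) v)) =
          ν • projF hΦ.localDiffeo (x₀, y₀) v := hν
        refine ⟨ρ x₀ ^ 2 * (l x₀ + ν), ?_⟩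
        rw [h0, hν', ← add_smul, map_smul, hdec, map_zero, map_zero, map_zero, zero_add, smul_smul]
      · rw [h0, map_zero, add_zero] at hdec
        have h1 : endo g K.1 (Φ (x₀, y₀)) (inclB Φ (x₀, y₀) (projB hΦ.localDiffeo (x₀, y₀) v)) =
            μ • inclB Φ (x₀, y₀) (projB hΦ.localDiffeo (x₀, y₀) v) := by
          rw [hdec, hv]
        obtain ⟨ν, hν⟩ := hLB.2 x₀ _ _ (hΦ.endo_toB_of_endo_inclB hKs h1)
        have hν' : LB.1 x₀ (gB.flat x₀ (projB hΦ.localDiffeo (x₀, y₀) v)) =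
          ν • projB hΦ.localDiffeo (x₀, y₀) v := hν
        refine ⟨ν, ?_⟩
        rw [h0, hν', map_smul, hdec, map_zero, map_zero, smul_zero, add_zero, map_zero, smul_zero,
          add_zero])
  have hLs := hΦ.splits_of_isDiagonalFor hK.simple hKs (h𝒦.diagonal L hL)
  have hLk := h𝒦.killing L hL
  have hT : ∀ v, endo g L.1 (Φ (x₀, y₀)) v = _ := fun v =>
    (LinearMap.congr_fun hLT v).trans (hΦ.assemble_flat (LB.1 x₀) (l x₀) (LF.1 y₀) v)
  have hB0 : (toB hΦ.localDiffeo y₀ L).1 x₀ = LB.1 x₀ := by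
    refine eq_of_endo_eq (g := gB) (LinearMap.ext fun u => ?_)
    have h := congrArg (projB hΦ.localDiffeo (x₀, y₀)) (hT (inclB Φ (x₀, y₀) u))
    rw [hΦ.projB_endo hLs, map_add, map_smul, projB_inclB, projB_inclB, projB_inclF, smul_zero,
      add_zero] at h
    exact h
  -- The decomposition of `L` is normalized by `l' x₀ = 0`, so its fiber part over `x₀` absorbs the
  -- constant multiple `l x₀` of `G_F`.
  have hF0 : (toF hΦ.localDiffeo x₀ L).1 y₀ = (l x₀ • gF.contraTensor + LF).1 y₀ := by
    refine eq_of_endo_eq (g := gF) (LinearMap.ext fun w => ?_)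
    have h := congrArg (projF hΦ.localDiffeo (x₀, y₀)) (hT (inclF Φ (x₀, y₀) w))
    rw [hΦ.projF_endo hLs, map_add, map_smul, projF_inclF, projF_inclB, projF_inclF, zero_add] at h
    have h2 := smul_right_injective _ (hΦ.rho_sq_ne_zero x₀) h
    have h3 : gF.contra y₀ (gF.flat y₀ w) = w := (gF.flat y₀).symm_apply_apply _
    refine h2.trans ?_
    change _ = l x₀ • gF.contra y₀ (gF.flat y₀ w) + LF.1 y₀ (gF.flat y₀ w)
    rw [h3]
  have hB : toB hΦ.localDiffeo y₀ L = LB :=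
    eq_of_apply_eq (𝒦 := killingSpace gB (toB hΦ.localDiffeo y₀ K))
      (hΦ.isCharacteristic_toB hK hKs y₀) (fun T hT => hT.1) (fun T hT => hT.2)
      (hΦ.toB_mem_killingSpace hKs hLs hLk (h𝒦.diagonal L hL) y₀) hLB hB0
  have hF : toF hΦ.localDiffeo x₀ L = l x₀ • gF.contraTensor + LF :=
    eq_of_apply_eq (𝒦 := killingSpace gF (toF hΦ.localDiffeo x₀ K))
      (hΦ.isCharacteristic_toF hK hKs x₀) (fun T hT => hT.1) (fun T hT => hT.2)
      (hΦ.toF_mem_killingSpace hKs hLs hLk (h𝒦.diagonal L hL) x₀)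
      (Submodule.add_mem _ (Submodule.smul_mem _ _ (contraTensor_mem_killingSpace gF _)) hLF) hF0
  obtain ⟨l', hl', hl'0, hcomp, hdl'⟩ := hΦ.exists_decomposition hLs hLk x₀ y₀
  have hll : ∀ x, l x = l' x + l x₀ := by
    intro x
    have hs : SmoothFn b (l - l') := ContMDiff.sub hl hl'
    have h := eq_of_mvfderiv_eq_zero (f := l - l') hs (fun z => by
      rw [mvfderiv_sub (hl.mdifferentiable (by simp) z) (hl'.mdifferentiable (by simp) z), hdl,
        hdl', hB, sub_self]) x x₀
    simp only [Pi.sub_apply, hl'0] at h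
    linarith
  refine ⟨L, hL, fun x y => hΦ.eq_assemble hLs ?_ ?_⟩
  · rw [← hB]
    exact hΦ.compB_eq_compB hLs hLk x y y₀
  · have h1 : compF hΦ.localDiffeo L.1 (x₀, y) = l x₀ • gF.contra y + LF.1 y :=
      congrFun (congrArg Subtype.val hF) y
    rw [hcomp, h1, hll x, add_smul, add_assoc]

end IsAdaptedWarpedProduct

end KSSpaces

end KillingStackel

end

/-! ### The main theorem. -/

theorem mainTheorem3 {n b k : ℕ}
    {M : Type*} [TopologicalSpace M] [ChartedSpace (EuclideanSpace ℝ (Fin n)) M]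
    [IsManifold (𝓡 n) ∞ M] [T2Space M] [ConnectedSpace M]
    {B : Type*} [TopologicalSpace B] [ChartedSpace (EuclideanSpace ℝ (Fin b)) B]
    [IsManifold (𝓡 b) ∞ B] [T2Space B] [ConnectedSpace B]
    {F : Type*} [TopologicalSpace F] [ChartedSpace (EuclideanSpace ℝ (Fin k)) F]
    [IsManifold (𝓡 k) ∞ F] [T2Space F] [ConnectedSpace F]
    (g : KillingStackel.PseudoRiemannianMetric n M)
    (K : KillingStackel.SymTensor n M)
    (hK : KillingStackel.IsCharacteristic g K)
    (𝒦 : Submodule ℝ (KillingStackel.SymTensor n M))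
    (h𝒦 : KillingStackel.IsKSSpaceOf g K 𝒦)
    (D : ∀ x : M, Submodule ℝ (KillingStackel.Tan n x))
    (hD : KillingStackel.IsKillingDistribution g D)
    (hKD : KillingStackel.IsInvariant g K D)
    (gB : KillingStackel.PseudoRiemannianMetric b B)
    (gF : KillingStackel.PseudoRiemannianMetric k F)
    (ρ : B → ℝ) (Φ : B × F → M)
    (hΦ : KillingStackel.IsAdaptedWarpedProduct g D gB gF ρ Φ) :
    ∃ (𝒦B : Submodule ℝ (KillingStackel.SymTensor b B))
      (𝒦F : Submodule ℝ (KillingStackel.SymTensor k F)),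
      KillingStackel.IsKSSpace gB 𝒦B ∧ KillingStackel.IsKSSpace gF 𝒦F ∧
      -- `L` is an arbitrary contravariant 2-tensor field on the open set `Φ (B × F)` of `M`
      ∀ L : ∀ p : B × F, KillingStackel.Cotan n (Φ p) →ₗ[ℝ] KillingStackel.Tan n (Φ p),
        (∃ L' ∈ 𝒦, ∀ p, L p = L'.1 (Φ p)) ↔
        ∃ LB ∈ 𝒦B, ∃ LF ∈ 𝒦F, ∃ l : B → ℝ, KillingStackel.SmoothFn b l ∧
          (∀ (x : B) (y : F), L (x, y) =
            KillingStackel.push (fun x' => Φ (x', y)) x (LB.1 x) +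
            l x • KillingStackel.push (fun y' => Φ (x, y')) y (gF.contra y) +
            KillingStackel.push (fun y' => Φ (x, y')) y (LF.1 y)) ∧
          (∀ x : B, mvfderiv (𝓡 b) l x =
            gB.flat x (LB.1 x (mvfderiv (𝓡 b) (fun x' => (ρ x' ^ 2)⁻¹) x))) := by
  obtain ⟨x₀⟩ : Nonempty B := inferInstance
  obtain ⟨y₀⟩ : Nonempty F := inferInstance
  have hKs := hΦ.splits_of_invariant hKD
  refine ⟨KillingStackel.killingSpace gB (KillingStackel.toB hΦ.localDiffeo y₀ K),
    KillingStackel.killingSpace gF (KillingStackel.toF hΦ.localDiffeo x₀ K),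
    hΦ.isKSSpace_killingSpace_toB hK hKs h𝒦 x₀ y₀, hΦ.isKSSpace_killingSpace_toF hK hKs h𝒦 x₀ y₀,
    fun L => ⟨?_, ?_⟩⟩
  · rintro ⟨L', hL', hL⟩
    have hLs := hΦ.splits_of_isDiagonalFor hK.simple hKs (h𝒦.diagonal L' hL')
    have hLk := h𝒦.killing L' hL'
    obtain ⟨l, hl, -, hcomp, hdl⟩ := hΦ.exists_decomposition hLs hLk x₀ y₀
    refine ⟨_, hΦ.toB_mem_killingSpace hKs hLs hLk (h𝒦.diagonal L' hL') y₀, _,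
      hΦ.toF_mem_killingSpace hKs hLs hLk (h𝒦.diagonal L' hL') x₀, l, hl, fun x y => ?_, hdl⟩
    rw [hL]
    exact hΦ.eq_assemble hLs (hΦ.compB_eq_compB hLs hLk x y y₀) (hcomp x y)
  · rintro ⟨LB, hLB, LF, hLF, l, hl, hL, hdl⟩
    obtain ⟨L', hL', h⟩ := hΦ.exists_mem_eq_assemble hK hKs h𝒦 x₀ y₀ hLB hLF hl hdl
    exact ⟨L', hL', fun p => (hL p.1 p.2).trans (h p.1 p.2).symm⟩
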